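/- For a (nonempty, finite) fan $\Delta$ of strongly convex rational polyhedral cones in $N_{\mathbb R}$, $N=\mathbb Z^n$, with dual lattice $M$, and a commutative ring $R$, let $X(\Delta,R)$ denote the toric variety over $\operatorname{Spec}R$ obtained by gluing the affine schemes $U_\sigma=\operatorname{Spec}R[\sigma^\vee\cap M]$, $\sigma\in\Delta$, along the open immersions $U_\tau\to U_\sigma$ for the faces $\tau$ of $\sigma$. A ring homomorphism $R\to R'$ induces a canonical morphism $X(\Delta,R')\to X(\Delta,R)$. On an integral locally noetherian scheme, a divisor is a Weil divisor, that is, a locally finite formal combination of points of codimension one, with coefficients in $\mathbb Z$ (or in $\mathbb Q$, for a $\mathbb Q$-divisor). It is an effective Cartier divisor if it is locally the divisor of a nonzero regular function. A $\mathbb Q$-divisor $H$ is ample if some multiple $mH$, $m\ge 1$ an integer, is the divisor of a nonzero rational section of an ample invertible sheaf. For a flat morphism $g$ and a divisor $E$ on its target, $g^*E$ is the divisor whose coefficient at a point $x$ of codimension one is the coefficient of $E$ at $g(x)$ times the length of $\mathcal O_{X,x}/\mathfrak m_{g(x)}\mathcal O_{X,x}$. **Theorem 3.6.** Let $K$ be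 a field of characteristic zero and let $X=X(\Delta,K)$ be a proper toric variety over $K$. Let $D$ be an effective divisor, $L$ an ample invertible sheaf and $H$ an ample $\mathbb Q$-divisor on $X$. Then there exist a finitely generated $\mathbb Z$-subalgebra $A\subseteq K$ and, on the toric variety $\mathcal X=X(\Delta,A)$ over $\operatorname{Spec}A$, an effective divisor $\mathcal D$, an ample invertible sheaf $\mathcal L$ and an ample $\mathbb Q$-divisor $\mathcal H$, such that $\mathcal X$ is proper over $\operatorname{Spec}A$ and $(X,D,L,H)$ is deduced from $(\mathcal X,\mathcal D,\mathcal L,\mathcal H)$ by base change: the canonical morphism $g:X\to\mathcal X$ makes $X$ the fibre product $\mathcal X\times_{\operatorname{Spec}A}\operatorname{Spec}K$, and $D=g^*\mathcal D$, $L\cong g^*\mathcal L$ and $H=g^*\mathcal H$. If moreover $D$ is an effective Cartier divisor, then $\mathcal D$ can be chosen to be an effective Cartier divisor as well. -/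

import Mathlib

open CategoryTheory Limits AlgebraicGeometry TopologicalSpace

universe u

noncomputable section

namespace ToricModel

/-! ### Cones and fans in `N = ℤⁿ`, with dual lattice `M = ℤⁿ` -/

/-- The pairing `⟨m, v⟩ = ∑ mᵢ vᵢ` of a lattice character `m ∈ M = ℤⁿ` with `v ∈ N_ℝ = ℝⁿ`. -/
def pairing {n : ℕ} (m : Fin n → ℤ) (v : Fin n → ℝ) : ℝ := ∑ i, (m i : ℝ) * v i

/-- A (rational polyhedral) cone is generated by finitely many lattice vectors. -/
def IsRationalPolyhedral {n : ℕ} (σ : PointedCone ℝ (Fin n → ℝ)) : Prop :=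
  ∃ S : Finset (Fin n → ℤ), σ = PointedCone.hull ℝ {w | ∃ v ∈ S, w = fun i => (v i : ℝ)}

/-- The monoid `σ^∨ ∩ M` of lattice characters that are nonnegative on `σ`. -/
def dualMonoid {n : ℕ} (σ : PointedCone ℝ (Fin n → ℝ)) : AddSubmonoid (Fin n → ℤ) where
  carrier := {m | ∀ v ∈ σ, 0 ≤ pairing m v}
  zero_mem' := fun v _ => by simp [pairing]
  add_mem' := fun {a b} ha hb v hv => by
    have h : pairing (a + b) v = pairing a v + pairing b v := by
      simp [pairing, add_mul, Finset.sum_add_distrib]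
    rw [h]
    exact add_nonneg (ha v hv) (hb v hv)

/-- `τ = σ ∩ u^⊥` for some `u ∈ σ^∨ ∩ M`. For a rational polyhedral cone `σ` every face is cut out
by such a lattice character, so this is the usual notion of a face. -/
def IsFace {n : ℕ} (τ σ : PointedCone ℝ (Fin n → ℝ)) : Prop :=
  ∃ u ∈ dualMonoid σ, ∀ v, v ∈ τ ↔ v ∈ σ ∧ pairing u v = 0

/-- A fan in `N_ℝ = ℝⁿ`: a nonempty finite set of strongly convex rational polyhedral cones which
contains the faces of its members, and in which any two members meet in a common face. -/
structure Fan (n : ℕ) where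
  cones : Set (PointedCone ℝ (Fin n → ℝ))
  finite : cones.Finite
  nonempty : cones.Nonempty
  rational : ∀ σ ∈ cones, IsRationalPolyhedral σ
  stronglyConvex : ∀ σ ∈ cones, ∀ v ∈ σ, -v ∈ σ → v = 0
  face_mem : ∀ σ ∈ cones, ∀ τ, IsFace τ σ → τ ∈ cones
  inter_face : ∀ σ ∈ cones, ∀ τ ∈ cones, IsFace (σ ⊓ τ) σ

lemma pairing_add {n : ℕ} (a b : Fin n → ℤ) (v : Fin n → ℝ) :
    pairing (a + b) v = pairing a v + pairing b v := by
  simp [pairing, add_mul, Finset.sum_add_distrib]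

lemma pairing_nsmul {n : ℕ} (k : ℕ) (a : Fin n → ℤ) (v : Fin n → ℝ) :
    pairing (k • a) v = k * pairing a v := by
  simp [pairing, Finset.mul_sum, mul_assoc]

lemma dualMonoid_anti {n : ℕ} {τ σ : PointedCone ℝ (Fin n → ℝ)} (h : τ ≤ σ) :
    dualMonoid σ ≤ dualMonoid τ := fun _ hm v hv => hm v (h hv)

/-- If `τ = σ ∩ u^⊥`, then `m + k u ∈ σ^∨` for `m ∈ τ^∨ ∩ M` and `k` large. -/
lemma exists_add_nsmul_mem {n : ℕ} {τ σ : PointedCone ℝ (Fin n → ℝ)}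
    (hσ : IsRationalPolyhedral σ) {u : Fin n → ℤ} (hu : u ∈ dualMonoid σ)
    (hτ : ∀ v, v ∈ τ ↔ v ∈ σ ∧ pairing u v = 0) {m : Fin n → ℤ} (hm : m ∈ dualMonoid τ) :
    ∃ k : ℕ, m + k • u ∈ dualMonoid σ := by
  obtain ⟨S, hS⟩ := hσ
  have gen : ∀ v ∈ S, (fun i => (v i : ℝ)) ∈ σ := fun v hv => by
    rw [hS]; exact Submodule.subset_span ⟨v, hv, rfl⟩
  have key : ∀ v ∈ S, ∃ k : ℕ, ∀ l : ℕ, k ≤ l →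
      0 ≤ pairing m (fun i => (v i : ℝ)) + l * pairing u (fun i => (v i : ℝ)) := by
    intro v hv
    rcases (hu _ (gen v hv)).eq_or_lt with h | h
    · refine ⟨0, fun l _ => ?_⟩
      rw [← h, mul_zero, add_zero]
      exact hm _ ((hτ _).2 ⟨gen v hv, h.symm⟩)
    · obtain ⟨k, hk⟩ := exists_nat_ge (-pairing m (fun i => (v i : ℝ)) /
        pairing u (fun i => (v i : ℝ)))
      refine ⟨k, fun l hl => ?_⟩
      rw [div_le_iff₀ h] at hk
      have : (k : ℝ) * pairing u (fun i => (v i : ℝ)) ≤ l * pairing u (fun i => (v i : ℝ)) := by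
        gcongr
      linarith
  choose! k hk using key
  refine ⟨S.sup k, fun v hv => ?_⟩
  rw [hS] at hv
  induction hv using Submodule.span_induction with
  | mem x hx =>
    obtain ⟨w, hw, rfl⟩ := hx
    rw [pairing_add, pairing_nsmul]
    exact hk w hw _ (Finset.le_sup hw)
  | zero => simp [pairing]
  | add x y _ _ hx hy =>
    have : pairing (m + S.sup k • u) (x + y) =
        pairing (m + S.sup k • u) x + pairing (m + S.sup k • u) y := by
      simp only [pairing, Pi.add_apply x y, mul_add, Finset.sum_add_distrib]
    rw [this]; exact add_nonneg hx hy
  | smul a x _ hx =>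
    have : pairing (m + S.sup k • u) (a • x) = a * pairing (m + S.sup k • u) x := by
      simp only [pairing, Finset.mul_sum]
      refine Finset.sum_congr rfl fun i _ => ?_
      change _ * ((a : ℝ) * x i) = _
      ring
    rw [this]; exact mul_nonneg a.2 hx

/-! ### Affine charts `U_σ = Spec R[σ^∨ ∩ M]` and their gluing -/

/-- The coordinate ring `R[σ^∨ ∩ M]`. -/
abbrev ChartRing (R : Type u) [CommRing R] {n : ℕ} (σ : PointedCone ℝ (Fin n → ℝ)) : Type u :=
  AddMonoidAlgebra R (dualMonoid σ)

/-- The inclusion `R[σ^∨ ∩ M] ⊆ R[τ^∨ ∩ M]` for `τ ⊆ σ`. -/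
abbrev chartRingMap (R : Type u) [CommRing R] {n : ℕ} {τ σ : PointedCone ℝ (Fin n → ℝ)}
    (h : τ ≤ σ) : ChartRing R σ →+* ChartRing R τ :=
  AddMonoidAlgebra.mapDomainRingHom R (AddSubmonoid.inclusion (dualMonoid_anti h))

/-- For a face `τ = σ ∩ u^⊥`, the ring `R[τ^∨ ∩ M]` is the localization of `R[σ^∨ ∩ M]` at the
character of `u`. -/
lemma isLocalization_chartRing (R : Type u) [CommRing R] {n : ℕ}
    {τ σ : PointedCone ℝ (Fin n → ℝ)} (h : τ ≤ σ) (hσ : IsRationalPolyhedral σ)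
    {u : Fin n → ℤ} (hu : u ∈ dualMonoid σ) (hτ : ∀ v, v ∈ τ ↔ v ∈ σ ∧ pairing u v = 0) :
    letI := (chartRingMap R h).toAlgebra
    IsLocalization.Away (AddMonoidAlgebra.single (⟨u, hu⟩ : dualMonoid σ) (1 : R) : ChartRing R σ)
      (ChartRing R τ) := by
  let := (chartRingMap R h).toAlgebra
  have hmap : ∀ x, algebraMap (ChartRing R σ) (ChartRing R τ) x = chartRingMap R h x :=
    fun _ => rfl
  have hneg : -u ∈ dualMonoid τ := fun v hv => by
    have : pairing (-u) v = - pairing u v := by simp [pairing]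
    rw [this, ((hτ v).1 hv).2, neg_zero]
  have hpow : ∀ k : ℕ, (AddMonoidAlgebra.single (⟨u, hu⟩ : dualMonoid σ) (1 : R) :
      ChartRing R σ) ^ k = AddMonoidAlgebra.single (k • (⟨u, hu⟩ : dualMonoid σ)) 1 := by
    intro k; rw [AddMonoidAlgebra.single_pow, one_pow]
  refine ⟨?_, ?_, ?_⟩
  · rintro ⟨_, k, rfl⟩
    change IsUnit (algebraMap (ChartRing R σ) (ChartRing R τ)
      ((AddMonoidAlgebra.single (⟨u, hu⟩ : dualMonoid σ) (1 : R)) ^ k))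
    rw [map_pow]
    refine IsUnit.pow k (IsUnit.of_mul_eq_one (AddMonoidAlgebra.single ⟨-u, hneg⟩ 1) ?_)
    rw [hmap, AddMonoidAlgebra.mapDomainRingHom_apply, AddMonoidAlgebra.mapDomain_single,
      AddMonoidAlgebra.single_mul_single, AddMonoidAlgebra.one_def, one_mul]
    congr 1
    exact Subtype.ext (add_neg_cancel u)
  · intro z
    suffices H : ∃ (k : ℕ) (a : ChartRing R σ), z * algebraMap _ (ChartRing R τ)
        ((AddMonoidAlgebra.single (⟨u, hu⟩ : dualMonoid σ) (1 : R)) ^ k) = algebraMap _ _ a by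
      obtain ⟨k, a, H⟩ := H
      exact ⟨(a, ⟨_, k, rfl⟩), H⟩
    induction z using AddMonoidAlgebra.induction_linear with
    | zero => exact ⟨0, 0, by simp⟩
    | add x y hx hy =>
      obtain ⟨k, a, ha⟩ := hx
      obtain ⟨l, b, hb⟩ := hy
      refine ⟨k + l, a * (AddMonoidAlgebra.single (⟨u, hu⟩ : dualMonoid σ) (1 : R)) ^ l +
        b * (AddMonoidAlgebra.single (⟨u, hu⟩ : dualMonoid σ) (1 : R)) ^ k, ?_⟩
      rw [map_add, map_mul, map_mul, ← ha, ← hb, pow_add, map_mul]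
      ring
    | single m r =>
      obtain ⟨k, hk⟩ := exists_add_nsmul_mem hσ hu hτ m.2
      refine ⟨k, AddMonoidAlgebra.single ⟨_, hk⟩ r, ?_⟩
      rw [hpow, hmap, hmap, AddMonoidAlgebra.mapDomainRingHom_apply,
        AddMonoidAlgebra.mapDomainRingHom_apply, AddMonoidAlgebra.mapDomain_single,
        AddMonoidAlgebra.mapDomain_single, AddMonoidAlgebra.single_mul_single, mul_one]
      congr 1
  · intro a b hab
    refine ⟨1, ?_⟩
    have inj : Function.Injective (chartRingMap R h) :=
      AddMonoidAlgebra.mapDomain_injective (AddSubmonoid.inclusion_injective _)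
    rw [inj hab]

lemma IsFace.le {n : ℕ} {τ σ : PointedCone ℝ (Fin n → ℝ)} (h : IsFace τ σ) : τ ≤ σ := by
  obtain ⟨u, _, hu⟩ := h
  exact fun v hv => ((hu v).1 hv).1

/-- The affine toric scheme `U_σ = Spec R[σ^∨ ∩ M]`. -/
abbrev chart (R : Type u) [CommRing R] {n : ℕ} (σ : PointedCone ℝ (Fin n → ℝ)) : Scheme.{u} :=
  Spec (CommRingCat.of (ChartRing R σ))

/-- The morphism `U_τ ⟶ U_σ` for `τ ⊆ σ`. -/
abbrev chartMap (R : Type u) [CommRing R] {n : ℕ} {τ σ : PointedCone ℝ (Fin n → ℝ)}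
    (h : τ ≤ σ) : chart R τ ⟶ chart R σ :=
  Spec.map (CommRingCat.ofHom (chartRingMap R h))

lemma isOpenImmersion_chartMap (R : Type u) [CommRing R] {n : ℕ}
    {τ σ : PointedCone ℝ (Fin n → ℝ)} (h : τ ≤ σ) (hσ : IsRationalPolyhedral σ)
    (hτ : IsFace τ σ) : IsOpenImmersion (chartMap R h) := by
  obtain ⟨u, hu, hτ⟩ := hτ
  let := (chartRingMap R h).toAlgebra
  have := isLocalization_chartRing R h hσ hu hτ
  exact IsOpenImmersion.of_isLocalization
    (AddMonoidAlgebra.single (⟨u, hu⟩ : dualMonoid σ) (1 : R) : ChartRing R σ)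

lemma range_chartMap (R : Type u) [CommRing R] {n : ℕ}
    {τ σ : PointedCone ℝ (Fin n → ℝ)} (h : τ ≤ σ) (hσ : IsRationalPolyhedral σ)
    {u : Fin n → ℤ} (hu : u ∈ dualMonoid σ) (hτ : ∀ v, v ∈ τ ↔ v ∈ σ ∧ pairing u v = 0) :
    Set.range (chartMap R h) = (PrimeSpectrum.basicOpen
      (AddMonoidAlgebra.single (⟨u, hu⟩ : dualMonoid σ) (1 : R) : ChartRing R σ) :
        Set (PrimeSpectrum (ChartRing R σ))) := by
  let := (chartRingMap R h).toAlgebra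
  have := isLocalization_chartRing R h hσ hu hτ
  exact PrimeSpectrum.localization_away_comap_range (ChartRing R τ) _

/-- The diagram of the charts `U_σ` for `σ ∈ Δ`, with the morphisms `U_τ ⟶ U_σ` for `τ ⊆ σ`. -/
def diagram {n : ℕ} (Δ : Fan n) (R : Type u) [CommRing R] : Δ.cones ⥤ Scheme.{u} where
  obj σ := chart R σ.1
  map f := chartMap R (leOfHom f)
  map_id σ := by
    refine Eq.trans ?_ (Spec.map_id (CommRingCat.of (ChartRing R σ.1)))
    refine congrArg Spec.map (CommRingCat.hom_ext ?_)
    exact AddMonoidAlgebra.mapDomainRingHom_id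
  map_comp f g := by
    refine Eq.trans ?_ (Spec.map_comp _ _)
    refine congrArg Spec.map (CommRingCat.hom_ext ?_)
    exact AddMonoidAlgebra.mapDomainRingHom_comp
      (AddSubmonoid.inclusion (dualMonoid_anti (leOfHom f)))
      (AddSubmonoid.inclusion (dualMonoid_anti (leOfHom g)))

lemma Fan.isFace_of_le {n : ℕ} (Δ : Fan n) {τ σ : PointedCone ℝ (Fin n → ℝ)} (hτ : τ ∈ Δ.cones)
    (hσ : σ ∈ Δ.cones) (h : τ ≤ σ) : IsFace τ σ := by
  have := Δ.inter_face σ hσ τ hτ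
  rwa [inf_eq_right.2 h] at this

instance {n : ℕ} (Δ : Fan n) (R : Type u) [CommRing R] {σ τ : Δ.cones} (f : σ ⟶ τ) :
    IsOpenImmersion ((diagram Δ R).map f) :=
  isOpenImmersion_chartMap R (leOfHom f) (Δ.rational _ τ.2)
    (Δ.isFace_of_le σ.2 τ.2 (leOfHom f))

instance {n : ℕ} (Δ : Fan n) (R : Type u) [CommRing R] :
    (diagram Δ R ⋙ Scheme.forget).IsLocallyDirected where
  cond {i j k} fi fj xi xj hx := by
    have hij : i.1 ⊓ j.1 ∈ Δ.cones := Δ.face_mem _ i.2 _ (Δ.inter_face _ i.2 _ j.2)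
    let l : Δ.cones := ⟨i.1 ⊓ j.1, hij⟩
    have li : l ≤ i := (inf_le_left : i.1 ⊓ j.1 ≤ i.1)
    have lj : l ≤ j := (inf_le_right : i.1 ⊓ j.1 ≤ j.1)
    change (diagram Δ R).map fi xi = (diagram Δ R).map fj xj at hx
    obtain ⟨a, ha, hai⟩ := Δ.isFace_of_le i.2 k.2 (leOfHom fi)
    obtain ⟨b, hb, hbj⟩ := Δ.isFace_of_le j.2 k.2 (leOfHom fj)
    have hl : ∀ v, v ∈ i.1 ⊓ j.1 ↔ v ∈ k.1 ∧ pairing (a + b) v = 0 := by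
      intro v
      rw [Submodule.mem_inf, hai, hbj, pairing_add]
      constructor
      · rintro ⟨⟨h, h1⟩, _, h2⟩
        exact ⟨h, by rw [h1, h2, add_zero]⟩
      · rintro ⟨h, h1⟩
        have := ha v h
        have := hb v h
        exact ⟨⟨h, by linarith⟩, h, by linarith⟩
    have ri := range_chartMap R (leOfHom fi) (Δ.rational _ k.2) ha hai
    have rj := range_chartMap R (leOfHom fj) (Δ.rational _ k.2) hb hbj
    have rl := range_chartMap R ((leOfHom (homOfLE li)).trans (leOfHom fi)) (Δ.rational _ k.2)
      (add_mem ha hb) hl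
    have hmul : (AddMonoidAlgebra.single (⟨a + b, add_mem ha hb⟩ : dualMonoid k.1) (1 : R) :
        ChartRing R k.1) = AddMonoidAlgebra.single ⟨a, ha⟩ 1 * AddMonoidAlgebra.single ⟨b, hb⟩ 1 := by
      rw [AddMonoidAlgebra.single_mul_single, one_mul]; rfl
    rw [hmul, PrimeSpectrum.basicOpen_mul, Opens.coe_inf, ← ri, ← rj] at rl
    obtain ⟨y, hy⟩ : (diagram Δ R).map fi xi ∈ Set.range ((diagram Δ R).map (homOfLE li ≫ fi)) := by
      refine rl.symm ▸ ⟨⟨xi, rfl⟩, ⟨xj, hx.symm⟩⟩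
    refine ⟨l, homOfLE li, homOfLE lj, y, ?_, ?_⟩
    · apply ((diagram Δ R).map fi).isOpenEmbedding.injective
      rw [← hy, Functor.map_comp]; rfl
    · apply ((diagram Δ R).map fj).isOpenEmbedding.injective
      rw [← hx, ← hy, Subsingleton.elim (homOfLE li ≫ fi) (homOfLE lj ≫ fj), Functor.map_comp]
      rfl

/-- The toric variety `X(Δ, R)`: the charts `U_σ`, `σ ∈ Δ`, glued along the open immersions
`U_τ ⟶ U_σ` for `τ ⊆ σ`; in it `U_σ ∩ U_τ = U_{σ ∩ τ}`. -/
def toricVariety {n : ℕ} (Δ : Fan n) (R : Type u) [CommRing R] : Scheme.{u} :=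
  colimit (diagram Δ R)

/-- The structure morphism `X(Δ, R) ⟶ Spec R`. -/
def toricStr {n : ℕ} (Δ : Fan n) (R : Type u) [CommRing R] :
    toricVariety Δ R ⟶ Spec (CommRingCat.of R) :=
  colimit.desc (diagram Δ R)
    { pt := Spec (CommRingCat.of R)
      ι :=
        { app := fun σ => Spec.map (CommRingCat.ofHom (algebraMap R (ChartRing R σ.1)))
          naturality := fun σ τ f => by
            change chartMap R (leOfHom f) ≫ _ = _ ≫ 𝟙 _
            rw [Category.comp_id, ← Spec.map_comp, ← CommRingCat.ofHom_comp]
            congr 2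
            ext r
            simp } }

/-- The canonical morphism `X(Δ, R') ⟶ X(Δ, R)` induced by a ring homomorphism `R → R'`. -/
def toricMap {n : ℕ} (Δ : Fan n) {R R' : Type u} [CommRing R] [CommRing R'] (φ : R →+* R') :
    toricVariety Δ R' ⟶ toricVariety Δ R :=
  colimMap
    { app := fun σ => Spec.map (CommRingCat.ofHom (AddMonoidAlgebra.mapRingHom (dualMonoid σ.1) φ))
      naturality := fun σ τ f => by
        change chartMap R' (leOfHom f) ≫ _ = _ ≫ chartMap R (leOfHom f)
        rw [← Spec.map_comp, ← Spec.map_comp, ← CommRingCat.ofHom_comp, ← CommRingCat.ofHom_comp]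
        congr 2
        ext <;> simp }

/-! ### Invertible sheaves and ampleness -/

section Sheaves

open MonoidalCategory

/-- The tensor product of two `𝒪_X`-modules: the sheafification of the presheaf tensor product. -/
def tensorSheaf {X : Scheme.{u}} (M N : X.Modules) : X.Modules :=
  (PresheafOfModules.sheafification (𝟙 X.ringCatSheaf.obj)).obj
    (MonoidalCategory.tensorObj
      (C := PresheafOfModules.{u} (X.presheaf ⋙ forget₂ CommRingCat RingCat)) M.val N.val)

/-- The tensor powers `M^{⊗ k}`. -/
def tensorPower {X : Scheme.{u}} (M : X.Modules) : ℕ → X.Modules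
  | 0 => SheafOfModules.unit X.ringCatSheaf
  | k + 1 => tensorSheaf (tensorPower M k) M

/-- The restriction of a section of `M` to a smaller open set. -/
def res {X : Scheme.{u}} {M : X.Modules} {U V : X.Opens} (h : V ≤ U) (s : Γ(M, U)) : Γ(M, V) :=
  M.presheaf.map (homOfLE h).op s

/-- The section `s` of `M` over `U` freely generates `M|_U`, i.e. `𝒪_U ⟶ M|_U`, `a ↦ a s`,
is an isomorphism. -/
def Trivializes {X : Scheme.{u}} {M : X.Modules} {U : X.Opens} (s : Γ(M, U)) : Prop :=
  ∀ (V : X.Opens) (h : V ≤ U), Function.Bijective (fun a : Γ(X, V) => a • res h s)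

/-- An invertible sheaf: an `𝒪_X`-module which is locally free of rank one. -/
def IsInvertible {X : Scheme.{u}} (M : X.Modules) : Prop :=
  ∀ x : X, ∃ U : X.Opens, x ∈ U ∧ ∃ s : Γ(M, U), Trivializes s

/-- The open locus `X_s` where the global section `s` generates `M`. -/
def nonvanishingLocus {X : Scheme.{u}} {M : X.Modules} (s : Γ(M, ⊤)) : X.Opens :=
  sSup {U | Trivializes (res (le_top : U ≤ ⊤) s)}

/-- An ample invertible sheaf on a quasi-compact scheme: the affine sets of the form `X_s`, with `s`
a global section of a positive tensor power, cover `X`. -/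
def IsAmple {X : Scheme.{u}} (M : X.Modules) : Prop :=
  CompactSpace X ∧ IsInvertible M ∧
    ∀ x : X, ∃ k : ℕ, 0 < k ∧ ∃ s : Γ(tensorPower M k, ⊤),
      x ∈ nonvanishingLocus s ∧ IsAffineOpen (nonvanishingLocus s)

end Sheaves

/-! ### Weil divisors -/

/-- A Weil divisor with coefficients in `R` (`R = ℤ` or `ℚ`): a locally finite formal
`R`-combination of points of codimension one, i.e. of prime divisors. -/
def WeilDivisor (X : Scheme.{u}) (R : Type*) [Zero R] :=
  {D : AlgebraicCycle X R // ∀ x : X, D x ≠ 0 → Order.coheight x = 1}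

/-- The coefficient of the prime divisor with generic point `x`. -/
def WeilDivisor.coeff {X : Scheme.{u}} {R : Type*} [Zero R] (D : WeilDivisor X R) (x : X) : R :=
  D.1 x

/-- An effective divisor. -/
def IsEffective {X : Scheme.{u}} (D : WeilDivisor X ℤ) : Prop := ∀ x : X, 0 ≤ D.coeff x

/-- An effective Cartier divisor: a Weil divisor which, locally on `X`, is the divisor of a nonzero
regular function. -/
def IsEffectiveCartier {X : Scheme.{u}} (D : WeilDivisor X ℤ) : Prop :=
  ∃ (_ : IsIntegral X) (_ : IsLocallyNoetherian X),
    ∀ x : X, ∃ (U : X.Opens) (_ : Nonempty U) (f : Γ(X, U)), x ∈ U ∧ f ≠ 0 ∧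
      ∀ y ∈ U, D.coeff y = Scheme.ord (X.germToFunctionField U f) y

/-- `E` is the divisor of the rational section `s` of the invertible sheaf `M`: if `t` trivializes
`M` over `V` and `s = f t`, then `E` and the divisor of the rational function `f` agree on `V`. -/
def IsDivisorOfSection {X : Scheme.{u}} [IsIntegral X] [IsLocallyNoetherian X] {M : X.Modules}
    {U : X.Opens} (s : Γ(M, U)) (E : WeilDivisor X ℤ) : Prop :=
  ∀ (V : X.Opens) (t : Γ(M, V)), Trivializes t →
    ∀ (_ : Nonempty (U ⊓ V : X.Opens)) (f : Γ(X, U ⊓ V)),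
      res inf_le_left s = f • res inf_le_right t →
        ∀ x ∈ V, E.coeff x = Scheme.ord (X.germToFunctionField (U ⊓ V) f) x

/-- An ample `ℚ`-divisor: some positive integral multiple `m H` is the divisor of a nonzero rational
section of an ample invertible sheaf, i.e. `m H` is an ample Cartier divisor. -/
def IsAmpleQDivisor {X : Scheme.{u}} (H : WeilDivisor X ℚ) : Prop :=
  ∃ (_ : IsIntegral X) (_ : IsLocallyNoetherian X) (m : ℕ) (E : WeilDivisor X ℤ) (M : X.Modules)
    (U : X.Opens) (s : Γ(M, U)),
    0 < m ∧ (∀ x : X, (E.coeff x : ℚ) = m * H.coeff x) ∧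
      IsAmple M ∧ (U : Set X).Nonempty ∧ s ≠ 0 ∧ IsDivisorOfSection s E

/-- The multiplicity at `x` of the fibre of `g` through `x`: the length of
`𝒪_{X,x} / 𝔪_{g(x)} 𝒪_{X,x}`. -/
def fibreMultiplicity {X Y : Scheme.{u}} (g : X ⟶ Y) (x : X) : ℕ :=
  (Module.length (X.presheaf.stalk x) (X.presheaf.stalk x ⧸
    (IsLocalRing.maximalIdeal (Y.presheaf.stalk (g x))).map (g.stalkMap x).hom)).toNat

/-- `D = g^* E` for a flat morphism `g`: the pullback of a prime divisor `Z ⊆ Y` is the divisor of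
the scheme-theoretic preimage `g⁻¹(Z)`, whose components are counted with their multiplicities. -/
def IsPullbackDivisor {X Y : Scheme.{u}} (g : X ⟶ Y) {R : Type*} [Semiring R]
    (E : WeilDivisor Y R) (D : WeilDivisor X R) : Prop :=
  ∀ x : X, Order.coheight x = 1 → D.coeff x = fibreMultiplicity g x * E.coeff (g x)

end ToricModel

end

open ToricModel

/-! The field `K` is the directed union of its finitely generated subalgebras `A`, and `X(Δ, K)` is
the base change of `X(Δ, A)` (`isPullback_toricMap`), hence the limit of these schemes along affine
morphisms (`isLimitToricCone`). Open sets, functions, and inclusions or identities between finitely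
many of them therefore descend to all sufficiently large `A`. Each demand on `A` is phrased as `∀ᶠ A
in atTop`, so that finitely many of them can be met at once.

Properness needs no limit argument. Separatedness over `K` says that characters of `σ ∩ τ` are sums
of characters of `σ` and of `τ` (`Fan.separates_of_isSeparated`), universal closedness produces
nonnegative relations between characters (`Fan.isComplete_of_universallyClosed`), and finite type
makes the dual monoids finitely generated. These properties of the fan no longer involve `K`, and
they imply the valuative criterion over every noetherian ring (`isProper_toricStr`).

A prime divisor of `X` is cut out in an affine open set by finitely many functions. Once these are
defined over `A`, its generic point is the only point of codimension one above its image, and its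
multiplicity is one (`isDescended_of_lifts`). A divisor is then descended by keeping its
coefficients on the images of its components (`descend`); no component is vertical, i.e. outside the
image of `X`. A local equation of a Cartier divisor might vanish at vertical points of codimension
one. Such a point is, in a chart, the prime ideal generated by a prime of `A`, so it contains no
function with an invertible coefficient; putting the inverse of one coefficient into `A` removes the
problem (`eventually_isGood_spread`). At the other points of codimension one, orders are compared by
flatness (`ord_sub_ord_eq`).

An invertible sheaf with generators `tᵢ` whose transition functions are defined over `A` descends to
the subsheaf of its direct image generated by the `tᵢ` (`exists_descended_sheaf`). Functions over
`A` inject into functions over `K`, so identities can be checked over `K`. Descending the sections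
with affine nonvanishing loci gives ampleness (`eventually_isAmple`); writing a rational section as
fractions times generators gives the statement on `ℚ`-divisors (`eventually_isDivisorOfSection`). -/

noncomputable section

namespace ToricModel

/-! ### Charts of toric varieties and base change -/

section Charts

variable {n : ℕ} (Δ : Fan n)

/-- The inclusion of the chart `U_σ` in the toric variety. -/
def chartι (R : Type u) [CommRing R] (σ : Δ.cones) : chart R σ.1 ⟶ toricVariety Δ R :=
  colimit.ι (diagram Δ R) σ

instance (R : Type u) [CommRing R] (σ : Δ.cones) : IsOpenImmersion (chartι Δ R σ) :=
  inferInstanceAs (IsOpenImmersion (colimit.ι (diagram Δ R) σ))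

/-- The cover of the toric variety by its charts. -/
def chartCover (R : Type u) [CommRing R] : (toricVariety Δ R).OpenCover :=
  Scheme.IsLocallyDirected.openCover (diagram Δ R)

lemma exists_chartι_eq (R : Type u) [CommRing R] (x : toricVariety Δ R) :
    ∃ (σ : Δ.cones) (y : chart R σ.1), chartι Δ R σ y = x :=
  Scheme.IsLocallyDirected.ι_jointly_surjective (diagram Δ R) x

lemma toricVariety_hom_ext {R : Type u} [CommRing R] {Z : Scheme.{u}}
    {f g : toricVariety Δ R ⟶ Z} (h : ∀ σ, chartι Δ R σ ≫ f = chartι Δ R σ ≫ g) : f = g :=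
  colimit.hom_ext h

lemma chartMap_chartι (R : Type u) [CommRing R] {τ σ : Δ.cones} (h : τ ≤ σ) :
    chartMap R (show τ.1 ≤ σ.1 from h) ≫ chartι Δ R σ = chartι Δ R τ :=
  colimit.w (diagram Δ R) (homOfLE h)

lemma chartι_apply_eq_iff (R : Type u) [CommRing R] {σ τ : Δ.cones} (x : chart R σ.1)
    (y : chart R τ.1) : chartι Δ R σ x = chartι Δ R τ y ↔
      ∃ (ρ : Δ.cones) (h : ρ ≤ σ) (h' : ρ ≤ τ) (z : chart R ρ.1),
        chartMap R (show ρ.1 ≤ σ.1 from h) z = x ∧ chartMap R (show ρ.1 ≤ τ.1 from h') z = y := by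
  refine (Scheme.IsLocallyDirected.ι_eq_ι_iff (diagram Δ R)).trans ?_
  exact ⟨fun ⟨k, f, g, z, h⟩ => ⟨k, leOfHom f, leOfHom g, z, h⟩,
    fun ⟨k, f, g, z, h⟩ => ⟨k, homOfLE f, homOfLE g, z, h⟩⟩

/-- The morphism of affine charts induced by a ring homomorphism. -/
abbrev chartBaseMap {R R' : Type u} [CommRing R] [CommRing R'] (φ : R →+* R')
    (σ : PointedCone ℝ (Fin n → ℝ)) : chart R' σ ⟶ chart R σ :=
  Spec.map (CommRingCat.ofHom (AddMonoidAlgebra.mapRingHom (dualMonoid σ) φ))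

variable {R R' R'' : Type u} [CommRing R] [CommRing R'] [CommRing R''] (φ : R →+* R')
  (ψ : R' →+* R'')

lemma chartι_toricMap (σ : Δ.cones) :
    chartι Δ R' σ ≫ toricMap Δ φ = chartBaseMap φ σ.1 ≫ chartι Δ R σ :=
  ι_colimMap _ _

lemma chartι_toricStr (σ : Δ.cones) :
    chartι Δ R σ ≫ toricStr Δ R = Spec.map (CommRingCat.ofHom (algebraMap R (ChartRing R σ.1))) :=
  colimit.ι_desc _ _

lemma toricMap_toricStr :
    toricMap Δ φ ≫ toricStr Δ R = toricStr Δ R' ≫ Spec.map (CommRingCat.ofHom φ) := by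
  refine toricVariety_hom_ext Δ fun σ => ?_
  rw [← Category.assoc, chartι_toricMap, Category.assoc, chartι_toricStr, ← Category.assoc,
    chartι_toricStr, ← Spec.map_comp, ← Spec.map_comp, ← CommRingCat.ofHom_comp, ← CommRingCat.ofHom_comp]
  congr 2
  exact AddMonoidAlgebra.mapRingHom_comp_algebraMap φ

lemma toricMap_id : toricMap Δ (RingHom.id R) = 𝟙 _ := by
  refine toricVariety_hom_ext Δ fun σ => ?_
  rw [chartι_toricMap, Category.comp_id, chartBaseMap, AddMonoidAlgebra.mapRingHom_id]
  exact (congrArg (· ≫ _) (Spec.map_id _)).trans (Category.id_comp _)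

lemma toricMap_comp : toricMap Δ (ψ.comp φ) = toricMap Δ ψ ≫ toricMap Δ φ := by
  refine toricVariety_hom_ext Δ fun σ => ?_
  rw [chartι_toricMap, ← Category.assoc, chartι_toricMap, Category.assoc, chartι_toricMap,
    ← Category.assoc, chartBaseMap, AddMonoidAlgebra.mapRingHom_comp, CommRingCat.ofHom_comp, Spec.map_comp]

/-- The intersection of two cones of a fan. -/
def Fan.inter (σ τ : Δ.cones) : Δ.cones :=
  ⟨σ.1 ⊓ τ.1, Δ.face_mem _ σ.2 _ (Δ.inter_face _ σ.2 _ τ.2)⟩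

lemma Fan.inter_le_left (σ τ : Δ.cones) : Δ.inter σ τ ≤ σ := (inf_le_left : σ.1 ⊓ τ.1 ≤ σ.1)

lemma Fan.inter_le_right (σ τ : Δ.cones) : Δ.inter σ τ ≤ τ := (inf_le_right : σ.1 ⊓ τ.1 ≤ τ.1)

/-- Both ranges are the nonvanishing locus of the same character, and base change preserves
characters. -/
lemma range_chartMap_baseMap {τ σ : PointedCone ℝ (Fin n → ℝ)} (h : τ ≤ σ)
    (hσ : IsRationalPolyhedral σ) (hτ : IsFace τ σ) :
    chartBaseMap φ σ ⁻¹' Set.range (chartMap R h) = Set.range (chartMap R' h) := by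
  obtain ⟨u, hu, hτ⟩ := hτ
  rw [range_chartMap R h hσ hu hτ, range_chartMap R' h hσ hu hτ]
  ext x
  change AddMonoidAlgebra.mapRingHom (dualMonoid σ) φ _ ∉ x.asIdeal ↔ _ ∉ x.asIdeal
  rw [AddMonoidAlgebra.mapRingHom_single, map_one]

/-- If a point of `U_τ` maps into `U_σ`, its image lies in `U_ρ` for some `ρ` contained in both
cones; by `range_chartMap_baseMap` the point itself then lies in `U_ρ`. This reduces the fibre
product statement to affine charts. -/
lemma toricMap_preimage_opensRange (σ : Δ.cones) :
    toricMap Δ φ ⁻¹ᵁ (chartι Δ R σ).opensRange = (chartι Δ R' σ).opensRange := by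
  ext x
  constructor
  · rintro ⟨y, hy⟩
    obtain ⟨τ, x, rfl⟩ := exists_chartι_eq Δ R' x
    rw [← Scheme.Hom.comp_apply, chartι_toricMap, Scheme.Hom.comp_apply,
      chartι_apply_eq_iff] at hy
    obtain ⟨ρ, hρσ, hρτ, z, -, hz⟩ := hy
    have : x ∈ chartBaseMap φ τ.1 ⁻¹' Set.range (chartMap R (show ρ.1 ≤ τ.1 from hρτ)) := ⟨z, hz⟩
    rw [range_chartMap_baseMap φ _ (Δ.rational _ τ.2) (Δ.isFace_of_le ρ.2 τ.2 hρτ)] at this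
    obtain ⟨w, rfl⟩ := this
    rw [← Scheme.Hom.comp_apply, chartMap_chartι Δ R' hρτ, ← chartMap_chartι Δ R' hρσ]
    exact ⟨_, rfl⟩
  · rintro ⟨y, rfl⟩
    refine ⟨chartBaseMap φ σ.1 y, ?_⟩
    rw [← Scheme.Hom.comp_apply, ← Scheme.Hom.comp_apply, chartι_toricMap]

lemma isPullback_chartι_toricMap (σ : Δ.cones) :
    IsPullback (chartBaseMap φ σ.1) (chartι Δ R' σ) (chartι Δ R σ) (toricMap Δ φ) :=
  IsOpenImmersion.isPullback _ _ _ _ (chartι_toricMap Δ φ σ)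
    (toricMap_preimage_opensRange Δ φ σ)

lemma isPullback_chartBaseMap (σ : PointedCone ℝ (Fin n → ℝ)) :
    IsPullback (chartBaseMap φ σ)
      (Spec.map (CommRingCat.ofHom (algebraMap R' (ChartRing R' σ))))
      (Spec.map (CommRingCat.ofHom (algebraMap R (ChartRing R σ))))
      (Spec.map (CommRingCat.ofHom φ)) := by
  algebraize [φ]
  let := AddMonoidAlgebra.algebraAddMonoidAlgebra (M := dualMonoid σ) (R := R) (S := R')
  have : IsScalarTower R (ChartRing R σ) (ChartRing R' σ) :=
    .of_algebraMap_eq' (AddMonoidAlgebra.mapRingHom_comp_algebraMap (algebraMap R R')).symm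
  have h := CommRingCat.isPushout_of_isPushout R R' (ChartRing R σ) (ChartRing R' σ)
  exact isPullback_SpecMap_of_isPushout _ _ _ _ h.flip

/-- `X(Δ, R')` is the base change of `X(Δ, R)`. -/
theorem isPullback_toricMap :
    IsPullback (toricMap Δ φ) (toricStr Δ R') (toricStr Δ R) (Spec.map (CommRingCat.ofHom φ)) := by
  refine Scheme.isPullback_of_openCover _ _ _ _ (chartCover Δ R) fun σ => ?_
  have h1 := isPullback_chartι_toricMap Δ φ σ
  have h2 := isPullback_chartBaseMap φ σ.1
  refine h2.of_iso (h1.flip.isoPullback) (Iso.refl _) (Iso.refl _) (Iso.refl _) ?_ ?_ ?_ ?_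
  · simp only [Iso.refl_hom]
    exact (h1.flip.isoPullback_hom_snd).symm
  · simp only [Iso.refl_hom, Category.comp_id]
    refine ((chartι_toricStr Δ σ).symm.trans ?_)
    exact ((congrArg (· ≫ toricStr Δ R') h1.flip.isoPullback_hom_fst).symm).trans
      (Category.assoc _ _ _)
  · simp only [Iso.refl_hom, Category.comp_id]
    exact (chartι_toricStr Δ σ).symm
  · simp

end Charts

/-! ### Integrality, finiteness, flatness and dominance -/

section Properties

variable {n : ℕ}

/-- The property is inherited from `ℤⁿ`; it is what makes the monoid algebra over a domain a domain.
-/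
instance uniqueSums_dualMonoid (σ : PointedCone ℝ (Fin n → ℝ)) : UniqueSums (dualMonoid σ) :=
  UniqueSums.of_injective_addHom (dualMonoid σ).subtype.toAddHom Subtype.val_injective
    inferInstance

variable (Δ : Fan n) (R : Type u) [CommRing R]

instance isDomain_chartRing [IsDomain R] (σ : PointedCone ℝ (Fin n → ℝ)) :
    IsDomain (ChartRing R σ) := inferInstance

instance finite_cones : Finite Δ.cones := Δ.finite

instance nonempty_cones : Nonempty Δ.cones := Δ.nonempty.to_subtype

instance finite_chartCover : Finite (chartCover Δ R).I₀ := Δ.finite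

instance isAffine_chartCover (σ) : IsAffine ((chartCover Δ R).X σ) :=
  inferInstanceAs (IsAffine (chart R σ.1))

instance compactSpace_toricVariety : CompactSpace (toricVariety Δ R) :=
  (chartCover Δ R).compactSpace

/-- The charts are integral, and any two of them meet because `σ ∩ τ` is again in the fan and has a
nonempty chart. -/
instance isIntegral_toricVariety [IsDomain R] : IsIntegral (toricVariety Δ R) := by
  have : IsReduced (toricVariety Δ R) := by
    have : ∀ i, IsReduced ((chartCover Δ R).X i) := fun i =>
      inferInstanceAs (IsReduced (chart R i.1))
    exact IsReduced.of_openCover _ (chartCover Δ R)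
  have hU : IsOpenCover fun σ : Δ.cones => (chartι Δ R σ).opensRange :=
    (chartCover Δ R).isOpenCover_opensRange
  have : PreirreducibleSpace (toricVariety Δ R) := by
    refine PreirreducibleSpace.of_isOpenCover ?_ hU fun σ => ?_
    · intro σ τ _ h
      have z : chart R (Δ.inter σ τ).1 := genericPoint _
      have h1 : chartι Δ R (Δ.inter σ τ) z ∈ (chartι Δ R σ).opensRange := by
        rw [← chartMap_chartι Δ R (Δ.inter_le_left σ τ)]; exact ⟨_, rfl⟩
      have h2 : chartι Δ R (Δ.inter σ τ) z ∈ (chartι Δ R τ).opensRange := by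
        rw [← chartMap_chartι Δ R (Δ.inter_le_right σ τ)]; exact ⟨_, rfl⟩
      exact (disjoint_iff.1 h).le ⟨h1, h2⟩
    · refine Subtype.preirreducibleSpace ?_
      have := (PreirreducibleSpace.isPreirreducible_univ (X := chart R σ.1)).image
        (chartι Δ R σ) (chartι Δ R σ).continuous.continuousOn
      rwa [Set.image_univ] at this
  obtain ⟨σ⟩ := nonempty_cones Δ
  have : Nonempty (toricVariety Δ R) := ⟨chartι Δ R σ (genericPoint (chart R σ.1))⟩
  have : IrreducibleSpace (toricVariety Δ R) := ⟨inferInstance⟩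
  exact isIntegral_of_irreducibleSpace_of_isReduced _

instance quasiCompact_toricStr : QuasiCompact (toricStr Δ R) := inferInstance

instance flat_toricStr : Flat (toricStr Δ R) := by
  have : IsZariskiLocalAtSource @Flat.{u} :=
    HasRingHomProperty.instIsZariskiLocalAtSource (Q := RingHom.Flat)
  refine (IsZariskiLocalAtSource.iff_of_openCover (P := @Flat) (chartCover Δ R)).mpr ?_
  suffices h : ∀ σ : Δ.cones, Flat (chartι Δ R σ ≫ toricStr Δ R) from h
  intro σ
  rw [chartι_toricStr, Flat.SpecMap_iff, CommRingCat.hom_ofHom, RingHom.flat_algebraMap_iff]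
  infer_instance

/-- The monoids do not depend on the ring, so finite generation read off over one ring serves over
all others. -/
lemma fg_dualMonoid_of_locallyOfFiniteType [Nontrivial R] [LocallyOfFiniteType (toricStr Δ R)]
    (σ : Δ.cones) : AddMonoid.FG (dualMonoid σ.1) := by
  have h : LocallyOfFiniteType (chartι Δ R σ ≫ toricStr Δ R) := inferInstance
  rw [chartι_toricStr, HasRingHomProperty.Spec_iff (P := @LocallyOfFiniteType),
    CommRingCat.hom_ofHom, RingHom.finiteType_algebraMap] at h
  exact AddMonoidAlgebra.fg_of_finiteType (R := R)

lemma locallyOfFiniteType_toricStr (h : ∀ σ : Δ.cones, AddMonoid.FG (dualMonoid σ.1)) :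
    LocallyOfFiniteType (toricStr Δ R) := by
  have : IsZariskiLocalAtSource @LocallyOfFiniteType.{u} :=
    HasRingHomProperty.instIsZariskiLocalAtSource (Q := RingHom.FiniteType)
  refine (IsZariskiLocalAtSource.iff_of_openCover (P := @LocallyOfFiniteType)
    (chartCover Δ R)).mpr ?_
  suffices h : ∀ σ : Δ.cones, LocallyOfFiniteType (chartι Δ R σ ≫ toricStr Δ R) from h
  intro σ
  have := h σ
  rw [chartι_toricStr, HasRingHomProperty.Spec_iff (P := @LocallyOfFiniteType),
    CommRingCat.hom_ofHom, RingHom.finiteType_algebraMap]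
  infer_instance

variable {R} {R' : Type u} [CommRing R'] (φ : R →+* R')

instance isAffineHom_toricMap : IsAffineHom (toricMap Δ φ) :=
  MorphismProperty.of_isPullback (isPullback_toricMap Δ φ).flip inferInstance

lemma flat_toricMap (h : φ.Flat) : Flat (toricMap Δ φ) :=
  MorphismProperty.of_isPullback (isPullback_toricMap Δ φ).flip (Flat.SpecMap_iff.2 h)

/-- A dominant morphism to an integral affine scheme is scheme-theoretically dominant, and this
survives base change along the flat morphism `toricStr`. The consequence used later is that pullback
of functions along `toricMap` is injective. -/
lemma isSchemeTheoreticallyDominant_toricMap [IsDomain R] (h : Function.Injective φ) :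
    IsSchemeTheoreticallyDominant (toricMap Δ φ) := by
  have : IsDominant (Spec.map (CommRingCat.ofHom φ)) := by
    refine ⟨(PrimeSpectrum.denseRange_comap_iff_ker_le_nilRadical φ).2 ?_⟩
    rw [(RingHom.injective_iff_ker_eq_bot _).1 h]
    exact bot_le
  have : IsSchemeTheoreticallyDominant (Spec.map (CommRingCat.ofHom φ)) := .of_isDominant _
  exact .of_isPullback (isPullback_toricMap Δ φ).flip

end Properties

/-! ### Separation and completeness of a fan in terms of characters -/

section Combinatorics

variable {n : ℕ}

/-- Characters that are nonnegative on `σ ∩ τ` are sums of characters of `σ` and of `τ`. -/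
def Fan.Separates (Δ : Fan n) : Prop :=
  ∀ σ τ : Δ.cones, ∀ m ∈ dualMonoid (σ.1 ⊓ τ.1),
    ∃ a ∈ dualMonoid σ.1, ∃ b ∈ dualMonoid τ.1, m = a + b

/-- A form of completeness of a fan: characters `m_σ ∈ σ^∨` satisfy a nontrivial relation with
nonnegative coefficients. -/
def Fan.IsComplete (Δ : Fan n) : Prop :=
  ∀ m : Δ.cones → Fin n → ℤ, (∀ σ, m σ ∈ dualMonoid σ.1) →
    ∃ c : Δ.cones → ℕ, c ≠ 0 ∧ ∑ᶠ σ, c σ • m σ = 0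

/-- The sum of a finite set of generators of a cone detects the characters orthogonal to it. -/
lemma exists_interior_vector {σ : PointedCone ℝ (Fin n → ℝ)} (hσ : IsRationalPolyhedral σ) :
    ∃ w : Fin n → ℝ, w ∈ σ ∧ ∀ m ∈ dualMonoid σ, pairing m w = 0 → ∀ v ∈ σ, pairing m v = 0 := by
  obtain ⟨S, rfl⟩ := hσ
  have gen : ∀ v ∈ S, (fun i => (v i : ℝ)) ∈
      PointedCone.hull ℝ {w | ∃ v ∈ S, w = fun i => (v i : ℝ)} :=
    fun v hv => Submodule.subset_span ⟨v, hv, rfl⟩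
  refine ⟨∑ v ∈ S, fun i => (v i : ℝ), Submodule.sum_mem _ gen, fun m hm h => ?_⟩
  have hsum : pairing m (∑ v ∈ S, fun i => (v i : ℝ)) = ∑ v ∈ S, pairing m (fun i => (v i : ℝ)) := by
    simp only [pairing, Finset.sum_apply, Finset.mul_sum]
    exact Finset.sum_comm
  rw [hsum, Finset.sum_eq_zero_iff_of_nonneg fun v hv => hm _ (gen v hv)] at h
  intro v hv
  induction hv using Submodule.span_induction with
  | mem x hx => obtain ⟨w, hw, rfl⟩ := hx; exact h w hw
  | zero => simp [pairing]
  | add x y _ _ hx hy =>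
    have : pairing m (x + y) = pairing m x + pairing m y := by
      simp only [pairing, Pi.add_apply x y, mul_add, Finset.sum_add_distrib]
    rw [this, hx, hy, add_zero]
  | smul a x _ hx =>
    have : pairing m (a • x) = a * pairing m x := by
      simp only [pairing, Finset.mul_sum]
      refine Finset.sum_congr rfl fun i _ => ?_
      change _ * ((a : ℝ) * x i) = _
      ring
    rw [this, hx, mul_zero]

lemma pairing_sum {ι : Type*} (s : Finset ι) (m : ι → Fin n → ℤ) (v : Fin n → ℝ) :
    pairing (∑ i ∈ s, m i) v = ∑ i ∈ s, pairing (m i) v := by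
  classical
  induction s using Finset.induction_on with
  | empty => simp [pairing]
  | insert a s ha ih => rw [Finset.sum_insert ha, Finset.sum_insert ha, pairing_add, ih]

lemma pairing_neg (m : Fin n → ℤ) (v : Fin n → ℝ) : pairing (-m) v = - pairing m v := by
  simp [pairing]

/-- The face of a cone cut out by a character. -/
def faceOf (σ : PointedCone ℝ (Fin n → ℝ)) (m : Fin n → ℤ) : PointedCone ℝ (Fin n → ℝ) where
  carrier := {v | v ∈ σ ∧ pairing m v = 0}
  zero_mem' := ⟨zero_mem _, by simp [pairing]⟩
  add_mem' := fun {a b} ha hb => ⟨add_mem ha.1 hb.1, by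
    have : pairing m (a + b) = pairing m a + pairing m b := by
      simp only [pairing, Pi.add_apply a b, mul_add, Finset.sum_add_distrib]
    rw [this, ha.2, hb.2, add_zero]⟩
  smul_mem' := fun c x hx => ⟨Submodule.smul_mem _ c hx.1, by
    have : pairing m (c • x) = c * pairing m x := by
      simp only [pairing, Finset.mul_sum]
      refine Finset.sum_congr rfl fun i _ => ?_
      change _ * ((c : ℝ) * x i) = _
      ring
    rw [this, hx.2, mul_zero]⟩

lemma mem_faceOf {σ : PointedCone ℝ (Fin n → ℝ)} {m : Fin n → ℤ} {v : Fin n → ℝ} :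
    v ∈ faceOf σ m ↔ v ∈ σ ∧ pairing m v = 0 := Iff.rfl

/-- If `σ` does not contain `σ₀`, some character of `σ` is negative on the interior of `σ₀`. -/
lemma Fan.Separates.exists_neg {Δ : Fan n} (h : Δ.Separates) {σ₀ σ : Δ.cones} (hσ : ¬ σ₀ ≤ σ)
    {w : Fin n → ℝ} (hw : w ∈ σ₀.1)
    (hw' : ∀ m ∈ dualMonoid σ₀.1, pairing m w = 0 → ∀ v ∈ σ₀.1, pairing m v = 0) :
    ∃ a ∈ dualMonoid σ.1, pairing a w < 0 := by
  obtain ⟨u, hu, hu'⟩ := Δ.inter_face _ σ₀.2 _ σ.2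
  -- As `u` vanishes on `σ ∩ σ₀`, its negative is a character there and splits as `a + b`; at `w`
  -- one has `b ≥ 0` and `u > 0`, which forces `a < 0`.
  have hneg : -u ∈ dualMonoid (σ.1 ⊓ σ₀.1) := fun v hv => by
    rw [pairing_neg, ((hu' v).1 ⟨hv.2, hv.1⟩).2, neg_zero]
  obtain ⟨a, ha, b, hb, hab⟩ := h σ σ₀ _ hneg
  refine ⟨a, ha, ?_⟩
  have h1 := hb w hw
  have h2 : 0 < pairing u w := by
    refine (hu w hw).lt_of_ne fun h0 => hσ fun v hv => ?_
    exact ((hu' v).2 ⟨hv, hw' u hu h0.symm v hv⟩).2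
  have h3 := pairing_add a b w
  rw [← hab, pairing_neg] at h3
  linarith

end Combinatorics

/-! ### Points of charts with values in fields and local rings -/

section ChartPoints

variable {n : ℕ} (Δ : Fan n)

/-- Points of two charts are identified through the chart of some cone contained in both, hence
contained in `σ ∩ τ`. -/
lemma isPullback_chartMap (R : Type u) [CommRing R] (σ τ : Δ.cones) :
    IsPullback (chartMap R (Δ.inter_le_left σ τ)) (chartMap R (Δ.inter_le_right σ τ))
      (chartι Δ R σ) (chartι Δ R τ) := by
  have : IsOpenImmersion (chartMap R (Δ.inter_le_right σ τ)) :=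
    isOpenImmersion_chartMap R _ (Δ.rational _ τ.2)
      (Δ.isFace_of_le (Δ.inter σ τ).2 τ.2 (Δ.inter_le_right σ τ))
  refine IsOpenImmersion.isPullback _ _ _ _ ?_ ?_
  · rw [chartMap_chartι Δ R (Δ.inter_le_left σ τ), chartMap_chartι Δ R (Δ.inter_le_right σ τ)]
  · ext x
    constructor
    · rintro ⟨y, hy⟩
      obtain ⟨ρ, h1, h2, z, -, rfl⟩ := (chartι_apply_eq_iff Δ R y x).1 hy
      have h3 : ρ ≤ Δ.inter σ τ := (le_inf h1 h2 : ρ.1 ≤ σ.1 ⊓ τ.1)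
      refine ⟨chartMap R h3 z, ?_⟩
      rw [← Scheme.Hom.comp_apply]
      have := (diagram Δ R).map_comp (homOfLE h3) (homOfLE (Δ.inter_le_right σ τ))
      exact congr($(this.symm) z)
    · rintro ⟨y, rfl⟩
      refine ⟨chartMap R (Δ.inter_le_left σ τ) y, ?_⟩
      rw [← Scheme.Hom.comp_apply, ← Scheme.Hom.comp_apply,
        chartMap_chartι Δ R (Δ.inter_le_left σ τ), chartMap_chartι Δ R (Δ.inter_le_right σ τ)]

/-- A morphism from the spectrum of a local ring whose closed point maps to a chart factors
through it. -/
lemma exists_eq_specMap_chartι (R : Type u) [CommRing R] {O : Type u} [CommRing O] [IsLocalRing O]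
    (l : Spec (CommRingCat.of O) ⟶ toricVariety Δ R) (σ : Δ.cones)
    (h : l (IsLocalRing.closedPoint O) ∈ Set.range (chartι Δ R σ)) :
    ∃ β : ChartRing R σ.1 →+* O, l = Spec.map (CommRingCat.ofHom β) ≫ chartι Δ R σ := by
  have hl : Set.range l ⊆ Set.range (chartι Δ R σ) := by
    rintro _ ⟨y, rfl⟩
    have : l ⁻¹ᵁ (chartι Δ R σ).opensRange = ⊤ :=
      Scheme.preimage_eq_top_of_closedPoint_mem (R := CommRingCat.of O) l h
    exact this.ge (Set.mem_univ y)
  refine ⟨(Spec.preimage (IsOpenImmersion.lift (chartι Δ R σ) l hl)).hom, ?_⟩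
  rw [CommRingCat.ofHom_hom, Spec.map_preimage, IsOpenImmersion.lift_fac]

/-- Points of two charts with the same image come from the intersection of the charts. -/
lemma exists_hom_inter {R : Type u} [CommRing R] {F : Type u} [CommRing F] {σ τ : Δ.cones}
    {α : ChartRing R σ.1 →+* F} {β : ChartRing R τ.1 →+* F}
    (h : Spec.map (CommRingCat.ofHom α) ≫ chartι Δ R σ =
      Spec.map (CommRingCat.ofHom β) ≫ chartι Δ R τ) :
    ∃ γ : ChartRing R (Δ.inter σ τ).1 →+* F,
      γ.comp (chartRingMap R (Δ.inter_le_left σ τ)) = α ∧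
      γ.comp (chartRingMap R (Δ.inter_le_right σ τ)) = β := by
  have hp := isPullback_chartMap Δ R σ τ
  refine ⟨(Spec.preimage (hp.lift _ _ h)).hom, ?_, ?_⟩
  · have := hp.lift_fst _ _ h
    rw [← Spec.map_preimage (hp.lift _ _ h), ← Spec.map_comp] at this
    exact congr($(Spec.map_injective this).hom)
  · have := hp.lift_snd _ _ h
    rw [← Spec.map_preimage (hp.lift _ _ h), ← Spec.map_comp] at this
    exact congr($(Spec.map_injective this).hom)

/-- A homomorphism to `F` with values in a subring `O` on constants and characters factors
through `O`. -/
lemma exists_lift_of_characters {R : Type u} [CommRing R] {σ : PointedCone ℝ (Fin n → ℝ)}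
    {O F : Type*} [CommRing O] [CommRing F] {i : O →+* F} (hi : Function.Injective i)
    (α : ChartRing R σ →+* F) (h : ∀ r, α (algebraMap R _ r) ∈ i.range)
    (h' : ∀ m, α (AddMonoidAlgebra.single m 1) ∈ i.range) :
    ∃ β : ChartRing R σ →+* O, i.comp β = α := by
  have H : ∀ x, α x ∈ i.range := by
    intro x
    induction x using AddMonoidAlgebra.induction_linear with
    | zero => rw [map_zero]; exact zero_mem _
    | add x y hx hy => rw [map_add]; exact add_mem hx hy
    | single m r =>
      have : (AddMonoidAlgebra.single m r : ChartRing R σ) =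
          algebraMap _ _ r * AddMonoidAlgebra.single m 1 := by
        simp [AddMonoidAlgebra.single_mul_single]
      rw [this, map_mul]
      exact mul_mem (h r) (h' m)
  have hbij : Function.Bijective i.rangeRestrict :=
    ⟨fun a b hab => hi (congrArg Subtype.val hab), i.rangeRestrict_surjective⟩
  let e : O ≃+* i.range := RingEquiv.ofBijective i.rangeRestrict hbij
  refine ⟨e.symm.toRingHom.comp (α.codRestrict i.range H), RingHom.ext fun x => ?_⟩
  exact congrArg Subtype.val (e.apply_symm_apply (α.codRestrict i.range H x))

end ChartPoints

/-! ### Separatedness splits characters of an intersection -/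

section Separated

variable {n : ℕ} (Δ : Fan n)

lemma surjective_of_isClosedImmersion {A B : Type u} [CommRing A] [CommRing B] (φ : A →+* B)
    (_ : IsClosedImmersion (Spec.map (CommRingCat.ofHom φ))) : Function.Surjective φ := by
  have h1 : Function.Surjective (Spec.map (CommRingCat.ofHom φ)).appTop :=
    (IsClosedImmersion.isAffine_surjective_of_isAffine (Spec.map (CommRingCat.ofHom φ))).2
  have h2 := Scheme.ΓSpecIso_naturality (CommRingCat.ofHom φ)
  intro z
  obtain ⟨w, hw⟩ := h1 ((Scheme.ΓSpecIso (CommRingCat.of B)).inv z)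
  refine ⟨(Scheme.ΓSpecIso (CommRingCat.of A)).hom w, ?_⟩
  have h3 : (Scheme.ΓSpecIso (CommRingCat.of B)).hom
      ((Spec.map (CommRingCat.ofHom φ)).appTop w) =
      φ ((Scheme.ΓSpecIso (CommRingCat.of A)).hom w) := congr($h2 w)
  rw [← h3, hw]
  simp

-- The morphism `U_{σ ∩ τ} ⟶ U_σ × U_τ` is a base change of the diagonal, hence a closed immersion,
-- so `R[σ^∨ ∩ M] ⊗ R[τ^∨ ∩ M]` surjects onto the coordinate ring of `U_{σ ∩ τ}`. The character of
-- `m` is then in the image, all of whose exponents are sums of the desired form.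
set_option maxHeartbeats 1000000 in
open TensorProduct in
lemma Fan.separates_of_isSeparated (R : Type u) [CommRing R] [Nontrivial R]
    [IsSeparated (toricStr Δ R)] : Δ.Separates := by
  intro σ τ m hm
  let A := ChartRing R σ.1
  let B := ChartRing R τ.1
  let C := ChartRing R (Δ.inter σ τ).1
  let f : A →ₐ[R] C := AddMonoidAlgebra.mapDomainAlgHom R R
    (AddSubmonoid.inclusion (dualMonoid_anti (Δ.inter_le_left σ τ)))
  let g : B →ₐ[R] C := AddMonoidAlgebra.mapDomainAlgHom R R
    (AddSubmonoid.inclusion (dualMonoid_anti (Δ.inter_le_right σ τ)))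
  let θ : A ⊗[R] B →ₐ[R] C := Algebra.TensorProduct.productMap f g
  have hp := isPullback_chartMap Δ R σ τ
  let h : chart R (Δ.inter σ τ).1 ⟶ pullback (chartι Δ R σ ≫ toricStr Δ R)
    (chartι Δ R τ ≫ toricStr Δ R) :=
    hp.isoPullback.hom ≫ pullback.mapDesc (chartι Δ R σ) (chartι Δ R τ) (toricStr Δ R)
  have : IsClosedImmersion h := inferInstance
  let e : pullback (chartι Δ R σ ≫ toricStr Δ R) (chartι Δ R τ ≫ toricStr Δ R) ≅
      Spec (CommRingCat.of (A ⊗[R] B)) :=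
    pullback.congrHom (chartι_toricStr Δ σ) (chartι_toricStr Δ τ) ≪≫ pullbackSpecIso R A B
  have hθ : h ≫ e.hom = Spec.map (CommRingCat.ofHom θ.toRingHom) := by
    rw [← cancel_mono e.inv, Category.assoc, e.hom_inv_id, Category.comp_id]
    refine pullback.hom_ext ?_ ?_
    · have h1 : e.inv ≫ pullback.fst _ _ = Spec.map (CommRingCat.ofHom
          (Algebra.TensorProduct.includeLeft : A →ₐ[R] A ⊗[R] B).toRingHom) := by
        simp only [e, Iso.trans_inv, Category.assoc, pullback.congrHom_inv]
        refine (congrArg ((pullbackSpecIso R A B).inv ≫ ·) (pullback.lift_fst _ _ _)).trans ?_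
        exact (congrArg _ (Category.comp_id _)).trans (pullbackSpecIso_inv_fst R A B)
      have h2 : h ≫ pullback.fst _ _ = chartMap R (Δ.inter_le_left σ τ) := by
        simp only [h, Category.assoc]
        refine (congrArg (hp.isoPullback.hom ≫ ·) (pullback.lift_fst _ _ _)).trans ?_
        exact (congrArg _ (Category.comp_id _)).trans hp.isoPullback_hom_fst
      rw [h2, Category.assoc, h1, ← Spec.map_comp, ← CommRingCat.ofHom_comp]
      exact congrArg (fun F : A →ₐ[R] C => Spec.map (CommRingCat.ofHom F.toRingHom))
        (Algebra.TensorProduct.productMap_left f g).symm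
    · have h1 : e.inv ≫ pullback.snd _ _ = Spec.map (CommRingCat.ofHom
          (Algebra.TensorProduct.includeRight : B →ₐ[R] A ⊗[R] B).toRingHom) := by
        simp only [e, Iso.trans_inv, Category.assoc, pullback.congrHom_inv]
        refine (congrArg ((pullbackSpecIso R A B).inv ≫ ·) (pullback.lift_snd _ _ _)).trans ?_
        exact (congrArg _ (Category.comp_id _)).trans (pullbackSpecIso_inv_snd R A B)
      have h2 : h ≫ pullback.snd _ _ = chartMap R (Δ.inter_le_right σ τ) := by
        simp only [h, Category.assoc]
        refine (congrArg (hp.isoPullback.hom ≫ ·) (pullback.lift_snd _ _ _)).trans ?_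
        exact (congrArg _ (Category.comp_id _)).trans hp.isoPullback_hom_snd
      rw [h2, Category.assoc, h1, ← Spec.map_comp, ← CommRingCat.ofHom_comp]
      exact congrArg (fun F : B →ₐ[R] C => Spec.map (CommRingCat.ofHom F.toRingHom))
        (Algebra.TensorProduct.productMap_right f g).symm
  have hcl : IsClosedImmersion (Spec.map (CommRingCat.ofHom θ.toRingHom)) := by
    rw [← hθ]; infer_instance
  have hsurj : Function.Surjective θ := surjective_of_isClosedImmersion θ.toRingHom hcl
  obtain ⟨z, hz⟩ := hsurj (AddMonoidAlgebra.single ⟨m, hm⟩ 1)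
  -- The condition on exponents is stable under addition, so tensors of monomials suffice.
  have key : ∀ z : A ⊗[R] B, ∀ m', (θ z).coeff m' ≠ 0 →
      ∃ a ∈ dualMonoid σ.1, ∃ b ∈ dualMonoid τ.1, m'.1 = a + b := by
    intro z
    induction z with
    | zero => intro m' h; simp at h
    | add x y hx hy =>
      intro m' h
      rw [map_add, AddMonoidAlgebra.coeff_add, Finsupp.add_apply] at h
      by_cases h0 : (θ x).coeff m' = 0
      · rw [h0, zero_add] at h; exact hy m' h
      · exact hx m' h0
    | tmul a b =>
      induction a using AddMonoidAlgebra.induction_linear with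
      | zero => intro m' h; simp at h
      | add x y hx hy =>
        intro m' h
        rw [TensorProduct.add_tmul, map_add, AddMonoidAlgebra.coeff_add, Finsupp.add_apply] at h
        by_cases h0 : (θ (x ⊗ₜ b)).coeff m' = 0
        · rw [h0, zero_add] at h; exact hy m' h
        · exact hx m' h0
      | single k r =>
        induction b using AddMonoidAlgebra.induction_linear with
        | zero => intro m' h; simp at h
        | add x y hx hy =>
          intro m' h
          rw [TensorProduct.tmul_add, map_add, AddMonoidAlgebra.coeff_add, Finsupp.add_apply] at h
          by_cases h0 : (θ (AddMonoidAlgebra.single k r ⊗ₜ x)).coeff m' = 0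
          · rw [h0, zero_add] at h; exact hy m' h
          · exact hx m' h0
        | single l s =>
          intro m' h
          have : θ (AddMonoidAlgebra.single k r ⊗ₜ AddMonoidAlgebra.single l s) =
              f (AddMonoidAlgebra.single k r) * g (AddMonoidAlgebra.single l s) :=
            Algebra.TensorProduct.productMap_apply_tmul _ _ _ _
          have hf : f (AddMonoidAlgebra.single k r) = AddMonoidAlgebra.single
            (AddSubmonoid.inclusion (dualMonoid_anti (Δ.inter_le_left σ τ)) k) r :=
            AddMonoidAlgebra.mapDomain_single ..
          have hg : g (AddMonoidAlgebra.single l s) = AddMonoidAlgebra.single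
            (AddSubmonoid.inclusion (dualMonoid_anti (Δ.inter_le_right σ τ)) l) s :=
            AddMonoidAlgebra.mapDomain_single ..
          rw [this, hf, hg, AddMonoidAlgebra.single_mul_single, AddMonoidAlgebra.coeff_single] at h
          have := Finsupp.single_apply_ne_zero.1 h
          refine ⟨k, k.2, l, l.2, ?_⟩
          rw [this.1]
          rfl
  refine key z ⟨m, hm⟩ ?_
  rw [hz]
  simp

end Separated

/-! ### Universal closedness gives relations between characters -/

section Complete

variable {n : ℕ} (Δ : Fan n)

/-- Without a relation, the characters of the `-m σ` generate a proper ideal in the `K`-algebra they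
generate inside the function field `F` of the torus, so some valuation ring `O` of `F` has all of
them as nonunits. By the valuative criterion the generic point of the torus extends to `Spec O`; the
closed point lands in some `U_σ`, so the character of `m σ` lies in `O` although its inverse is a
nonunit of `O`. -/
lemma Fan.isComplete_of_universallyClosed (K : Type u) [Field K]
    [UniversallyClosed (toricStr Δ K)] : Δ.IsComplete := by
  intro m hm
  by_contra hc
  push Not at hc
  have := Fintype.ofFinite Δ.cones
  let T := AddMonoidAlgebra K (Fin n → ℤ)
  let F := FractionRing T
  let χ : (Fin n → ℤ) → F := fun k => algebraMap T F (AddMonoidAlgebra.single k 1)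
  have χ_add : ∀ a b, χ (a + b) = χ a * χ b := fun a b => by
    simp only [χ]
    rw [← map_mul, AddMonoidAlgebra.single_mul_single, one_mul]
  have χ_zero : χ 0 = 1 := by simp only [χ]; rw [← AddMonoidAlgebra.one_def, map_one]
  let g : MvPolynomial Δ.cones K →+* T :=
    (MvPolynomial.aeval fun σ => AddMonoidAlgebra.single (-m σ) (1 : K)).toRingHom
  have hgX : ∀ σ, g (MvPolynomial.X σ) = AddMonoidAlgebra.single (-m σ) 1 := fun σ =>
    MvPolynomial.aeval_X _ _
  have hgmon : ∀ (c : Δ.cones →₀ ℕ) (a : K), g (MvPolynomial.monomial c a) =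
      AddMonoidAlgebra.single (-∑ σ, c σ • m σ) a := by
    intro c a
    have h1 : ∏ σ, (AddMonoidAlgebra.single (-m σ) (1 : K)) ^ c σ =
        (AddMonoidAlgebra.single (-∑ σ, c σ • m σ) 1 : T) := by
      simp only [AddMonoidAlgebra.single_pow, one_pow]
      rw [← Finset.sum_neg_distrib]
      induction (Finset.univ : Finset Δ.cones) using Finset.induction_on with
      | empty => simp [AddMonoidAlgebra.one_def]
      | insert a s ha ih =>
        rw [Finset.prod_insert ha, ih, Finset.sum_insert ha, AddMonoidAlgebra.single_mul_single,
          one_mul, smul_neg]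
    have h2 : g (MvPolynomial.monomial c a) =
        algebraMap K T a * ∏ σ, (AddMonoidAlgebra.single (-m σ) (1 : K)) ^ c σ := by
      refine (MvPolynomial.aeval_monomial _ _ _).trans ?_
      rw [Finsupp.prod_fintype _ _ fun i => pow_zero _]
    have h3 : algebraMap K (AddMonoidAlgebra K (Fin n → ℤ)) a = AddMonoidAlgebra.single 0 a := by
      simp
    rw [h2, h1, h3, AddMonoidAlgebra.single_mul_single, zero_add, mul_one]
  -- Absence of relations means that only the constant monomial is sent to exponent zero; hence a
  -- polynomial without constant term cannot map to `1`.
  have hg : ∀ p, (g p).coeff 0 = MvPolynomial.constantCoeff p := by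
    intro p
    induction p using MvPolynomial.induction_on' with
    | add p q hp hq =>
      rw [map_add, map_add, AddMonoidAlgebra.coeff_add, Finsupp.add_apply, hp, hq]
    | monomial c a =>
      rw [hgmon, AddMonoidAlgebra.coeff_single, MvPolynomial.constantCoeff_monomial]
      by_cases h : c = 0
      · subst h; simp
      · rw [if_neg h, Finsupp.single_apply, if_neg]
        intro h0
        refine hc c (fun h' => h (DFunLike.coe_injective h')) ?_
        rw [finsum_eq_sum_of_fintype]
        exact neg_eq_zero.1 h0
  let f : MvPolynomial Δ.cones K →+* F := (algebraMap T F).comp g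
  let I : Ideal f.range := (Ideal.span (Set.range MvPolynomial.X)).map f.rangeRestrict
  have hI : I ≠ ⊤ := by
    intro h
    obtain ⟨p, hp, hp'⟩ := (Ideal.mem_map_iff_of_surjective _ f.rangeRestrict_surjective).1
      ((Ideal.eq_top_iff_one I).1 h)
    have h1 : g p = 1 := by
      apply IsFractionRing.injective T F
      rw [map_one]
      exact congrArg Subtype.val hp'
    have h2 := hg p
    have h3 : Ideal.span (Set.range MvPolynomial.X) ≤
        RingHom.ker (MvPolynomial.constantCoeff (σ := Δ.cones) (R := K)) := by
      rw [Ideal.span_le]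
      rintro _ ⟨σ, rfl⟩
      exact RingHom.mem_ker.2 (MvPolynomial.constantCoeff_X K σ)
    rw [h1, RingHom.mem_ker.1 (h3 hp), AddMonoidAlgebra.one_def, AddMonoidAlgebra.coeff_single,
      Finsupp.single_eq_same] at h2
    exact one_ne_zero h2
  obtain ⟨O, hO, hsub⟩ := Ideal.image_subset_nonunits_valuationSubring I hI
  have hmO : ∀ σ, χ (-m σ) ∈ O.nonunits := fun σ => by
    refine hsub ⟨f.rangeRestrict (MvPolynomial.X σ),
      Ideal.mem_map_of_mem _ (Ideal.subset_span ⟨σ, rfl⟩), ?_⟩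
    exact congrArg (algebraMap T F) (hgX σ)
  obtain ⟨σ₀⟩ := nonempty_cones Δ
  let κ : K →+* O := ((algebraMap T F).comp (algebraMap K T)).codRestrict O.toSubring fun r =>
    hO ⟨MvPolynomial.C r, congrArg (algebraMap T F) (MvPolynomial.aeval_C _ r)⟩
  let α : ChartRing K σ₀.1 →+* F := (algebraMap T F).comp
    (AddMonoidAlgebra.mapDomainRingHom K (dualMonoid σ₀.1).subtype)
  have hα : ∀ k : dualMonoid σ₀.1, α (AddMonoidAlgebra.single k 1) = χ k.1 := fun k =>
    congrArg (algebraMap T F) (AddMonoidAlgebra.mapDomain_single ..)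
  have hsq : CommSq (Spec.map (CommRingCat.ofHom α) ≫ chartι Δ K σ₀)
      (Spec.map (CommRingCat.ofHom (algebraMap O F))) (toricStr Δ K)
      (Spec.map (CommRingCat.ofHom κ)) := by
    refine ⟨?_⟩
    rw [Category.assoc, chartι_toricStr, ← Spec.map_comp, ← Spec.map_comp,
      ← CommRingCat.ofHom_comp, ← CommRingCat.ofHom_comp]
    congr 2
    ext r
    refine congrArg (algebraMap T F) ?_
    have h3 : algebraMap K (AddMonoidAlgebra K (Fin n → ℤ)) r = AddMonoidAlgebra.single 0 r := by
      simp
    have h4 : algebraMap K (ChartRing K σ₀.1) r = AddMonoidAlgebra.single 0 r := by simp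
    rw [h3]
    refine (congrArg _ h4).trans ?_
    exact AddMonoidAlgebra.mapDomain_single ..
  have hex : ValuativeCriterion.Existence (toricStr Δ K) := by
    have : UniversallyClosed (toricStr Δ K) := inferInstance
    rw [UniversallyClosed.eq_valuativeCriterion] at this
    exact this.1
  obtain ⟨⟨⟨l, hl₁, hl₂⟩⟩⟩ := hex ⟨O, F, _, _, hsq⟩
  obtain ⟨σ, y, hy⟩ := exists_chartι_eq Δ K (l (IsLocalRing.closedPoint O))
  obtain ⟨β, rfl⟩ := exists_eq_specMap_chartι Δ K l σ ⟨y, hy⟩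
  rw [← Category.assoc, ← Spec.map_comp, ← CommRingCat.ofHom_comp] at hl₁
  obtain ⟨γ, hγ₁, hγ₂⟩ := exists_hom_inter Δ hl₁
  have hγ : ∀ k : dualMonoid (Δ.inter σ σ₀).1, γ (AddMonoidAlgebra.single k 1) = χ k.1 := by
    intro k
    obtain ⟨u, hu, hu'⟩ := Δ.isFace_of_le (Δ.inter σ σ₀).2 σ₀.2 (Δ.inter_le_right σ σ₀)
    -- The character `k` is the difference of `k + j u` and `j u`, which are both characters of
    -- `σ₀`, where `γ` is known from `α`.
    obtain ⟨j, hj⟩ := exists_add_nsmul_mem (Δ.rational _ σ₀.2) hu hu' k.2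
    have h0 : ∀ k : dualMonoid σ₀.1, γ (AddMonoidAlgebra.single (AddSubmonoid.inclusion
        (dualMonoid_anti (Δ.inter_le_right σ σ₀)) k) 1) = χ k.1 := by
      intro k
      refine Eq.trans ?_ (hα k)
      refine Eq.trans ?_ congr($hγ₂ (AddMonoidAlgebra.single k 1))
      exact congrArg γ (AddMonoidAlgebra.mapDomain_single ..).symm
    have h1 := h0 ⟨_, hj⟩
    have h2 := h0 ⟨_, nsmul_mem hu j⟩
    have h3 : (AddSubmonoid.inclusion (dualMonoid_anti (Δ.inter_le_right σ σ₀)) ⟨_, hj⟩) =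
      k + (AddSubmonoid.inclusion (dualMonoid_anti (Δ.inter_le_right σ σ₀))
        ⟨_, nsmul_mem hu j⟩) := rfl
    rw [h3, ← one_mul (1 : K), ← AddMonoidAlgebra.single_mul_single, map_mul, h2] at h1
    change _ = χ (k.1 + j • u) at h1
    rw [χ_add] at h1
    refine mul_right_cancel₀ (fun h0 => ?_) h1
    have := χ_add (j • u) (-(j • u))
    rw [h0, add_neg_cancel, χ_zero, zero_mul] at this
    exact one_ne_zero this
  have h1 : χ (m σ) ∈ O := by
    have := hγ (AddSubmonoid.inclusion (dualMonoid_anti (Δ.inter_le_left σ σ₀)) ⟨m σ, hm σ⟩)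
    change _ = χ (m σ) at this
    rw [← this]
    have h2 : γ (AddMonoidAlgebra.single (AddSubmonoid.inclusion
        (dualMonoid_anti (Δ.inter_le_left σ σ₀)) ⟨m σ, hm σ⟩) 1) =
        algebraMap O F (β (AddMonoidAlgebra.single ⟨m σ, hm σ⟩ 1)) := by
      refine Eq.trans ?_ congr($hγ₁ (AddMonoidAlgebra.single ⟨m σ, hm σ⟩ 1))
      exact congrArg γ (AddMonoidAlgebra.mapDomain_single ..).symm
    rw [h2]
    exact (β (AddMonoidAlgebra.single ⟨m σ, hm σ⟩ 1)).2
  have h2 := χ_add (m σ) (-m σ)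
  rw [add_neg_cancel, χ_zero] at h2
  rcases O.mem_nonunits_iff_or.1 (hmO σ) with h | h
  · rw [h, mul_zero] at h2; exact one_ne_zero h2
  · rw [← eq_inv_of_mul_eq_one_left h2.symm] at h
    exact h h1

end Complete

/-! ### The valuative criterion over an arbitrary base -/

section Proper

variable {n : ℕ} (Δ : Fan n)

/-- Morphisms of charts of points of the torus: a homomorphism of `R[σ^∨ ∩ M]` from one of
`R[τ^∨ ∩ M]`. -/
lemma specMap_comp_chartRingMap_chartι {R F : Type u} [CommRing R] [CommRing F] {τ σ : Δ.cones}
    (h : τ ≤ σ) (α : ChartRing R τ.1 →+* F) :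
    Spec.map (CommRingCat.ofHom (α.comp (chartRingMap R (show τ.1 ≤ σ.1 from h)))) ≫ chartι Δ R σ =
      Spec.map (CommRingCat.ofHom α) ≫ chartι Δ R τ := by
  rw [CommRingCat.ofHom_comp, Spec.map_comp, Category.assoc, chartMap_chartι Δ R h]

lemma chartRingMap_single {R : Type u} [CommRing R] {τ σ : PointedCone ℝ (Fin n → ℝ)}
    (h : τ ≤ σ) (m : dualMonoid σ) (r : R) :
    chartRingMap R h (AddMonoidAlgebra.single m r) =
      AddMonoidAlgebra.single (⟨m.1, dualMonoid_anti h m.2⟩ : dualMonoid τ) r :=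
  AddMonoidAlgebra.mapDomain_single ..

lemma chartRingMap_algebraMap {R : Type u} [CommRing R] {τ σ : PointedCone ℝ (Fin n → ℝ)}
    (h : τ ≤ σ) (r : R) :
    chartRingMap R h (algebraMap R _ r) = algebraMap R (ChartRing R τ) r := by
  simp

/-- Two lifts with closed points in `U_σ` and `U_τ` agree over `F`, which gives an `F`-point `γ` of
`U_{σ ∩ τ}`. Each character of `σ ∩ τ` is a product of one of `σ` and one of `τ`, both with values
in `O`, so `γ` is defined over `O`, and both lifts are equal to it. -/
lemma uniqueness_toricStr (R : Type u) [CommRing R] (hS : Δ.Separates) :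
    ValuativeCriterion.Uniqueness (toricStr Δ R) := by
  rintro ⟨O, F, i₁, i₂, hsq⟩
  refine ⟨fun l₁ l₂ => CommSq.LiftStruct.ext ?_⟩
  obtain ⟨l₁, h₁, -⟩ := l₁
  obtain ⟨l₂, h₂, -⟩ := l₂
  change l₁ = l₂
  change Spec.map (CommRingCat.ofHom (algebraMap O F)) ≫ l₁ = i₁ at h₁
  change Spec.map (CommRingCat.ofHom (algebraMap O F)) ≫ l₂ = i₁ at h₂
  change Spec (CommRingCat.of O) ⟶ toricVariety Δ R at l₁
  change Spec (CommRingCat.of O) ⟶ toricVariety Δ R at l₂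
  obtain ⟨σ, y, hy⟩ := exists_chartι_eq Δ R (l₁ (IsLocalRing.closedPoint O))
  obtain ⟨τ, z, hz⟩ := exists_chartι_eq Δ R (l₂ (IsLocalRing.closedPoint O))
  obtain ⟨β₁, rfl⟩ := exists_eq_specMap_chartι Δ R l₁ σ ⟨y, hy⟩
  obtain ⟨β₂, rfl⟩ := exists_eq_specMap_chartι Δ R l₂ τ ⟨z, hz⟩
  rw [← Category.assoc, ← Spec.map_comp, ← CommRingCat.ofHom_comp] at h₁ h₂
  obtain ⟨γ, hγ₁, hγ₂⟩ := exists_hom_inter Δ (h₁.trans h₂.symm)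
  have hinj : Function.Injective (algebraMap O F) := IsFractionRing.injective O F
  obtain ⟨δ, hδ⟩ := exists_lift_of_characters hinj γ
    (fun r => by
      have := congr($hγ₁ (algebraMap R _ r))
      rw [RingHom.comp_apply, RingHom.comp_apply, chartRingMap_algebraMap] at this
      exact ⟨_, this.symm⟩)
    (fun m => by
      obtain ⟨a, ha, b, hb, hab⟩ := hS σ τ m.1 m.2
      have h1 := congr($hγ₁ (AddMonoidAlgebra.single ⟨a, ha⟩ 1))
      have h2 := congr($hγ₂ (AddMonoidAlgebra.single ⟨b, hb⟩ 1))
      rw [RingHom.comp_apply, RingHom.comp_apply, chartRingMap_single] at h1 h2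
      refine ⟨β₁ (AddMonoidAlgebra.single ⟨a, ha⟩ 1) * β₂ (AddMonoidAlgebra.single ⟨b, hb⟩ 1), ?_⟩
      rw [map_mul, ← h1, ← h2, ← map_mul, AddMonoidAlgebra.single_mul_single, one_mul]
      congr 2
      exact Subtype.ext hab.symm)
  have e₁ : δ.comp (chartRingMap R (Δ.inter_le_left σ τ)) = β₁ := by
    refine RingHom.ext fun x => hinj ?_
    have h1 := congr($hγ₁ x)
    have h2 := congr($hδ (chartRingMap R (Δ.inter_le_left σ τ) x))
    exact h2.trans h1
  have e₂ : δ.comp (chartRingMap R (Δ.inter_le_right σ τ)) = β₂ := by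
    refine RingHom.ext fun x => hinj ?_
    have h1 := congr($hγ₂ x)
    have h2 := congr($hδ (chartRingMap R (Δ.inter_le_right σ τ) x))
    exact h2.trans h1
  rw [← e₁, ← e₂]
  exact (specMap_comp_chartRingMap_chartι Δ (Δ.inter_le_left σ τ) δ).trans
    (specMap_comp_chartRingMap_chartι Δ (Δ.inter_le_right σ τ) δ).symm

/-- If `σ₀` is minimal among the cones whose chart contains a given point, the characters which
do not vanish at the point are orthogonal to `σ₀`. -/
lemma exists_minimal_chart {R F : Type u} [CommRing R] [Field F]
    (x : Spec (CommRingCat.of F) ⟶ toricVariety Δ R) :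
    ∃ (σ₀ : Δ.cones) (α : ChartRing R σ₀.1 →+* F),
      x = Spec.map (CommRingCat.ofHom α) ≫ chartι Δ R σ₀ ∧
      ∀ m, α (AddMonoidAlgebra.single m 1) ≠ 0 → ∀ v ∈ σ₀.1, pairing m.1 v = 0 := by
  let T : Set Δ.cones := {σ | x (IsLocalRing.closedPoint F) ∈ Set.range (chartι Δ R σ)}
  have hT : T.Nonempty := by
    obtain ⟨σ, y, hy⟩ := exists_chartι_eq Δ R (x (IsLocalRing.closedPoint F))
    exact ⟨σ, y, hy⟩
  obtain ⟨σ₀, h₀, hmin⟩ := T.toFinite.exists_minimal hT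
  obtain ⟨α, rfl⟩ := exists_eq_specMap_chartι Δ R x σ₀ h₀
  refine ⟨σ₀, α, rfl, fun m hm v hv => ?_⟩
  -- A character that does not vanish at the point puts the point in the chart of the face it cuts
  -- out, which by minimality is all of `σ₀`.
  have hface : IsFace (faceOf σ₀.1 m.1) σ₀.1 := ⟨m.1, m.2, fun _ => mem_faceOf⟩
  let τ : Δ.cones := ⟨_, Δ.face_mem _ σ₀.2 _ hface⟩
  have hτ : τ ≤ σ₀ := (hface.le : faceOf σ₀.1 m.1 ≤ σ₀.1)
  have hr := range_chartMap R (show τ.1 ≤ σ₀.1 from hτ) (Δ.rational _ σ₀.2) m.2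
    (fun v => mem_faceOf)
  have hp : Spec.map (CommRingCat.ofHom α) (IsLocalRing.closedPoint F) ∈
      Set.range (chartMap R (show τ.1 ≤ σ₀.1 from hτ)) := by
    rw [hr]
    intro h
    change α _ ∈ (IsLocalRing.closedPoint F).asIdeal at h
    rw [IsLocalRing.closedPoint, IsLocalRing.mem_maximalIdeal, mem_nonunits_iff,
      isUnit_iff_ne_zero] at h
    exact h hm
  obtain ⟨q, hq⟩ := hp
  have hτT : τ ∈ T := by
    refine ⟨q, ?_⟩
    rw [← chartMap_chartι Δ R hτ, Scheme.Hom.comp_apply, hq]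
    rfl
  exact ((hmin hτT hτ : σ₀.1 ≤ τ.1) hv).2

lemma single_sum_nsmul {M ι : Type*} [AddCommMonoid M] (R : Type*) [CommRing R] (s : Finset ι)
    (c : ι → ℕ) (k : ι → M) :
    (AddMonoidAlgebra.single (∑ i ∈ s, c i • k i) 1 : AddMonoidAlgebra R M) =
      ∏ i ∈ s, (AddMonoidAlgebra.single (k i) 1) ^ c i := by
  classical
  induction s using Finset.induction_on with
  | empty => simp [AddMonoidAlgebra.one_def]
  | insert a s ha ih =>
    rw [Finset.prod_insert ha, ← ih, Finset.sum_insert ha, AddMonoidAlgebra.single_pow, one_pow,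
      AddMonoidAlgebra.single_mul_single, one_mul]

/-- Let `σ₀` be the minimal cone whose chart contains the `F`-point. If there is no lift, every `σ ⊇
σ₀` has a character whose value at the point is not in `O`; every other `σ` has one that is negative
at an interior vector `w` of `σ₀`. Completeness gives a relation between these characters. Pairing
it with `w` eliminates the cones not containing `σ₀`, and evaluating the rest at the point writes
`1` as a product of elements of valuation greater than `1`. -/
lemma existence_toricStr (R : Type u) [CommRing R] (hS : Δ.Separates) (hC : Δ.IsComplete) :
    ValuativeCriterion.Existence (toricStr Δ R) := by
  classical
  rintro ⟨O, F, i₁, i₂, hsq⟩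
  have := Fintype.ofFinite Δ.cones
  change Spec (CommRingCat.of F) ⟶ toricVariety Δ R at i₁
  change Spec (CommRingCat.of O) ⟶ Spec (CommRingCat.of R) at i₂
  change CommSq i₁ (Spec.map (CommRingCat.ofHom (algebraMap O F))) (toricStr Δ R) i₂ at hsq
  change hsq.HasLift
  obtain ⟨σ₀, α, rfl, hα⟩ := exists_minimal_chart Δ i₁
  obtain ⟨w, hw, hw'⟩ := exists_interior_vector (Δ.rational _ σ₀.2)
  obtain ⟨κ, rfl⟩ : ∃ κ : R →+* O, i₂ = Spec.map (CommRingCat.ofHom κ) :=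
    ⟨(Spec.preimage i₂).hom, by rw [CommRingCat.ofHom_hom, Spec.map_preimage]⟩
  have hκ : α.comp (algebraMap R (ChartRing R σ₀.1)) = (algebraMap O F).comp κ := by
    have := hsq.w
    rw [Category.assoc, chartι_toricStr, ← Spec.map_comp, ← Spec.map_comp] at this
    exact congr($(Spec.map_injective this).hom)
  have hinj : Function.Injective (algebraMap O F) := IsFractionRing.injective O F
  by_contra hno
  have key : ∀ σ : Δ.cones, ∃ m ∈ dualMonoid σ.1, (σ₀ ≤ σ → ∃ h : m ∈ dualMonoid σ₀.1,
      α (AddMonoidAlgebra.single ⟨m, h⟩ 1) ∉ (algebraMap O F).range) ∧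
      (¬ σ₀ ≤ σ → pairing m w < 0) := by
    intro σ
    by_cases hσ : σ₀ ≤ σ
    · by_contra! hcon
      refine hno ?_
      have hlift : ∀ m, (α.comp (chartRingMap R (show σ₀.1 ≤ σ.1 from hσ)))
          (AddMonoidAlgebra.single m 1) ∈ (algebraMap O F).range := by
        intro m
        by_contra hm
        refine (hcon m.1 m.2 fun _ => ⟨dualMonoid_anti hσ m.2, ?_⟩).1 hσ
        rwa [RingHom.comp_apply, chartRingMap_single] at hm
      obtain ⟨β, hβ⟩ := exists_lift_of_characters hinj
        (α.comp (chartRingMap R (show σ₀.1 ≤ σ.1 from hσ)))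
        (fun r => ⟨κ r, by
          rw [RingHom.comp_apply, chartRingMap_algebraMap]
          exact congr($hκ r).symm⟩) hlift
      refine ⟨⟨⟨Spec.map (CommRingCat.ofHom β) ≫ chartι Δ R σ, ?_, ?_⟩⟩⟩
      · rw [← Category.assoc, ← Spec.map_comp, ← CommRingCat.ofHom_comp, hβ]
        exact specMap_comp_chartRingMap_chartι Δ hσ α
      · rw [Category.assoc, chartι_toricStr, ← Spec.map_comp, ← CommRingCat.ofHom_comp]
        congr 2
        refine RingHom.ext fun r => hinj ?_
        have h1 := congr($hβ (algebraMap R _ r))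
        rw [RingHom.comp_apply, RingHom.comp_apply, chartRingMap_algebraMap] at h1
        exact h1.trans congr($hκ r)
    · obtain ⟨a, ha, ha'⟩ := hS.exists_neg hσ hw hw'
      exact ⟨a, ha, fun h => absurd h hσ, fun _ => ha'⟩
  choose m hm hm₁ hm₂ using key
  obtain ⟨c, hc, hsum⟩ := hC m hm
  rw [finsum_eq_sum_of_fintype] at hsum
  -- A value outside `O` is nonzero, and characters that do not vanish at the point are orthogonal
  -- to `σ₀`.
  have hzero : ∀ σ, σ₀ ≤ σ → pairing (m σ) w = 0 := fun σ hσ => by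
    obtain ⟨h, h'⟩ := hm₁ σ hσ
    refine hα ⟨m σ, h⟩ (fun h0 => h' ?_) w hw
    rw [h0]; exact zero_mem _
  have hc0 : ∀ σ, ¬ σ₀ ≤ σ → c σ = 0 := by
    have h1 : ∑ σ, -((c σ : ℝ) * pairing (m σ) w) = 0 := by
      rw [Finset.sum_neg_distrib]
      simp only [← pairing_nsmul]
      rw [← pairing_sum, hsum]
      simp [pairing]
    have h2 : ∀ σ, 0 ≤ -((c σ : ℝ) * pairing (m σ) w) := by
      intro σ
      by_cases hσ : σ₀ ≤ σ
      · rw [hzero σ hσ]; simp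
      · have := hm₂ σ hσ
        have h3 : (0 : ℝ) ≤ c σ := Nat.cast_nonneg _
        nlinarith
    intro σ hσ
    have h3 := (Finset.sum_eq_zero_iff_of_nonneg fun σ _ => h2 σ).1 h1 σ (Finset.mem_univ _)
    have h4 := hm₂ σ hσ
    rw [neg_eq_zero, mul_eq_zero] at h3
    rcases h3 with h3 | h3
    · exact_mod_cast h3
    · exact absurd h3 h4.ne
  -- The value `0` for cones not containing `σ₀` is harmless, as their coefficients in the relation
  -- vanish.
  let k : Δ.cones → dualMonoid σ₀.1 := fun σ => if h : σ₀ ≤ σ then ⟨m σ, (hm₁ σ h).1⟩ else 0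
  have hk : ∑ σ, c σ • k σ = 0 := by
    refine Subtype.ext ?_
    rw [AddSubmonoid.coe_finsetSum]
    refine Eq.trans (Finset.sum_congr rfl fun σ _ => ?_) hsum
    by_cases h : σ₀ ≤ σ
    · simp only [k, dif_pos h]; rfl
    · rw [hc0 σ h, zero_smul, zero_smul]; rfl
  let v := ValuationRing.valuation O F
  let a : Δ.cones → F := fun σ => α (AddMonoidAlgebra.single (k σ) 1)
  have ha : ∀ σ, σ₀ ≤ σ → 1 < v (a σ) := by
    intro σ hσ
    obtain ⟨h, h'⟩ := hm₁ σ hσ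
    have : a σ ∉ v.integer := by
      rw [ValuationRing.mem_integer_iff]
      simp only [a, k, dif_pos hσ]
      exact h'
    rw [Valuation.mem_integer_iff] at this
    exact not_le.1 this
  have hprod : ∏ σ, v (a σ) ^ c σ = 1 := by
    have h1 := congrArg α (single_sum_nsmul R Finset.univ c k)
    rw [hk, ← AddMonoidAlgebra.one_def, map_one, map_prod] at h1
    have h2 := congrArg v h1
    rw [map_one, map_prod] at h2
    rw [h2]
    exact Finset.prod_congr rfl fun σ _ => by rw [map_pow, map_pow]
  obtain ⟨σ, hσ⟩ : ∃ σ, c σ ≠ 0 := Function.ne_iff.1 hc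
  have hσ₀ : σ₀ ≤ σ := by_contra fun h => hσ (hc0 σ h)
  have hge : ∀ s : Finset Δ.cones, 1 ≤ ∏ σ ∈ s, v (a σ) ^ c σ := by
    intro s
    induction s using Finset.induction_on with
    | empty => simp
    | insert τ s hτ ih =>
      rw [Finset.prod_insert hτ]
      refine one_le_mul ?_ ih
      by_cases h : σ₀ ≤ τ
      · exact one_le_pow₀ (ha τ h).le
      · rw [hc0 τ h, pow_zero]
  rw [← Finset.mul_prod_erase _ _ (Finset.mem_univ σ)] at hprod
  have h1 : 1 < v (a σ) ^ c σ := one_lt_pow₀ (ha σ hσ₀) hσ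
  have h2 := le_mul_of_one_le_right (zero_le' (a := v (a σ) ^ c σ)) (hge (Finset.univ.erase σ))
  rw [hprod] at h2
  exact absurd h1 (not_lt.2 h2)

lemma isLocallyNoetherian_toricVariety (R : Type u) [CommRing R] [IsNoetherianRing R]
    (hfg : ∀ σ : Δ.cones, AddMonoid.FG (dualMonoid σ.1)) :
    IsLocallyNoetherian (toricVariety Δ R) := by
  have := locallyOfFiniteType_toricStr Δ R hfg
  exact LocallyOfFiniteType.isLocallyNoetherian (toricStr Δ R)

/-- The toric variety over a noetherian ring of a fan with the combinatorial properties of a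
complete fan is proper. -/
theorem isProper_toricStr (R : Type u) [CommRing R] [IsNoetherianRing R] (hS : Δ.Separates)
    (hC : Δ.IsComplete) (hfg : ∀ σ : Δ.cones, AddMonoid.FG (dualMonoid σ.1)) :
    IsProper (toricStr Δ R) := by
  have := locallyOfFiniteType_toricStr Δ R hfg
  have := isLocallyNoetherian_toricVariety Δ R hfg
  have : QuasiSeparated (toricStr Δ R) := inferInstance
  exact IsProper.of_valuativeCriterion _
    (ValuativeCriterion.iff.2 ⟨existence_toricStr Δ R hS hC, uniqueness_toricStr Δ R hS⟩)

end Proper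

/-! ### The toric variety over a field as a limit -/

section Limit

/-- The finitely generated `ℤ`-subalgebras of `K`. -/
abbrev FGSub (K : Type u) [CommRing K] := {A : Subalgebra ℤ K // A.FG}

section

variable (K : Type u) [CommRing K]

instance : Nonempty (FGSub K) := ⟨⟨⊥, Subalgebra.fg_bot⟩⟩

instance : IsDirectedOrder (FGSub K) :=
  ⟨fun A B => ⟨⟨A.1 ⊔ B.1, A.2.sup B.2⟩, (le_sup_left : A.1 ≤ _), (le_sup_right : B.1 ≤ _)⟩⟩

variable {K}

lemma FGSub.exists_mem (x : K) : ∃ A : FGSub K, x ∈ A.1 :=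
  ⟨⟨Algebra.adjoin ℤ {x}, ⟨{x}, by simp⟩⟩,
    Algebra.self_mem_adjoin_singleton ℤ x⟩

/-- The inclusion of subalgebras as a ring homomorphism. -/
abbrev FGSub.incl {A B : FGSub K} (h : A ≤ B) : A.1 →+* B.1 := (Subalgebra.inclusion h).toRingHom

end

variable {n : ℕ} (Δ : Fan n) (K : Type u) [Field K]

/-- The spectra of the finitely generated subalgebras of `K`. -/
def specDiagram : (FGSub K)ᵒᵖ ⥤ Scheme.{u} where
  obj A := Spec (CommRingCat.of A.unop.1)
  map f := Spec.map (CommRingCat.ofHom (FGSub.incl (leOfHom f.unop)))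
  map_id _ := Spec.map_id _
  map_comp f g := by
    rw [← Spec.map_comp]
    rfl

/-- The finitely generated subalgebras of `K` as a diagram of rings. -/
def subDiagram : FGSub K ⥤ CommRingCat.{u} where
  obj A := CommRingCat.of A.1
  map f := CommRingCat.ofHom (FGSub.incl (leOfHom f))

/-- The inclusions of the finitely generated subalgebras in `K`. -/
def subCocone : Cocone (subDiagram K) where
  pt := CommRingCat.of K
  ι := { app := fun A => CommRingCat.ofHom (algebraMap A.1 K) }

/-- `K` is the colimit of its finitely generated subalgebras. -/
def isColimitSubCocone : IsColimit (subCocone K) := by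
  have : PreservesColimitsOfShape (FGSub K) (forget CommRingCat.{u}) :=
    PreservesFilteredColimitsOfSize.preserves_filtered_colimits _
  have : ReflectsColimitsOfShape (FGSub K) (forget CommRingCat.{u}) :=
    reflectsColimitsOfShape_of_reflectsIsomorphisms
  refine isColimitOfReflects (forget CommRingCat) (Types.FilteredColimit.isColimitOf _ _ ?_ ?_)
  · intro x
    obtain ⟨A, hA⟩ := FGSub.exists_mem (K := K) x
    exact ⟨A, ⟨x, hA⟩, rfl⟩
  · intro A B a b hab
    obtain ⟨C, hA, hB⟩ := exists_ge_ge A B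
    exact ⟨C, homOfLE hA, homOfLE hB, Subtype.ext hab⟩

/-- The cone over the spectra of the subalgebras with apex `Spec K`. -/
def specCone : Cone (specDiagram K) where
  pt := Spec (CommRingCat.of K)
  π := { app := fun A => Spec.map (CommRingCat.ofHom (algebraMap A.unop.1 K))
         naturality := fun A B f => by
          refine (Category.id_comp _).trans ?_
          exact (Spec.map_comp (CommRingCat.ofHom (FGSub.incl (leOfHom f.unop)))
            (CommRingCat.ofHom (algebraMap A.unop.1 K))) }

/-- `Spec K` is the limit of the spectra of the finitely generated subalgebras. -/
def isLimitSpecCone : IsLimit (specCone K) :=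
  isLimitOfPreserves Scheme.Spec (isColimitSubCocone K).op

/-- The transition morphisms between the toric varieties over the subalgebras of `K`. -/
abbrev trans {A B : FGSub K} (h : A ≤ B) : toricVariety Δ B.1 ⟶ toricVariety Δ A.1 :=
  toricMap Δ (FGSub.incl h)

/-- The morphism from the toric variety over `K` to the one over a subalgebra. -/
abbrev proj (A : FGSub K) : toricVariety Δ K ⟶ toricVariety Δ A.1 :=
  toricMap Δ (algebraMap A.1 K)

lemma proj_trans {A B : FGSub K} (h : A ≤ B) : proj Δ K B ≫ trans Δ K h = proj Δ K A :=
  (toricMap_comp Δ (FGSub.incl h) (algebraMap B.1 K)).symm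

lemma trans_trans {A B C : FGSub K} (h : A ≤ B) (h' : B ≤ C) :
    trans Δ K h' ≫ trans Δ K h = trans Δ K (h.trans h') :=
  (toricMap_comp Δ (FGSub.incl h) (FGSub.incl h')).symm

/-- The toric varieties over the finitely generated subalgebras of `K`. -/
def toricDiagram : (FGSub K)ᵒᵖ ⥤ Scheme.{u} where
  obj A := toricVariety Δ A.unop.1
  map f := trans Δ K (leOfHom f.unop)
  map_id _ := toricMap_id Δ
  map_comp _ _ := (trans_trans Δ K _ _).symm

/-- The cone over the toric varieties over the subalgebras with apex the one over `K`. -/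
def toricCone : Cone (toricDiagram Δ K) where
  pt := toricVariety Δ K
  π := { app := fun A => proj Δ K A.unop
         naturality := fun _ _ f => by
          refine (Category.id_comp _).trans ?_
          exact (proj_trans Δ K (leOfHom f.unop)).symm }

/-- The toric variety over `K` is the limit of the toric varieties over the finitely generated
subalgebras of `K`. -/
def isLimitToricCone : IsLimit (toricCone Δ K) :=
  -- Cartesian squares over a connected diagram carry the limit property of `Spec K` over to the
  -- toric varieties.
  have := IsCofiltered.isConnected (FGSub K)ᵒᵖ
  isLimitOfIsPullbackOfIsConnected (F := toricDiagram Δ K) (G := specDiagram K)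
    { app := fun A => toricStr Δ A.unop.1
      naturality := fun A B f => toricMap_toricStr Δ (FGSub.incl (leOfHom f.unop)) }
    (toricCone Δ K) (specCone K)
    { hom := toricStr Δ K
      w := fun A => (toricMap_toricStr Δ (algebraMap A.unop.1 K)).symm }
    (fun A => isPullback_toricMap Δ (algebraMap A.unop.1 K)) (isLimitSpecCone K)

instance isAffineHom_toricDiagram {A B : (FGSub K)ᵒᵖ} (f : A ⟶ B) :
    IsAffineHom ((toricDiagram Δ K).map f) :=
  inferInstanceAs (IsAffineHom (toricMap Δ _))

instance isNoetherianRing_fgSub (A : FGSub K) : IsNoetherianRing A.1 := by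
  have : Algebra.FiniteType ℤ A.1 := A.1.fg_iff_finiteType.1 A.2
  exact Algebra.FiniteType.isNoetherianRing ℤ A.1

end Limit

/-! ### Spreading out open sets -/

section Spread

open Filter

variable {n : ℕ} (Δ : Fan n) (K : Type u) [Field K]

section

variable [hfg : ∀ σ : Δ.cones, AddMonoid.FG (dualMonoid σ.1)]

instance isNoetherian_toricVariety (R : Type u) [CommRing R] [IsNoetherianRing R] :
    IsNoetherian (toricVariety Δ R) :=
  { isLocallyNoetherian_toricVariety Δ R hfg, compactSpace_toricVariety Δ R with }

instance (A : (FGSub K)ᵒᵖ) : IsNoetherian ((toricDiagram Δ K).obj A) :=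
  inferInstanceAs (IsNoetherian (toricVariety Δ A.unop.1))

lemma isCompact_opens {X : Scheme.{u}} [IsNoetherian X] (U : X.Opens) : IsCompact (U : Set X) :=
  NoetherianSpace.isCompact _

end

variable {K}

/-- The open sets over the larger subalgebras induced by one over `A₀`. -/
def pullOpens (A₀ : FGSub K) (V : (toricVariety Δ A₀.1).Opens) (A : FGSub K) :
    (toricVariety Δ A.1).Opens := by
  classical exact if h : A₀ ≤ A then trans Δ K h ⁻¹ᵁ V else ⊥

lemma pullOpens_eq {A₀ A : FGSub K} (V : (toricVariety Δ A₀.1).Opens) (h : A₀ ≤ A) :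
    pullOpens Δ A₀ V A = trans Δ K h ⁻¹ᵁ V := dif_pos h

/-- A compatible family of open sets, over all large subalgebras, inducing `U` over `K`. -/
def SpreadsTo (U : (toricVariety Δ K).Opens) (V : ∀ A : FGSub K, (toricVariety Δ A.1).Opens) :
    Prop :=
  ∃ A₀, (∀ A, A₀ ≤ A → proj Δ K A ⁻¹ᵁ V A = U) ∧
    ∀ A B (h : A ≤ B), A₀ ≤ A → trans Δ K h ⁻¹ᵁ V A = V B

variable {Δ}

lemma proj_preimage_trans_preimage {A B : FGSub K} (h : A ≤ B) (V : (toricVariety Δ A.1).Opens) :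
    proj Δ K B ⁻¹ᵁ trans Δ K h ⁻¹ᵁ V = proj Δ K A ⁻¹ᵁ V := by
  rw [← Scheme.Hom.comp_preimage, proj_trans]

lemma trans_preimage_trans_preimage {A B C : FGSub K} (h : A ≤ B) (h' : B ≤ C)
    (V : (toricVariety Δ A.1).Opens) :
    trans Δ K h' ⁻¹ᵁ trans Δ K h ⁻¹ᵁ V = trans Δ K (h.trans h') ⁻¹ᵁ V := by
  rw [← Scheme.Hom.comp_preimage, trans_trans]

lemma spreadsTo_pullOpens {A₀ : FGSub K} (V : (toricVariety Δ A₀.1).Opens) :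
    SpreadsTo Δ (proj Δ K A₀ ⁻¹ᵁ V) (pullOpens Δ A₀ V) := by
  refine ⟨A₀, fun A h => ?_, fun A B h h' => ?_⟩
  · rw [pullOpens_eq Δ V h, proj_preimage_trans_preimage]
  · rw [pullOpens_eq Δ V h', pullOpens_eq Δ V (h'.trans h), trans_preimage_trans_preimage]

variable {U U' : (toricVariety Δ K).Opens} {V V' : ∀ A : FGSub K, (toricVariety Δ A.1).Opens}

lemma SpreadsTo.eventually_proj (h : SpreadsTo Δ U V) :
    ∀ᶠ A in atTop, proj Δ K A ⁻¹ᵁ V A = U := by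
  obtain ⟨A₀, h, -⟩ := h
  filter_upwards [eventually_ge_atTop A₀] with A hA using h A hA

lemma SpreadsTo.inf (h : SpreadsTo Δ U V) (h' : SpreadsTo Δ U' V') :
    SpreadsTo Δ (U ⊓ U') (fun A => V A ⊓ V' A) := by
  obtain ⟨A₀, h1, h2⟩ := h
  obtain ⟨A₀', h1', h2'⟩ := h'
  obtain ⟨B, hB, hB'⟩ := exists_ge_ge A₀ A₀'
  refine ⟨B, fun A hA => ?_, fun A C h hA => ?_⟩
  · rw [Scheme.Hom.preimage_inf, h1 A (hB.trans hA), h1' A (hB'.trans hA)]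
  · rw [Scheme.Hom.preimage_inf, h2 A C h (hB.trans hA), h2' A C h (hB'.trans hA)]

lemma spreadsTo_top : SpreadsTo Δ (⊤ : (toricVariety Δ K).Opens) (fun _ => ⊤) :=
  ⟨Classical.arbitrary _, fun _ _ => rfl, fun _ _ _ _ => rfl⟩

lemma SpreadsTo.iSup {ι : Type*} [Finite ι] {U : ι → (toricVariety Δ K).Opens}
    {V : ι → ∀ A : FGSub K, (toricVariety Δ A.1).Opens} (h : ∀ i, SpreadsTo Δ (U i) (V i)) :
    SpreadsTo Δ (⨆ i, U i) (fun A => ⨆ i, V i A) := by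
  choose A₀ h1 h2 using h
  obtain ⟨B, hB⟩ := Finite.exists_le A₀
  refine ⟨B, fun A hA => ?_, fun A C h hA => ?_⟩
  · rw [Scheme.Hom.preimage_iSup]
    exact iSup_congr fun i => h1 i A ((hB i).trans hA)
  · rw [Scheme.Hom.preimage_iSup]
    exact iSup_congr fun i => h2 i A C h ((hB i).trans hA)

section

variable [hfg : ∀ σ : Δ.cones, AddMonoid.FG (dualMonoid σ.1)]

/-- Open subsets of these noetherian schemes are quasi-compact, so an inclusion in the limit already
holds at some stage; it then pulls back to all later ones. -/
lemma SpreadsTo.eventually_le (h : SpreadsTo Δ U V) (h' : SpreadsTo Δ U' V') (hU : U ≤ U') :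
    ∀ᶠ A in atTop, V A ≤ V' A := by
  obtain ⟨A₀, h1, h2⟩ := h
  obtain ⟨A₀', h1', h2'⟩ := h'
  obtain ⟨B, hB, hB'⟩ := exists_ge_ge A₀ A₀'
  obtain ⟨C, f, hC⟩ := exists_map_preimage_le_map_preimage (toricDiagram Δ K) (toricCone Δ K)
    (isLimitToricCone Δ K) (i := Opposite.op B) (U := V B) (V := V' B)
    (isCompact_opens (X := toricVariety Δ B.1) (V B))
    (((h1 B hB).le.trans hU).trans (h1' B hB').ge)
  have hBC : B ≤ C.unop := leOfHom f.unop
  change trans Δ K hBC ⁻¹ᵁ V B ≤ trans Δ K hBC ⁻¹ᵁ V' B at hC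
  rw [h2 _ _ hBC hB, h2' _ _ hBC hB'] at hC
  filter_upwards [eventually_ge_atTop C.unop] with A hA
  rw [← h2 _ _ hA (hB.trans hBC), ← h2' _ _ hA (hB'.trans hBC)]
  exact Scheme.Hom.preimage_mono _ hC

lemma SpreadsTo.eventually_eq (h : SpreadsTo Δ U V) (h' : SpreadsTo Δ U V') :
    ∀ᶠ A in atTop, V A = V' A := by
  filter_upwards [h.eventually_le h' le_rfl, h'.eventually_le h le_rfl] with A h1 h2
  exact le_antisymm h1 h2

lemma exists_pullOpens (U : (toricVariety Δ K).Opens) :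
    ∃ (A₀ : FGSub K) (V : (toricVariety Δ A₀.1).Opens), proj Δ K A₀ ⁻¹ᵁ V = U := by
  obtain ⟨A, V, -, h⟩ := exists_preimage_eq (toricDiagram Δ K) (toricCone Δ K)
    (isLimitToricCone Δ K) U (isCompact_opens (X := toricVariety Δ K) U)
  exact ⟨A.unop, V, h⟩

/-- A choice of a compatible family of open sets inducing `U`. -/
def spread (U : (toricVariety Δ K).Opens) (A : FGSub K) : (toricVariety Δ A.1).Opens :=
  pullOpens Δ (exists_pullOpens U).choose (exists_pullOpens U).choose_spec.choose A

lemma spreadsTo_spread (U : (toricVariety Δ K).Opens) : SpreadsTo Δ U (spread U) := by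
  have := spreadsTo_pullOpens (exists_pullOpens U).choose_spec.choose
  rwa [(exists_pullOpens U).choose_spec.choose_spec] at this

/-- An affine open set of the limit comes from an affine one at some stage, affineness persists
under the affine transition morphisms, and two models of `U` eventually agree. -/
lemma eventually_isAffineOpen_spread (hU : IsAffineOpen U) :
    ∀ᶠ A in atTop, IsAffineOpen (spread U A) := by
  obtain ⟨A, V, hV, h⟩ := exists_isAffineOpen_preimage_eq (toricDiagram Δ K) (toricCone Δ K)
    (isLimitToricCone Δ K) U hU
  change (toricVariety Δ A.unop.1).Opens at V
  have h1 := spreadsTo_pullOpens V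
  rw [show proj Δ K A.unop ⁻¹ᵁ V = U from h] at h1
  filter_upwards [eventually_ge_atTop A.unop, (spreadsTo_spread U).eventually_eq h1] with B hB h2
  rw [h2, pullOpens_eq Δ V hB]
  have : IsAffineHom (trans Δ K hB) := isAffineHom_toricMap Δ (FGSub.incl hB)
  have hV' : IsAffineOpen (X := toricVariety Δ A.unop.1) V := hV
  exact hV'.preimage _

end

end Spread

/-! ### Lifts of functions along a morphism -/

section Lift

/-- The function `a` on `U` is the pullback of the function `b` on `V`. -/
def IsLift {X Y : Scheme.{u}} (π : X ⟶ Y) {V : Y.Opens} {U : X.Opens} (b : Γ(Y, V)) (a : Γ(X, U)) :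
    Prop :=
  ∃ h : U ≤ π ⁻¹ᵁ V, π.appLE V U h b = a

variable {X Y Z : Scheme.{u}} {π : X ⟶ Y} {V : Y.Opens} {U : X.Opens}

lemma IsLift.of_comp {ρ : Y ⟶ Z} {W : Z.Opens} {c : Γ(Z, W)} {a : Γ(X, U)}
    (h : IsLift (π ≫ ρ) c a) : IsLift π (ρ.app W c) a := by
  obtain ⟨h, rfl⟩ := h
  exact ⟨h, by rw [Scheme.Hom.comp_appLE]; rfl⟩

lemma IsLift.unique [QuasiCompact π] [IsSchemeTheoreticallyDominant π] {a : Γ(X, U)} {b b' : Γ(Y, V)}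
    (hU : π ⁻¹ᵁ V = U) (h : IsLift π b a) (h' : IsLift π b' a) : b = b' := by
  subst hU
  obtain ⟨h1, h⟩ := h
  obtain ⟨_, h'⟩ := h'
  rw [← h', ← Scheme.Hom.app_eq_appLE] at h
  exact π.app_injective V h

lemma IsLift.preimage_basicOpen {a : Γ(X, U)} {b : Γ(Y, V)} (hU : π ⁻¹ᵁ V = U)
    (h : IsLift π b a) : π ⁻¹ᵁ Y.basicOpen b = X.basicOpen a := by
  subst hU
  obtain ⟨h1, rfl⟩ := h
  rw [← Scheme.Hom.app_eq_appLE, Scheme.preimage_basicOpen]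

end Lift

/-! ### Spreading out functions and their nonvanishing loci -/

section SpreadSections

open Filter

variable {n : ℕ} {Δ : Fan n} {K : Type u} [Field K]
  [hfg : ∀ σ : Δ.cones, AddMonoid.FG (dualMonoid σ.1)]

instance (A : FGSub K) : IsSchemeTheoreticallyDominant (proj Δ K A) :=
  isSchemeTheoreticallyDominant_toricMap Δ _ Subtype.val_injective

/-- The restrictions to the open sets `V A` form again a limit of quasi-compact quasi-separated
schemes along affine morphisms, and a function on such a limit comes from a finite stage. -/
lemma SpreadsTo.eventually_exists_isLift {U : (toricVariety Δ K).Opens}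
    {V : ∀ A : FGSub K, (toricVariety Δ A.1).Opens} (hV : SpreadsTo Δ U V)
    (s : Γ(toricVariety Δ K, U)) :
    ∀ᶠ A in atTop, ∃ b : Γ(toricVariety Δ A.1, V A), IsLift (proj Δ K A) b s := by
  obtain ⟨A₀, h1, h2⟩ := hV
  have hU := h1 A₀ le_rfl
  subst hU
  let V₀ : ((toricDiagram Δ K).obj (Opposite.op A₀)).Opens := V A₀
  have hq (j : Over (Opposite.op A₀)) : CompactSpace ((opensDiagram (toricDiagram Δ K) (Opposite.op A₀) V₀).obj j) :=
    isCompact_iff_compactSpace.mp (isCompact_opens (X := toricVariety Δ j.left.unop.1) _)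
  have hs (j : Over (Opposite.op A₀)) : QuasiSeparatedSpace ((opensDiagram (toricDiagram Δ K) (Opposite.op A₀) V₀).obj j) :=
    (isQuasiSeparated_iff_quasiSeparatedSpace _ ((toricDiagram Δ K).map _ ⁻¹ᵁ _).2).mp (.of_quasiSeparatedSpace _)
  obtain ⟨j, t, ht⟩ := exists_appTop_π_eq_of_isLimit _ _
    (isLimitOpensCone (toricDiagram Δ K) (toricCone Δ K) (isLimitToricCone Δ K)
      (Opposite.op A₀) V₀)
    ((proj Δ K A₀ ⁻¹ᵁ V A₀).topIso.inv s)
  have hj : A₀ ≤ j.left.unop := leOfHom j.hom.unop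
  have hl : IsLift (proj Δ K j.left.unop) ((trans Δ K hj ⁻¹ᵁ V A₀).topIso.hom t) s := by
    have h0 : proj Δ K A₀ ⁻¹ᵁ V A₀ ≤ proj Δ K j.left.unop ⁻¹ᵁ trans Δ K hj ⁻¹ᵁ V A₀ :=
      (proj_preimage_trans_preimage hj _).ge
    refine ⟨h0, ?_⟩
    have h4 : (proj Δ K A₀ ⁻¹ᵁ V A₀).topIso.inv s =
      ((proj Δ K j.left.unop).resLE (trans Δ K hj ⁻¹ᵁ V A₀) _ h0).appTop t := ht
    rw [Scheme.Hom.appTop, Scheme.Hom.resLE_app_top] at h4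
    have h5 := congrArg (proj Δ K A₀ ⁻¹ᵁ V A₀).topIso.hom h4
    have h6 : ∀ x, (proj Δ K A₀ ⁻¹ᵁ V A₀).topIso.hom ((proj Δ K A₀ ⁻¹ᵁ V A₀).topIso.inv x) = x :=
      fun x => congr($((proj Δ K A₀ ⁻¹ᵁ V A₀).topIso.inv_hom_id) x)
    rw [h6] at h5
    exact (h5.trans (h6 _)).symm
  filter_upwards [eventually_ge_atTop j.left.unop] with B hB
  have h3 : V B = trans Δ K hB ⁻¹ᵁ trans Δ K hj ⁻¹ᵁ V A₀ := by
    rw [h2 _ _ hj le_rfl, h2 _ _ hB hj]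
  rw [h3]
  rw [← proj_trans Δ K hB] at hl
  exact ⟨_, hl.of_comp⟩

/-- Lifts are unique, so for large `A` every lift is the pullback of one fixed lift. Its
nonvanishing locus is then a model of that of `s`, and two models eventually agree. -/
lemma SpreadsTo.eventually_basicOpen {U : (toricVariety Δ K).Opens}
    {V : ∀ A : FGSub K, (toricVariety Δ A.1).Opens} (hV : SpreadsTo Δ U V)
    (s : Γ(toricVariety Δ K, U)) :
    ∀ᶠ A in atTop, ∀ b : Γ(toricVariety Δ A.1, V A), IsLift (proj Δ K A) b s →
      (toricVariety Δ A.1).basicOpen b = spread ((toricVariety Δ K).basicOpen s) A := by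
  have h1 := hV.eventually_exists_isLift s
  obtain ⟨A₀, h2, h3⟩ := hV
  obtain ⟨A₁, ⟨b₁, hb₁⟩, hA₁⟩ := (h1.and (eventually_ge_atTop A₀)).exists
  have h4 := spreadsTo_pullOpens ((toricVariety Δ A₁.1).basicOpen b₁)
  rw [hb₁.preimage_basicOpen (h2 A₁ hA₁)] at h4
  filter_upwards [eventually_ge_atTop A₁, h4.eventually_eq (spreadsTo_spread _)] with A hA h5
  rw [← h5, pullOpens_eq Δ _ hA, Scheme.preimage_basicOpen, ← h3 _ _ hA hA₁]
  intro b hb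
  rw [← proj_trans Δ K hA] at hb₁
  congr 1
  refine hb.unique ?_ hb₁.of_comp
  rw [proj_preimage_trans_preimage, h2 A₁ hA₁]

end SpreadSections

/-- An open set containing the points of codimension one that are not in the image of `π`. -/
def IsGood {X Y : Scheme.{u}} (π : X ⟶ Y) (W : Y.Opens) : Prop :=
  ∀ y : Y, Order.coheight y = 1 → y ∉ Set.range π → y ∈ W

/-! ### Points of codimension one outside the generic fibre -/

section Vertical

variable {n : ℕ} {Δ : Fan n}

lemma coheight_chartι {R : Type u} [CommRing R] {σ : Δ.cones} (y : chart R σ.1) :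
    Order.coheight (chartι Δ R σ y) = y.asIdeal.height :=
  (coheight_eq_of_isOpenImmersion (chartι Δ R σ)).trans
    (idealHeight_eq_coheight (CommRingCat.of (ChartRing R σ.1)) y).symm

/-- Over a domain, a prime of height one containing a nonzero constant is generated by constants. -/
lemma coeff_mem_of_height_eq_one {R : Type u} [CommRing R] [IsDomain R]
    {σ : PointedCone ℝ (Fin n → ℝ)} (P : Ideal (ChartRing R σ)) [P.IsPrime] (hP : P.height = 1)
    (h0 : P.comap (algebraMap R _) ≠ ⊥) {f : ChartRing R σ} (hf : f ∈ P) (m : dualMonoid σ) :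
    f.coeff m ∈ P.comap (algebraMap R _) := by
  -- The functions with all coefficients in `s` form the kernel of reduction modulo `s`. It is a
  -- nonzero prime inside `P`, hence equal to `P` by height.
  let s := P.comap (algebraMap R (ChartRing R σ))
  let q := AddMonoidAlgebra.mapRingHom (dualMonoid σ) (Ideal.Quotient.mk s)
  have hQ : (RingHom.ker q).IsPrime := RingHom.ker_isPrime q
  have hmem : ∀ g, g ∈ RingHom.ker q ↔ ∀ m, g.coeff m ∈ s := by
    intro g
    rw [RingHom.mem_ker]
    constructor
    · intro h m
      have := congr(($h).coeff m)
      rw [AddMonoidAlgebra.coeff_mapRingHom] at this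
      exact Ideal.Quotient.eq_zero_iff_mem.1 this
    · intro h
      refine AddMonoidAlgebra.ext (Finsupp.ext fun m => ?_)
      rw [AddMonoidAlgebra.coeff_mapRingHom]
      exact Ideal.Quotient.eq_zero_iff_mem.2 (h m)
  have hle : RingHom.ker q ≤ P := by
    intro g hg
    rw [← AddMonoidAlgebra.sum_coeff_single g]
    refine Ideal.sum_mem _ fun m _ => ?_
    have : (AddMonoidAlgebra.single m (g.coeff m) : ChartRing R σ) =
        algebraMap _ _ (g.coeff m) * AddMonoidAlgebra.single m 1 := by
      simp [AddMonoidAlgebra.single_mul_single]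
    rw [this]
    exact Ideal.mul_mem_right _ _ ((hmem g).1 hg m)
  have hne : RingHom.ker q ≠ ⊥ := by
    obtain ⟨c, hc, hc0⟩ := Submodule.exists_mem_ne_zero_of_ne_bot h0
    intro hbot
    have h1 : algebraMap R (ChartRing R σ) c ∈ RingHom.ker q := by
      rw [hmem]
      intro m
      have : algebraMap R (ChartRing R σ) c = AddMonoidAlgebra.single 0 c := by simp
      rw [this, AddMonoidAlgebra.coeff_single, Finsupp.single_apply]
      split_ifs
      · exact hc
      · exact zero_mem _
    rw [hbot, Ideal.mem_bot] at h1
    refine hc0 ?_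
    have h2 : algebraMap R (ChartRing R σ) c = AddMonoidAlgebra.single 0 c := by simp
    have := congr(($h1).coeff 0)
    rw [h2, AddMonoidAlgebra.coeff_single, Finsupp.single_eq_same] at this
    exact this
  have heq : RingHom.ker q = P := by
    by_contra hcon
    have : P.FiniteHeight := P.finiteHeight_iff.2 (.inr (by rw [hP]; exact ENat.one_ne_top))
    have : (RingHom.ker q).FiniteHeight := (RingHom.ker q).finiteHeight_iff.2
      (.inr (((Ideal.height_mono hle).trans hP.le).trans_lt ENat.one_lt_top).ne)
    have h1 := Ideal.height_strict_mono_of_isPrime_of_isPrime (lt_of_le_of_ne hle hcon)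
    have h2 := Ideal.height_strict_mono_of_isPrime_of_isPrime (bot_lt_iff_ne_bot.2 hne)
    rw [hP, Order.lt_one_iff] at h1
    rw [h1] at h2
    exact not_lt_zero h2
  exact (hmem f).1 (heq.ge hf) m

/-- A point whose prime contains no nonzero constant lies over the generic point of `Spec R`, which
is the image of `Spec K`; the fibre product then has a point above it. -/
lemma comap_ne_bot_of_notMem_range {R K : Type u} [CommRing R] [Field K] {φ : R →+* K}
    (hφ : Function.Injective φ) {σ : Δ.cones} (y : chart R σ.1)
    (hy : chartι Δ R σ y ∉ Set.range (toricMap Δ φ)) :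
    y.asIdeal.comap (algebraMap R (ChartRing R σ.1)) ≠ ⊥ := by
  intro hbot
  refine hy ?_
  have hp := isPullback_toricMap Δ φ
  have h1 : toricStr Δ R (chartι Δ R σ y) = Spec.map (CommRingCat.ofHom φ)
      (⊥ : PrimeSpectrum K) := by
    rw [← Scheme.Hom.comp_apply, chartι_toricStr]
    refine PrimeSpectrum.ext ?_
    refine Eq.trans (b := (⊥ : Ideal R)) hbot ?_
    exact ((RingHom.injective_iff_ker_eq_bot φ).1 hφ).symm
  obtain ⟨z, hz, -⟩ := Scheme.Pullback.exists_preimage_pullback _ _ h1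
  refine ⟨hp.isoPullback.inv z, ?_⟩
  rw [← hz, ← Scheme.Hom.comp_apply, hp.isoPullback_inv_fst]

/-- The points of codimension one outside of the generic fibre lie in all charts, and in the
locus where a function with an invertible coefficient does not vanish. -/
lemma exists_chartι_eq_of_notMem_range {R K : Type u} [CommRing R] [IsDomain R] [Field K]
    {φ : R →+* K} (hφ : Function.Injective φ) {y : toricVariety Δ R}
    (hy1 : Order.coheight y = 1) (hy : y ∉ Set.range (toricMap Δ φ)) (σ : Δ.cones)
    {h : ChartRing R σ.1} {m : dualMonoid σ.1} (hm : IsUnit (h.coeff m)) :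
    ∃ y' : chart R σ.1, chartι Δ R σ y' = y ∧ h ∉ y'.asIdeal := by
  have hunit : ∀ (τ : Δ.cones) (z : chart R τ.1) (g : ChartRing R τ.1) (k : dualMonoid τ.1),
      chartι Δ R τ z = y → IsUnit (g.coeff k) → g ∉ z.asIdeal := by
    rintro τ z g k rfl hk hg
    rw [coheight_chartι] at hy1
    have hz := z.isPrime
    have hz' : (z.asIdeal.comap (algebraMap R (ChartRing R τ.1))).IsPrime := Ideal.comap_isPrime _ _
    have := coeff_mem_of_height_eq_one z.asIdeal hy1 (comap_ne_bot_of_notMem_range hφ z hy) hg k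
    exact hz'.ne_top (Ideal.eq_top_of_isUnit_mem _ this hk)
  obtain ⟨τ, z, hz⟩ := exists_chartι_eq Δ R y
  obtain ⟨u, hu, hu'⟩ := Δ.isFace_of_le (Δ.inter σ τ).2 τ.2 (Δ.inter_le_right σ τ)
  have hr := range_chartMap R (Δ.inter_le_right σ τ) (Δ.rational _ τ.2) hu hu'
  -- The character cutting out `σ ∩ τ` in `τ` has coefficient `1`, so it does not vanish at the
  -- point, which therefore lies in `U_σ` too.
  obtain ⟨w, hw⟩ : z ∈ Set.range (chartMap R (Δ.inter_le_right σ τ)) := by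
    rw [hr]
    refine hunit τ z _ ⟨u, hu⟩ hz ?_
    rw [AddMonoidAlgebra.coeff_single, Finsupp.single_eq_same]
    exact isUnit_one
  refine ⟨chartMap R (Δ.inter_le_left σ τ) w, ?_, ?_⟩
  · rw [← hz, ← hw, ← Scheme.Hom.comp_apply, ← Scheme.Hom.comp_apply,
      chartMap_chartι Δ R (Δ.inter_le_left σ τ), chartMap_chartι Δ R (Δ.inter_le_right σ τ)]
  · refine hunit σ _ h m ?_ hm
    rw [← hz, ← hw, ← Scheme.Hom.comp_apply, ← Scheme.Hom.comp_apply,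
      chartMap_chartι Δ R (Δ.inter_le_left σ τ), chartMap_chartι Δ R (Δ.inter_le_right σ τ)]

open Filter

lemma FGSub.eventually_mem {K : Type u} [CommRing K] (x : K) :
    ∀ᶠ A : FGSub K in atTop, x ∈ A.1 := by
  obtain ⟨A, hA⟩ := FGSub.exists_mem x
  filter_upwards [eventually_ge_atTop A] with B hB using hB hA

lemma FGSub.eventually_exists_mapRingHom_eq {K : Type u} [CommRing K]
    {σ : PointedCone ℝ (Fin n → ℝ)} (h : ChartRing K σ) : ∀ᶠ A : FGSub K in atTop,
      ∃ g : ChartRing A.1 σ, AddMonoidAlgebra.mapRingHom (dualMonoid σ) (algebraMap A.1 K) g = h := by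
  induction h using AddMonoidAlgebra.induction_linear with
  | zero => exact .of_forall fun A => ⟨0, map_zero _⟩
  | add x y hx hy =>
    filter_upwards [hx, hy] with A ⟨a, ha⟩ ⟨b, hb⟩
    exact ⟨a + b, by rw [map_add, ha, hb]⟩
  | single m r =>
    filter_upwards [FGSub.eventually_mem r] with A hA
    exact ⟨AddMonoidAlgebra.single m ⟨r, hA⟩, AddMonoidAlgebra.mapRingHom_single ..⟩

variable [hfg : ∀ σ : Δ.cones, AddMonoid.FG (dualMonoid σ.1)]

/-- In one chart `U` contains the nonempty nonvanishing locus of some `h`. As soon as `A` contains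
the coefficients of `h` and the inverse of one of them, this locus contains all vertical points of
codimension one. -/
lemma eventually_isGood_spread {K : Type u} [Field K] {U : (toricVariety Δ K).Opens}
    (hU : (U : Set (toricVariety Δ K)).Nonempty) :
    ∀ᶠ A in atTop, IsGood (proj Δ K A) (spread U A) := by
  obtain ⟨σ⟩ := nonempty_cones Δ
  have hne : ((chartι Δ K σ).opensRange : Set (toricVariety Δ K)).Nonempty :=
    ⟨_, ⟨(⊥ : PrimeSpectrum (ChartRing K σ.1)), rfl⟩⟩
  obtain ⟨_, hx, x, rfl⟩ := nonempty_preirreducible_inter U.isOpen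
    (chartι Δ K σ).opensRange.isOpen hU hne
  obtain ⟨_, ⟨_, ⟨h, rfl⟩, rfl⟩, hxh, hhU⟩ :=
    PrimeSpectrum.isBasis_basic_opens.exists_subset_of_mem_open
      (show x ∈ ((chartι Δ K σ) ⁻¹ᵁ U : Set _) from hx) ((chartι Δ K σ) ⁻¹ᵁ U).isOpen
  have hh0 : h ≠ 0 := by
    rintro rfl
    exact hxh (zero_mem _)
  obtain ⟨m, hm⟩ : ∃ m, h.coeff m ≠ 0 := by
    by_contra! hcon
    exact hh0 (AddMonoidAlgebra.ext (Finsupp.ext hcon))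
  obtain ⟨A₁, ⟨h₁, hh₁⟩, hc⟩ := ((FGSub.eventually_exists_mapRingHom_eq h).and
    (FGSub.eventually_mem (h.coeff m)⁻¹)).exists
  have hunit : IsUnit (h₁.coeff m) := by
    refine IsUnit.of_mul_eq_one ⟨_, hc⟩ (Subtype.ext ?_)
    have h2 : algebraMap A₁.1 K (h₁.coeff m) = h.coeff m := by
      rw [← hh₁, AddMonoidAlgebra.coeff_mapRingHom]
    change algebraMap A₁.1 K (h₁.coeff m) * (h.coeff m)⁻¹ = 1
    rw [h2, mul_inv_cancel₀ hm]
  let W₁ : (toricVariety Δ A₁.1).Opens := (chartι Δ A₁.1 σ) ''ᵁ (PrimeSpectrum.basicOpen h₁)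
  have hW₁ : proj Δ K A₁ ⁻¹ᵁ W₁ ≤ U := by
    rintro z ⟨w, hw, hwz⟩
    have hz : z ∈ proj Δ K A₁ ⁻¹ᵁ (chartι Δ A₁.1 σ).opensRange := ⟨w, hwz⟩
    rw [toricMap_preimage_opensRange] at hz
    obtain ⟨z, rfl⟩ := hz
    rw [← Scheme.Hom.comp_apply, chartι_toricMap, Scheme.Hom.comp_apply] at hwz
    have h2 := (chartι Δ A₁.1 σ).isOpenEmbedding.injective hwz
    refine hhU ?_
    change h ∉ z.asIdeal
    rw [← hh₁]
    rw [h2] at hw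
    exact hw
  filter_upwards [(spreadsTo_pullOpens W₁).eventually_le (spreadsTo_spread U) hW₁,
    eventually_ge_atTop A₁] with A hA hA₁ y hy1 hy
  refine hA ?_
  rw [pullOpens_eq Δ W₁ hA₁]
  obtain ⟨y', rfl, hy'⟩ := exists_chartι_eq_of_notMem_range (φ := algebraMap A.1 K)
    Subtype.val_injective hy1 hy σ
    (h := AddMonoidAlgebra.mapRingHom (dualMonoid σ.1) (FGSub.incl hA₁) h₁) (m := m) (by
      rw [AddMonoidAlgebra.coeff_mapRingHom]
      exact hunit.map _)
  refine ⟨chartBaseMap (FGSub.incl hA₁) σ.1 y', hy', ?_⟩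
  exact congr($(chartι_toricMap Δ (FGSub.incl hA₁) σ) y').symm

end Vertical

/-! ### Flat local homomorphisms: orders and heights -/

section LocalAlgebra

variable {R S : Type*} [CommRing R] [CommRing S] [IsLocalRing R] [IsLocalRing S] [Algebra R S]
  [Module.Flat R S] [IsLocalHom (algebraMap R S)]

open TensorProduct in
-- The order is the length of `R ⧸ (f)`, and flat local base change multiplies lengths by the length
-- of the closed fibre.
lemma ord_algebraMap (f : R) :
    Ring.ord S (algebraMap R S f) = Ring.ord R f *
      Module.length S (S ⧸ (IsLocalRing.maximalIdeal R).map (algebraMap R S)) := by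
  rw [Ring.ord, Ring.ord, ← IsLocalRing.length_baseChange R S (R ⧸ Ideal.span {f})]
  have h : Ideal.span {algebraMap R S f} = (Ideal.span {f}).map (algebraMap R S) := by
    rw [Ideal.map_span, Set.image_singleton]
  rw [h]
  exact (Algebra.TensorProduct.quotIdealMapEquivTensorQuot S (Ideal.span {f})).toLinearEquiv.length_eq

lemma height_maximalIdeal_le [IsNoetherianRing R] [IsNoetherianRing S] :
    (IsLocalRing.maximalIdeal R).height ≤ (IsLocalRing.maximalIdeal S).height := by
  have : (IsLocalRing.maximalIdeal S).LiesOver (IsLocalRing.maximalIdeal R) :=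
    ⟨(IsLocalRing.maximalIdeal_comap (algebraMap R S)).symm⟩
  rw [Ideal.height_eq_height_add_of_liesOver_of_hasGoingDown (IsLocalRing.maximalIdeal R)
    (IsLocalRing.maximalIdeal S)]
  exact le_self_add

end LocalAlgebra

/-! ### Points of codimension one and their images -/

section Points

variable {X Y : Scheme.{u}} (π : X ⟶ Y)

lemma height_maximalIdeal_stalk (x : X) :
    (IsLocalRing.maximalIdeal (X.presheaf.stalk x)).height = Order.coheight x := by
  have h1 := ringKrullDim_stalk_eq_coheight x
  rw [← IsLocalRing.maximalIdeal_height_eq_ringKrullDim] at h1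
  exact_mod_cast h1

lemma coheight_eq_height_primeIdealOf {U : X.Opens} (hU : IsAffineOpen U) (x : U) :
    (hU.primeIdealOf x).asIdeal.height = Order.coheight x.1 := by
  refine (idealHeight_eq_coheight Γ(X, U) (hU.primeIdealOf x)).trans ?_
  conv_rhs => rw [← hU.fromSpec_primeIdealOf x]
  exact (coheight_eq_of_isOpenImmersion hU.fromSpec).symm

lemma mem_primeIdealOf_iff {U : X.Opens} (hU : IsAffineOpen U) (x : U) (a : Γ(X, U)) :
    a ∈ (hU.primeIdealOf x).asIdeal ↔ x.1 ∉ X.basicOpen a := by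
  have h1 := hU.fromSpec_preimage_basicOpen a
  have h2 : hU.primeIdealOf x ∈ hU.fromSpec ⁻¹ᵁ X.basicOpen a ↔ x.1 ∈ X.basicOpen a := by
    change hU.fromSpec (hU.primeIdealOf x) ∈ X.basicOpen a ↔ _
    rw [hU.fromSpec_primeIdealOf]
  rw [h1] at h2
  rw [← h2]
  exact not_not.symm

/-- The point `x` is the unique point of codimension one above its image, and is a reduced
component of its fibre. -/
def IsDescended (x : X) : Prop :=
  (IsLocalRing.maximalIdeal (Y.presheaf.stalk (π x))).map (π.stalkMap x).hom =
      IsLocalRing.maximalIdeal (X.presheaf.stalk x) ∧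
    ∀ x' : X, Order.coheight x' = 1 → π x' = π x → x' = x

variable {π}

/-- Generators of the prime of `x` that come from `Y` also generate its maximal ideal from that of
`π x`. They vanish at every `x'` above `π x`, so `x'` is a specialization of `x`, and equal
codimension gives `x' = x`. -/
lemma isDescended_of_lifts [IsLocallyNoetherian X] {x : X} (hx1 : Order.coheight x = 1)
    {U : X.Opens} (hU : IsAffineOpen U) (hx : x ∈ U) {V : Y.Opens} (hV : π ⁻¹ᵁ V = U)
    {S : Set Γ(X, U)} (hS : Ideal.span S = (hU.primeIdealOf ⟨x, hx⟩).asIdeal)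
    (hlift : ∀ a ∈ S, ∃ b : Γ(Y, V), IsLift π b a) : IsDescended π x := by
  subst hV
  have hlift' : ∀ a ∈ S, ∃ b : Γ(Y, V), π.app V b = a := by
    intro a ha
    obtain ⟨b, _, hb⟩ := hlift a ha
    exact ⟨b, by rw [Scheme.Hom.app_eq_appLE]; exact hb⟩
  have hmem : ∀ a ∈ S, x ∉ X.basicOpen a := by
    intro a ha
    exact (mem_primeIdealOf_iff hU ⟨x, hx⟩ a).1 (hS ▸ Ideal.subset_span ha)
  constructor
  · apply le_antisymm
    · exact Ideal.map_le_iff_le_comap.2 (IsLocalRing.maximalIdeal_comap (π.stalkMap x).hom).ge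
    · let := (X.presheaf.germ (π ⁻¹ᵁ V) x hx).hom.toAlgebra
      have hloc : IsLocalization.AtPrime (X.presheaf.stalk x)
          (hU.primeIdealOf ⟨x, hx⟩).asIdeal := hU.isLocalization_stalk ⟨x, hx⟩
      rw [← IsLocalization.AtPrime.map_eq_maximalIdeal (hU.primeIdealOf ⟨x, hx⟩).asIdeal
        (X.presheaf.stalk x), ← hS, Ideal.map_span, Ideal.span_le]
      rintro _ ⟨a, ha, rfl⟩
      obtain ⟨b, hb⟩ := hlift' a ha
      have h1 : π.stalkMap x (Y.presheaf.germ V (π x) (show π x ∈ V from hx) b) =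
          X.presheaf.germ (π ⁻¹ᵁ V) x hx a :=
        (Scheme.Hom.germ_stalkMap_apply π V x hx b).trans (by rw [hb])
      refine h1 ▸ Ideal.mem_map_of_mem _ ?_
      rw [IsLocalRing.mem_maximalIdeal, mem_nonunits_iff]
      intro hu
      refine hmem a ha ?_
      rw [← hb, ← Scheme.preimage_basicOpen]
      exact (Y.mem_basicOpen _ _ (show π x ∈ V from hx)).2 hu
  · intro x' hx1' hxx'
    have hx' : x' ∈ π ⁻¹ᵁ V := by
      change π x' ∈ V
      rw [hxx']; exact hx
    have hle : (hU.primeIdealOf ⟨x, hx⟩).asIdeal ≤ (hU.primeIdealOf ⟨x', hx'⟩).asIdeal := by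
      rw [← hS, Ideal.span_le]
      intro a ha
      refine (mem_primeIdealOf_iff hU ⟨x', hx'⟩ a).2 fun hcon => hmem a ha ?_
      obtain ⟨b, hb⟩ := hlift' a ha
      rw [← hb, ← Scheme.preimage_basicOpen] at hcon ⊢
      have h1 : π x' ∈ Y.basicOpen b := hcon
      rw [hxx'] at h1
      exact h1
    have heq : hU.primeIdealOf ⟨x, hx⟩ = hU.primeIdealOf ⟨x', hx'⟩ := by
      by_contra hne
      have h1 := coheight_eq_height_primeIdealOf hU ⟨x, hx⟩
      have h2 := coheight_eq_height_primeIdealOf hU ⟨x', hx'⟩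
      have := (hU.primeIdealOf ⟨x, hx⟩).isPrime
      have := (hU.primeIdealOf ⟨x', hx'⟩).isPrime
      have : IsNoetherianRing Γ(X, π ⁻¹ᵁ V) := IsLocallyNoetherian.component_noetherian ⟨_, hU⟩
      have h3 := Ideal.height_strict_mono_of_isPrime_of_isPrime
        (lt_of_le_of_ne hle fun h => hne (PrimeSpectrum.ext h))
      rw [h1, h2, hx1, hx1'] at h3
      exact lt_irrefl _ h3
    have h4 := congrArg hU.fromSpec heq
    rw [hU.fromSpec_primeIdealOf, hU.fromSpec_primeIdealOf] at h4
    exact h4.symm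

lemma coheight_le_of_flat [Flat π] [IsLocallyNoetherian X] [IsLocallyNoetherian Y] (x : X) :
    Order.coheight (π x) ≤ Order.coheight x := by
  rw [← height_maximalIdeal_stalk, ← height_maximalIdeal_stalk]
  algebraize [(π.stalkMap x).hom]
  have : Module.Flat (Y.presheaf.stalk (π x)) (X.presheaf.stalk x) := Flat.stalkMap π x
  have : IsLocalHom (algebraMap (Y.presheaf.stalk (π x)) (X.presheaf.stalk x)) :=
    inferInstanceAs (IsLocalHom (π.stalkMap x).hom)
  exact height_maximalIdeal_le

/-- Flatness bounds the codimension of the image by one. If it were zero, the maximal ideal at `π x`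
would vanish, and so would the maximal ideal at `x` which it generates. -/
lemma IsDescended.coheight_eq [Flat π] [IsLocallyNoetherian X] [IsLocallyNoetherian Y]
    [IsIntegral X] [IsIntegral Y] {x : X}
    (h : IsDescended π x) (hx : Order.coheight x = 1) : Order.coheight (π x) = 1 := by
  refine le_antisymm ((coheight_le_of_flat x).trans hx.le) ?_
  rw [Order.one_le_iff_ne_zero]
  intro h0
  rw [← height_maximalIdeal_stalk] at h0 hx
  have h1 : IsLocalRing.maximalIdeal (Y.presheaf.stalk (π x)) = ⊥ := by
    by_contra hne
    have := Ideal.height_strict_mono_of_isPrime_of_isPrime (bot_lt_iff_ne_bot.2 hne)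
    rw [h0] at this
    exact not_lt_zero this
  have h2 := h.1
  rw [h1, Ideal.map_bot] at h2
  rw [← h2, Ideal.height_bot] at hx
  exact zero_ne_one hx

lemma IsDescended.fibreMultiplicity_eq {x : X} (h : IsDescended π x) :
    fibreMultiplicity π x = 1 := by
  rw [fibreMultiplicity, h.1]
  have : IsSimpleModule (X.presheaf.stalk x)
      (X.presheaf.stalk x ⧸ IsLocalRing.maximalIdeal (X.presheaf.stalk x)) :=
    isSimpleModule_iff_quot_maximal.2
      ⟨_, IsLocalRing.maximalIdeal.isMaximal _, ⟨LinearEquiv.refl _ _⟩⟩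
  rw [Module.length_eq_one]
  rfl

/-- The points of codimension one of `Y` in the image of `π` are images of points of codimension
one. -/
lemma exists_coheight_eq_one [IsIntegral X] [IsIntegral Y] [IsLocallyNoetherian X]
    [QuasiCompact π] [IsSchemeTheoreticallyDominant π] {y : Y} (hy1 : Order.coheight y = 1)
    (hy : y ∈ Set.range π) : ∃ x, Order.coheight x = 1 ∧ π x = y := by
  obtain ⟨x', rfl⟩ := hy
  obtain ⟨V, hV, hyV, -⟩ := exists_isAffineOpen_mem_and_subset (X := Y) (x := π x') (U := ⊤) trivial
  obtain ⟨U, hU, hxU, hUV⟩ := exists_isAffineOpen_mem_and_subset (X := X) (x := x') (U := π ⁻¹ᵁ V) hyV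
  let φ := π.appLE V U hUV
  have : Nonempty U := ⟨⟨x', hxU⟩⟩
  have hφ : Function.Injective φ := by
    intro a b hab
    refine π.app_injective V (map_injective_of_isIntegral X (homOfLE hUV) ?_)
    exact hab
  let P := (hV.primeIdealOf ⟨π x', hyV⟩).asIdeal
  let P' := (hU.primeIdealOf ⟨x', hxU⟩).asIdeal
  have hPP' : P'.comap φ.hom = P :=
    congrArg PrimeSpectrum.asIdeal (IsAffineOpen.comap_primeIdealOf_appLE V hV U hU hUV hxU)
  have hPh : P.height = 1 := (coheight_eq_height_primeIdealOf hV ⟨π x', hyV⟩).trans hy1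
  have : Nonempty V := ⟨⟨π x', hyV⟩⟩
  have hPp : P.IsPrime := (hV.primeIdealOf ⟨π x', hyV⟩).isPrime
  have hP'p : P'.IsPrime := (hU.primeIdealOf ⟨x', hxU⟩).isPrime
  have hPne : P ≠ ⊥ := by
    intro h
    rw [h, Ideal.height_bot] at hPh
    exact zero_ne_one hPh
  -- A minimal prime `Q` of `φ f` below the prime of `x'` has height one by Krull's principal ideal
  -- theorem. It contracts to a nonzero prime inside `P`, hence to `P`.
  obtain ⟨f, hf, hf0⟩ := Submodule.exists_mem_ne_zero_of_ne_bot hPne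
  have hfP' : Ideal.span {φ f} ≤ P' := by
    rw [Ideal.span_singleton_le_iff_mem]
    exact hPP'.ge hf
  obtain ⟨Q, hQ, hQP'⟩ := Ideal.exists_minimalPrimes_le hfP'
  have hQp : Q.IsPrime := hQ.1.1
  have hfQ : φ f ∈ Q := hQ.1.2 (Ideal.mem_span_singleton_self _)
  have : IsNoetherianRing Γ(X, U) := IsLocallyNoetherian.component_noetherian ⟨_, hU⟩
  have hQ1 : Q.height = 1 := by
    apply le_antisymm
    · exact Ideal.height_le_one_of_isPrincipal_of_mem_minimalPrimes _ _ hQ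
    · rw [Order.one_le_iff_ne_zero]
      intro h0
      have hQne : (⊥ : Ideal Γ(X, U)) < Q := by
        refine bot_lt_iff_ne_bot.2 fun h => hf0 ?_
        rw [h, Ideal.mem_bot] at hfQ
        exact hφ (hfQ.trans (map_zero _).symm)
      have := Ideal.height_strict_mono_of_isPrime_of_isPrime hQne
      rw [h0] at this
      exact not_lt_zero this
  have hQP : Q.comap φ.hom = P := by
    have hle : Q.comap φ.hom ≤ P := (Ideal.comap_mono hQP').trans hPP'.le
    have hQcp : (Q.comap φ.hom).IsPrime := Ideal.comap_isPrime _ _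
    by_contra hne
    have : P.FiniteHeight := P.finiteHeight_iff.2 (.inr (by rw [hPh]; exact ENat.one_ne_top))
    have : (Q.comap φ.hom).FiniteHeight := (Q.comap φ.hom).finiteHeight_iff.2
      (.inr (((Ideal.height_mono hle).trans hPh.le).trans_lt ENat.one_lt_top).ne)
    have h1 := Ideal.height_strict_mono_of_isPrime_of_isPrime (lt_of_le_of_ne hle hne)
    have hbot : (⊥ : Ideal Γ(Y, V)) < Q.comap φ.hom :=
      bot_lt_iff_ne_bot.2 fun h => hf0 (by
        have : f ∈ Q.comap φ.hom := hfQ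
        rwa [h, Ideal.mem_bot] at this)
    have h2 := Ideal.height_strict_mono_of_isPrime_of_isPrime hbot
    rw [hPh, Order.lt_one_iff] at h1
    rw [h1] at h2
    exact not_lt_zero h2
  let q : PrimeSpectrum Γ(X, U) := ⟨Q, hQp⟩
  refine ⟨hU.fromSpec q, ?_, ?_⟩
  · refine (coheight_eq_of_isOpenImmersion hU.fromSpec).trans ?_
    rw [← hQ1]
    exact (idealHeight_eq_coheight Γ(X, U) q).symm
  · have h1 := congr($(IsAffineOpen.SpecMap_appLE_fromSpec π hV hU hUV) q)
    refine Eq.trans (h1.symm : π (hU.fromSpec q) = hV.fromSpec (Spec.map φ q)) ?_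
    have h2 : Spec.map φ q = hV.primeIdealOf ⟨π x', hyV⟩ := PrimeSpectrum.ext hQP
    have h3 := hV.fromSpec_primeIdealOf ⟨π x', hyV⟩
    rw [← h2] at h3
    exact h3

end Points

/-! ### Orders of vanishing under flat pullback -/

section Order

lemma app_ne_zero {X Y : Scheme.{u}} {π : X ⟶ Y} [QuasiCompact π] [IsSchemeTheoreticallyDominant π]
    {V : Y.Opens} {f : Γ(Y, V)} (hf : f ≠ 0) : π.app V f ≠ 0 := by
  rwa [ne_eq, map_eq_zero_iff _ (π.app_injective V)]

variable {X Y : Scheme.{u}} [IsIntegral X] [IsLocallyNoetherian X] [IsIntegral Y]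
  [IsLocallyNoetherian Y] {π : X ⟶ Y}

lemma ord_germToFunctionField {U : X.Opens} [Nonempty U] {f : Γ(X, U)} (hf : f ≠ 0) {x : X}
    (hx1 : Order.coheight x = 1) (hx : x ∈ U) {k : ℕ}
    (hk : Ring.ord (X.presheaf.stalk x) (X.presheaf.germ U x hx f) = k) :
    Scheme.ord (X.germToFunctionField U f) x = k := by
  have hf' : X.germToFunctionField U f ≠ 0 := by
    rwa [ne_eq, map_eq_zero_iff _ (X.germToFunctionField_injective U)]
  have hg : X.presheaf.germ U x hx f ≠ 0 := by
    rwa [ne_eq, map_eq_zero_iff _ (germ_injective_of_isIntegral X x hx)]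
  rw [Scheme.ord_eq_iff hx1 hf', ← Scheme.algebraMap_germ_eq_germToFunctionField X hx]
  have : Ring.KrullDimLE 1 (X.presheaf.stalk x) := krullDimLE_of_coheight_le hx1.le
  refine (Ring.ordFrac_eq_ord _ hg).trans ?_
  exact Ring.ordMonoidWithZeroHom_eq_coe _ (mem_nonZeroDivisors_of_ne_zero hg) hk

lemma exists_ord_eq {U : X.Opens} [Nonempty U] {f : Γ(X, U)} (hf : f ≠ 0) {x : X}
    (hx1 : Order.coheight x = 1) (hx : x ∈ U) :
    ∃ k : ℕ, Ring.ord (X.presheaf.stalk x) (X.presheaf.germ U x hx f) = k := by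
  have : Ring.KrullDimLE 1 (X.presheaf.stalk x) := krullDimLE_of_coheight_le hx1.le
  have hg : X.presheaf.germ U x hx f ≠ 0 := by
    rwa [ne_eq, map_eq_zero_iff _ (germ_injective_of_isIntegral X x hx)]
  exact ⟨_, (ENat.natCast_toNat (Ring.ord_ne_top (mem_nonZeroDivisors_of_ne_zero hg))).symm⟩

/-- The length of the fibre at a point of codimension one is finite and nonzero. -/
lemma length_fibre [Flat π] [QuasiCompact π] [IsSchemeTheoreticallyDominant π] {x : X}
    (hx1 : Order.coheight x = 1) (hy1 : Order.coheight (π x) = 1) :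
    fibreMultiplicity π x ≠ 0 ∧ Module.length (X.presheaf.stalk x) (X.presheaf.stalk x ⧸
      (IsLocalRing.maximalIdeal (Y.presheaf.stalk (π x))).map (π.stalkMap x).hom) =
        fibreMultiplicity π x := by
  have hne : (IsLocalRing.maximalIdeal (Y.presheaf.stalk (π x))).map (π.stalkMap x).hom ≠ ⊤ := by
    refine ne_top_of_le_ne_top (IsLocalRing.maximalIdeal.isMaximal (X.presheaf.stalk x)).ne_top ?_
    exact Ideal.map_le_iff_le_comap.2 (IsLocalRing.maximalIdeal_comap (π.stalkMap x).hom).ge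
  have hpos : Module.length (X.presheaf.stalk x) (X.presheaf.stalk x ⧸
      (IsLocalRing.maximalIdeal (Y.presheaf.stalk (π x))).map (π.stalkMap x).hom) ≠ 0 := by
    rw [ne_eq, Module.length_eq_zero_iff]
    rwa [Submodule.Quotient.subsingleton_iff]
  have htop : Module.length (X.presheaf.stalk x) (X.presheaf.stalk x ⧸
      (IsLocalRing.maximalIdeal (Y.presheaf.stalk (π x))).map (π.stalkMap x).hom) ≠ ⊤ := by
    have hmax : IsLocalRing.maximalIdeal (Y.presheaf.stalk (π x)) ≠ ⊥ := by
      intro h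
      rw [← height_maximalIdeal_stalk, h, Ideal.height_bot] at hy1
      exact zero_ne_one hy1
    -- Finiteness: the fibre is a quotient of the stalk at `x` modulo a nonzero element, which has
    -- finite length in dimension one.
    obtain ⟨g, hg, hg0⟩ := Submodule.exists_mem_ne_zero_of_ne_bot hmax
    have : Ring.KrullDimLE 1 (X.presheaf.stalk x) := krullDimLE_of_coheight_le hx1.le
    have hinj : Function.Injective (π.stalkMap x).hom := by
      algebraize [(π.stalkMap x).hom]
      have : Module.Flat (Y.presheaf.stalk (π x)) (X.presheaf.stalk x) := Flat.stalkMap π x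
      have : IsLocalHom (algebraMap (Y.presheaf.stalk (π x)) (X.presheaf.stalk x)) :=
        inferInstanceAs (IsLocalHom (π.stalkMap x).hom)
      have : Module.FaithfullyFlat (Y.presheaf.stalk (π x)) (X.presheaf.stalk x) :=
        Module.FaithfullyFlat.of_flat_of_isLocalHom
      exact FaithfulSMul.algebraMap_injective (Y.presheaf.stalk (π x)) (X.presheaf.stalk x)
    have hg' : (π.stalkMap x).hom g ≠ 0 := by
      rwa [ne_eq, map_eq_zero_iff _ hinj]
    have h1 := Ring.ord_ne_top (mem_nonZeroDivisors_of_ne_zero hg')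
    refine ne_top_of_le_ne_top h1 (Module.length_le_of_surjective
      (Submodule.factor (Ideal.span_le.2 ?_)) (Submodule.factor_surjective _))
    rw [Set.singleton_subset_iff]
    exact Ideal.mem_map_of_mem _ hg
  have hcoe := ENat.natCast_toNat htop
  refine ⟨fun h => hpos ?_, hcoe.symm⟩
  rw [fibreMultiplicity] at h
  rw [← hcoe, h]
  rfl

lemma ord_app [Flat π] [QuasiCompact π] [IsSchemeTheoreticallyDominant π] {x : X}
    (hx1 : Order.coheight x = 1) (hy1 : Order.coheight (π x) = 1) {V : Y.Opens} [Nonempty V]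
    [Nonempty (π ⁻¹ᵁ V)] (hV : π x ∈ V) {f : Γ(Y, V)} (hf : f ≠ 0) :
    Scheme.ord (X.germToFunctionField (π ⁻¹ᵁ V) (π.app V f)) x =
      fibreMultiplicity π x * Scheme.ord (Y.germToFunctionField V f) (π x) := by
  obtain ⟨k, hk⟩ := exists_ord_eq hf hy1 hV
  rw [ord_germToFunctionField hf hy1 hV hk]
  have := ord_germToFunctionField (app_ne_zero (π := π) hf) hx1 hV
    (k := k * fibreMultiplicity π x) (by
      rw [← Scheme.Hom.germ_stalkMap_apply]
      algebraize [(π.stalkMap x).hom]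
      have : Module.Flat (Y.presheaf.stalk (π x)) (X.presheaf.stalk x) := Flat.stalkMap π x
      have : IsLocalHom (algebraMap (Y.presheaf.stalk (π x)) (X.presheaf.stalk x)) :=
        inferInstanceAs (IsLocalHom (π.stalkMap x).hom)
      refine (ord_algebraMap (S := X.presheaf.stalk x) (Y.presheaf.germ V (π x) hV f)).trans ?_
      rw [hk, Nat.cast_mul, ← (length_fibre hx1 hy1).2]
      rfl)
  rw [this, Nat.cast_mul, mul_comm]

/-- If the divisor of `α / β` is the pullback of `D` over the generic fibre, then it is `D`,
provided that `α` and `β` do not vanish at the remaining points of codimension one. -/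
lemma ord_sub_ord_eq [Flat π] [QuasiCompact π] [IsSchemeTheoreticallyDominant π]
    {D : X → ℤ} {E : Y → ℤ}
    (hDE : ∀ x, Order.coheight x = 1 → D x = fibreMultiplicity π x * E (π x))
    (hE1 : ∀ y, E y ≠ 0 → Order.coheight y = 1) (hE : ∀ y, y ∉ Set.range π → E y = 0)
    {V : Y.Opens} [Nonempty V] [Nonempty (π ⁻¹ᵁ V)] {α β : Γ(Y, V)} (hα : α ≠ 0) (hβ : β ≠ 0)
    (hgα : IsGood π (Y.basicOpen α)) (hgβ : IsGood π (Y.basicOpen β))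
    (hD : ∀ x ∈ π ⁻¹ᵁ V, D x = Scheme.ord (X.germToFunctionField (π ⁻¹ᵁ V) (π.app V α)) x -
      Scheme.ord (X.germToFunctionField (π ⁻¹ᵁ V) (π.app V β)) x) {y : Y} (hy : y ∈ V) :
    E y = Scheme.ord (Y.germToFunctionField V α) y - Scheme.ord (Y.germToFunctionField V β) y := by
  by_cases hy1 : Order.coheight y = 1
  -- In the image, both sides are compared at a point of codimension one above `y` and the nonzero
  -- multiplicity is cancelled; outside it, `α` and `β` are units at `y`.
  · by_cases hyr : y ∈ Set.range π
    · obtain ⟨x, hx1, rfl⟩ := exists_coheight_eq_one hy1 hyr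
      have h1 := hD x hy
      rw [hDE x hx1, ord_app hx1 hy1 hy hα, ord_app hx1 hy1 hy hβ, ← mul_sub] at h1
      exact mul_left_cancel₀ (by exact_mod_cast (length_fibre (π := π) hx1 hy1).1) h1
    · have key : ∀ γ : Γ(Y, V), γ ≠ 0 → IsGood π (Y.basicOpen γ) →
          Scheme.ord (Y.germToFunctionField V γ) y = 0 := by
        intro γ hγ hg
        have hu := (Y.mem_basicOpen _ _ hy).1 (hg y hy1 hyr)
        exact ord_germToFunctionField hγ hy1 hy (k := 0) (Ring.ord_of_isUnit hu)
      rw [hE y hyr, key α hα hgα, key β hβ hgβ, sub_zero]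
  · rw [Scheme.ord_eq_zero_of_coheight_neq_one hy1, Scheme.ord_eq_zero_of_coheight_neq_one hy1,
      sub_zero]
    by_contra h
    exact hy1 (hE1 y h)

end Order

/-! ### Descent of Weil divisors -/

section

open Filter

section DescendDivisor

variable {X Y : Scheme.{u}} (π : X ⟶ Y) {R : Type*}

open Classical in
/-- The coefficients of the image of a divisor with descended components. -/
def descendCoeff [Zero R] (D : WeilDivisor X R) (y : Y) : R :=
  -- For descended components the choice is immaterial, since only one point of codimension one lies
  -- above `y`.
  if h : ∃ x, D.coeff x ≠ 0 ∧ π x = y then D.coeff h.choose else 0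

variable {π}

lemma descendCoeff_apply [Zero R] {D : WeilDivisor X R}
    (hD : ∀ x, D.coeff x ≠ 0 → IsDescended π x) {x : X} (hx : Order.coheight x = 1) :
    descendCoeff π D (π x) = D.coeff x := by
  by_cases h : ∃ x', D.coeff x' ≠ 0 ∧ π x' = π x
  · rw [descendCoeff, dif_pos h]
    have h1 := (hD _ h.choose_spec.1).2 x hx h.choose_spec.2.symm
    rw [← h1]
  · rw [descendCoeff, dif_neg h]
    by_contra hne
    exact h ⟨x, Ne.symm hne, rfl⟩

lemma exists_of_descendCoeff_ne_zero [Zero R] {D : WeilDivisor X R} {y : Y}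
    (h : descendCoeff π D y ≠ 0) : ∃ x, D.coeff x ≠ 0 ∧ π x = y := by
  by_contra hne
  exact h (dif_neg hne)

lemma finite_support_coeff [Zero R] [CompactSpace X] (D : WeilDivisor X R) :
    {x | D.coeff x ≠ 0}.Finite := by
  have h1 : LocallyFiniteSupport D.coeff := fun z =>
    D.1.supportLocallyFiniteWithinDomain' z trivial
  have := h1.finite_inter_support_of_isCompact isCompact_univ
  rwa [Set.univ_inter] at this

/-- The image of a divisor with descended components. -/
def descend [Zero R] [CompactSpace X] (π : X ⟶ Y) (D : WeilDivisor X R)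
    (hD : ∀ x, D.coeff x ≠ 0 → Order.coheight (π x) = 1) : WeilDivisor Y R :=
  ⟨{ toFun := descendCoeff π D
     supportWithinDomain' := Set.subset_univ _
     supportLocallyFiniteWithinDomain' := fun z _ => ⟨Set.univ, Filter.univ_mem, by
      refine ((finite_support_coeff D).image π).subset fun y hy => ?_
      obtain ⟨x, hx, rfl⟩ := exists_of_descendCoeff_ne_zero hy.2
      exact ⟨x, hx, rfl⟩⟩ }, fun y hy => by
      obtain ⟨x, hx, rfl⟩ := exists_of_descendCoeff_ne_zero hy
      exact hD x hx⟩

section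

variable [CompactSpace X]

lemma descend_coeff [Zero R] {D : WeilDivisor X R} (hD : ∀ x, D.coeff x ≠ 0 → IsDescended π x)
    (hD' : ∀ x, D.coeff x ≠ 0 → Order.coheight (π x) = 1) {x : X} (hx : Order.coheight x = 1) :
    (descend π D hD').coeff (π x) = D.coeff x :=
  descendCoeff_apply hD hx

lemma exists_of_descend_ne_zero [Zero R] {D : WeilDivisor X R}
    (hD' : ∀ x, D.coeff x ≠ 0 → Order.coheight (π x) = 1) {y : Y}
    (hy : (descend π D hD').coeff y ≠ 0) : ∃ x, D.coeff x ≠ 0 ∧ π x = y :=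
  exists_of_descendCoeff_ne_zero hy

lemma descend_eq_zero [Zero R] {D : WeilDivisor X R}
    (hD' : ∀ x, D.coeff x ≠ 0 → Order.coheight (π x) = 1) {y : Y} (hy : y ∉ Set.range π) :
    (descend π D hD').coeff y = 0 := by
  by_contra h
  obtain ⟨x, -, rfl⟩ := exists_of_descend_ne_zero hD' h
  exact hy ⟨x, rfl⟩

lemma isEffective_descend {D : WeilDivisor X ℤ}
    (hD : ∀ x, D.coeff x ≠ 0 → IsDescended π x)
    (hD' : ∀ x, D.coeff x ≠ 0 → Order.coheight (π x) = 1) (hE : IsEffective D) :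
    IsEffective (descend π D hD') := by
  intro y
  by_cases h : (descend π D hD').coeff y = 0
  · exact h.ge
  · obtain ⟨x, hx, rfl⟩ := exists_of_descend_ne_zero hD' h
    rw [descend_coeff hD hD' (D.2 x hx)]
    exact hE x

lemma isPullbackDivisor_descend [Semiring R] {D : WeilDivisor X R}
    (hD : ∀ x, D.coeff x ≠ 0 → IsDescended π x)
    (hD' : ∀ x, D.coeff x ≠ 0 → Order.coheight (π x) = 1) :
    IsPullbackDivisor π (descend π D hD') D := by
  intro x hx
  rw [descend_coeff hD hD' hx]
  by_cases h : D.coeff x = 0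
  · rw [h, mul_zero]
  · rw [(hD x h).fibreMultiplicity_eq, Nat.cast_one, one_mul]

lemma descend_mul {H : WeilDivisor X ℚ} {E : WeilDivisor X ℤ} {m : ℕ} (hm : 0 < m)
    (hEH : ∀ x, (E.coeff x : ℚ) = m * H.coeff x) (hH : ∀ x, H.coeff x ≠ 0 → IsDescended π x)
    (hE : ∀ x, E.coeff x ≠ 0 → IsDescended π x)
    (hH' : ∀ x, H.coeff x ≠ 0 → Order.coheight (π x) = 1)
    (hE' : ∀ x, E.coeff x ≠ 0 → Order.coheight (π x) = 1) (y : Y) :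
    ((descend π E hE').coeff y : ℚ) = m * (descend π H hH').coeff y := by
  have hm' : (m : ℚ) ≠ 0 := Nat.cast_ne_zero.2 hm.ne'
  by_cases h : ∃ x, Order.coheight x = 1 ∧ π x = y
  · obtain ⟨x, hx, rfl⟩ := h
    rw [descend_coeff hE hE' hx, descend_coeff hH hH' hx, hEH]
  · have h1 : (descend π E hE').coeff y = 0 := by
      by_contra hne
      obtain ⟨x, hx, hxy⟩ := exists_of_descend_ne_zero hE' hne
      exact h ⟨x, E.2 x hx, hxy⟩
    have h2 : (descend π H hH').coeff y = 0 := by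
      by_contra hne
      obtain ⟨x, hx, hxy⟩ := exists_of_descend_ne_zero hH' hne
      exact h ⟨x, H.2 x hx, hxy⟩
    rw [h1, h2, Int.cast_zero, mul_zero]

end

end DescendDivisor

section

variable {X Y : Scheme.{u}} {π : X ⟶ Y}

lemma IsGood.mono {V W : Y.Opens} (h : IsGood π V) (hVW : V ≤ W) : IsGood π W :=
  fun y hy1 hy => hVW (h y hy1 hy)

lemma nonempty_basicOpen [IsReduced X] {U : X.Opens} {a : Γ(X, U)} (ha : a ≠ 0) :
    (X.basicOpen a : Set X).Nonempty := by
  rw [Set.nonempty_iff_ne_empty]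
  exact fun h => ha ((basicOpen_eq_bot_iff a).1 (Opens.ext h))

lemma IsLift.ne_zero {V : Y.Opens} {U : X.Opens} {α : Γ(Y, V)} {a : Γ(X, U)} (h : IsLift π α a)
    (ha : a ≠ 0) : α ≠ 0 := by
  rintro rfl
  obtain ⟨_, h⟩ := h
  exact ha (h.symm.trans (map_zero _))

end

section OrdLift

variable {X Y : Scheme.{u}} [IsIntegral X] [IsLocallyNoetherian X] [IsIntegral Y]
  [IsLocallyNoetherian Y] {π : X ⟶ Y}

lemma IsLift.ord_sub_ord_eq [Flat π] [QuasiCompact π] [IsSchemeTheoreticallyDominant π]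
    {D : X → ℤ} {E : Y → ℤ}
    (hDE : ∀ x, Order.coheight x = 1 → D x = fibreMultiplicity π x * E (π x))
    (hE1 : ∀ y, E y ≠ 0 → Order.coheight y = 1) (hE : ∀ y, y ∉ Set.range π → E y = 0)
    {V : Y.Opens} {U : X.Opens} [Nonempty V] [Nonempty U] (hU : π ⁻¹ᵁ V = U) {α β : Γ(Y, V)}
    {a b : Γ(X, U)} (hαa : IsLift π α a) (hβb : IsLift π β b) (ha : a ≠ 0) (hb : b ≠ 0)
    (hgα : IsGood π (Y.basicOpen α)) (hgβ : IsGood π (Y.basicOpen β))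
    (hD : ∀ x ∈ U, D x = Scheme.ord (X.germToFunctionField U a) x -
      Scheme.ord (X.germToFunctionField U b) x) {y : Y} (hy : y ∈ V) :
    E y = Scheme.ord (Y.germToFunctionField V α) y - Scheme.ord (Y.germToFunctionField V β) y := by
  subst hU
  have key : ∀ {γ : Γ(Y, V)} {c : Γ(X, π ⁻¹ᵁ V)}, IsLift π γ c → π.app V γ = c := by
    rintro γ c ⟨_, h⟩
    rw [Scheme.Hom.app_eq_appLE]
    exact h
  refine ToricModel.ord_sub_ord_eq hDE hE1 hE (hαa.ne_zero ha) (hβb.ne_zero hb) hgα hgβ ?_ hy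
  rw [key hαa, key hβb]
  exact hD

lemma ord_germToFunctionField_one (U : X.Opens) [Nonempty U] (x : X) :
    Scheme.ord (X.germToFunctionField U 1) x = 0 := by
  rw [map_one]
  by_cases hx : Order.coheight x = 1
  · rw [Scheme.ord_eq_iff hx one_ne_zero, map_one]
    rfl
  · exact Scheme.ord_eq_zero_of_coheight_neq_one hx _

end OrdLift

/-! ### Divisors over all large subalgebras -/

section Eventually

variable {n : ℕ} {Δ : Fan n} {K : Type u} [Field K]
  [hfg : ∀ σ : Δ.cones, AddMonoid.FG (dualMonoid σ.1)]

/-- The prime of `x` in an affine neighbourhood is finitely generated, and its generators lift for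
large `A`. -/
lemma eventually_isDescended {x : toricVariety Δ K} (hx : Order.coheight x = 1) :
    ∀ᶠ A in atTop, IsDescended (proj Δ K A) x := by
  obtain ⟨U, hU, hxU, -⟩ :=
    exists_isAffineOpen_mem_and_subset (X := toricVariety Δ K) (x := x) (U := ⊤) trivial
  have : IsNoetherianRing Γ(toricVariety Δ K, U) :=
    IsLocallyNoetherian.component_noetherian ⟨U, hU⟩
  obtain ⟨S, hS⟩ := IsNoetherian.noetherian (hU.primeIdealOf ⟨x, hxU⟩).asIdeal
  filter_upwards [(spreadsTo_spread U).eventually_proj,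
    S.eventually_all.2 fun a _ => (spreadsTo_spread U).eventually_exists_isLift a] with A h1 h2
  exact isDescended_of_lifts hx hU hxU h1 hS fun a ha => h2 a ha

lemma eventually_isDescended_of_coeff_ne_zero {R : Type*} [Zero R]
    (D : WeilDivisor (toricVariety Δ K) R) :
    ∀ᶠ A in atTop, ∀ x, D.coeff x ≠ 0 → IsDescended (proj Δ K A) x := by
  have : CompactSpace (toricVariety Δ K) := compactSpace_toricVariety Δ K
  have h := ((finite_support_coeff D).eventually_all (l := atTop)
    (p := fun x A => IsDescended (proj Δ K A) x)).2 fun x hx => eventually_isDescended (D.2 x hx)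
  exact h

/-- Flatness of `K` over `A` factors through the fraction field of `A`. -/
instance flat_proj (A : FGSub K) : Flat (proj Δ K A) :=
  flat_toricMap Δ _ <| by
    let := FractionRing.liftAlgebra A.1 K
    have := FractionRing.isScalarTower_liftAlgebra A.1 K
    have : Module.Flat A.1 (FractionRing A.1) := IsLocalization.flat _ (nonZeroDivisors A.1)
    rw [RingHom.flat_algebraMap_iff]
    have : Module.Flat (FractionRing A.1) K :=
      have : Module.Free (FractionRing A.1) K := Module.Free.of_divisionRing _ _
      Module.Flat.of_free
    exact Module.Flat.trans A.1 (FractionRing A.1) K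

/-- Local equations on a finite cover lift to `A`. For large `A` the lifts have no zeros at vertical
points of codimension one, where `E` has coefficient zero as well, so they are local equations of
`E`. -/
lemma eventually_isEffectiveCartier {D : WeilDivisor (toricVariety Δ K) ℤ}
    (hD : IsEffectiveCartier D) : ∀ᶠ A in atTop, ∀ E : WeilDivisor (toricVariety Δ A.1) ℤ,
      IsPullbackDivisor (proj Δ K A) E D → (∀ y, y ∉ Set.range (proj Δ K A) → E.coeff y = 0) →
        IsEffectiveCartier E := by
  obtain ⟨_, _, h⟩ := hD
  choose U hne f hxU hf hord using h
  have : CompactSpace (toricVariety Δ K) := compactSpace_toricVariety Δ K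
  obtain ⟨t, ht⟩ := CompactSpace.elim_nhds_subcover (fun x => (U x : Set (toricVariety Δ K)))
    fun x => (U x).2.mem_nhds (hxU x)
  have hcov : (⨆ x : t, U x) = ⊤ := by
    refine Opens.ext ?_
    rw [Opens.coe_iSup, Opens.coe_top, ← Set.top_eq_univ, ← ht]
    exact (Set.biUnion_eq_iUnion (t : Set (toricVariety Δ K)) fun x _ =>
      (U x : Set (toricVariety Δ K))).symm
  have h1 := SpreadsTo.iSup fun x : t => spreadsTo_spread (U x)
  rw [hcov] at h1
  filter_upwards [h1.eventually_eq spreadsTo_top,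
    t.eventually_all.2 fun x _ => (spreadsTo_spread (U x)).eventually_proj,
    t.eventually_all.2 fun x _ => (spreadsTo_spread (U x)).eventually_exists_isLift (f x),
    t.eventually_all.2 fun x _ => (spreadsTo_spread (U x)).eventually_basicOpen (f x),
    t.eventually_all.2 fun x _ => eventually_isGood_spread
      (U := (toricVariety Δ K).basicOpen (f x)) (by
        exact nonempty_basicOpen (hf x))] with A h2 h3 h4 h5 h6 E hE1 hE2
  have : IsIntegral (toricVariety Δ A.1) := isIntegral_toricVariety Δ A.1
  refine ⟨inferInstance, inferInstance, fun y => ?_⟩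
  have hy : y ∈ ⨆ x : t, spread (U x) A := h2 ▸ trivial
  obtain ⟨x, hyx⟩ := Opens.mem_iSup.1 hy
  obtain ⟨b, hb⟩ := h4 x x.2
  have hVne : Nonempty (spread (U x.1) A) := ⟨⟨y, hyx⟩⟩
  refine ⟨spread (U x.1) A, hVne, b, hyx, hb.ne_zero (hf x), fun z hz => ?_⟩
  have hgood : IsGood (proj Δ K A) ((toricVariety Δ A.1).basicOpen b) := by
    rw [h5 x x.2 b hb]
    exact h6 x x.2
  -- A regular function is treated as a fraction with denominator `1`.
  have := hb.ord_sub_ord_eq (D := D.coeff) (E := E.coeff) hE1 E.2 hE2 (h3 x x.2)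
    (β := 1) (b := 1) ⟨(h3 x x.2).ge, map_one _⟩ (hf x) one_ne_zero hgood
    (hgood.mono (by
      rw [Scheme.basicOpen_of_isUnit _ isUnit_one]
      exact Scheme.basicOpen_le _ _)) (fun w hw => by
      rw [ord_germToFunctionField_one, sub_zero]
      exact hord x w hw) hz
  rw [ord_germToFunctionField_one, sub_zero] at this
  exact this

end Eventually

end

/-! ### Sections and local generators of module sheaves -/

section Sections

variable {X : Scheme.{u}}

/-- The restriction of functions. -/
abbrev resHom {U V : X.Opens} (h : V ≤ U) : Γ(X, U) →+* Γ(X, V) := (X.presheaf.map (homOfLE h).op).hom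

lemma resHom_resHom {U V W : X.Opens} (h : V ≤ U) (h' : W ≤ V) (a : Γ(X, U)) :
    resHom h' (resHom h a) = resHom (h'.trans h) a := by
  change (X.presheaf.map (homOfLE h).op ≫ X.presheaf.map (homOfLE h').op) a = _
  rw [← Functor.map_comp]
  rfl

variable {M N : X.Modules}

lemma res_res {U V W : X.Opens} (h : V ≤ U) (h' : W ≤ V) (s : Γ(M, U)) :
    res h' (res h s) = res (h'.trans h) s := by
  change (M.presheaf.map (homOfLE h).op ≫ M.presheaf.map (homOfLE h').op) s = _
  rw [← Functor.map_comp]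
  rfl

lemma res_self {U : X.Opens} (s : Γ(M, U)) : res (le_refl U) s = s := by
  change M.presheaf.map (𝟙 (Opposite.op U)) s = s
  rw [CategoryTheory.Functor.map_id]
  rfl

lemma res_smul {U V : X.Opens} (h : V ≤ U) (a : Γ(X, U)) (s : Γ(M, U)) :
    res h (a • s) = resHom h a • res h s :=
  M.map_smul (homOfLE h) a s

lemma res_add {U V : X.Opens} (h : V ≤ U) (s t : Γ(M, U)) : res h (s + t) = res h s + res h t :=
  map_add _ _ _

lemma res_zero {U V : X.Opens} (h : V ≤ U) : res h (0 : Γ(M, U)) = 0 :=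
  map_zero _

lemma app_res (f : M ⟶ N) {U V : X.Opens} (h : V ≤ U) (s : Γ(M, U)) :
    f.app V (res h s) = res h (f.app U s) :=
  congr($(f.mapPresheaf.naturality (homOfLE h).op) s)

lemma eq_of_res_eq {U : X.Opens} {ι : Type*} (V : ι → X.Opens) (hV : ∀ i, V i ≤ U)
    (hU : U ≤ ⨆ i, V i) {s t : Γ(M, U)} (h : ∀ i, res (hV i) s = res (hV i) t) : s = t :=
  TopCat.Sheaf.eq_of_locally_eq' ⟨M.presheaf, M.isSheaf⟩ V U (fun i => homOfLE (hV i)) hU s t h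

lemma exists_res_eq {U : X.Opens} {ι : Type*} (V : ι → X.Opens) (hV : ∀ i, V i ≤ U)
    (hU : U ≤ ⨆ i, V i) (s : ∀ i, Γ(M, V i))
    (h : ∀ i j, res (inf_le_left : V i ⊓ V j ≤ V i) (s i) = res inf_le_right (s j)) :
    ∃ t : Γ(M, U), ∀ i, res (hV i) t = s i :=
  (TopCat.Sheaf.existsUnique_gluing' ⟨M.presheaf, M.isSheaf⟩ V U (fun i => homOfLE (hV i)) hU s
    h).exists

lemma eq_of_resHom_eq {U : X.Opens} {ι : Type*} (V : ι → X.Opens) (hV : ∀ i, V i ≤ U)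
    (hU : U ≤ ⨆ i, V i) {s t : Γ(X, U)} (h : ∀ i, resHom (hV i) s = resHom (hV i) t) : s = t :=
  TopCat.Sheaf.eq_of_locally_eq' X.sheaf V U (fun i => homOfLE (hV i)) hU s t h

lemma exists_resHom_eq {U : X.Opens} {ι : Type*} (V : ι → X.Opens) (hV : ∀ i, V i ≤ U)
    (hU : U ≤ ⨆ i, V i) (s : ∀ i, Γ(X, V i))
    (h : ∀ i j, resHom (inf_le_left : V i ⊓ V j ≤ V i) (s i) = resHom inf_le_right (s j)) :
    ∃ t : Γ(X, U), ∀ i, resHom (hV i) t = s i :=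
  (TopCat.Sheaf.existsUnique_gluing' X.sheaf V U (fun i => homOfLE (hV i)) hU s h).exists

lemma Trivializes.res {U V : X.Opens} {s : Γ(M, U)} (hs : Trivializes s) (h : V ≤ U) :
    Trivializes (res h s) := by
  intro W hW
  simp_rw [res_res]
  exact hs W (hW.trans h)

lemma Trivializes.eq_of_smul_eq {U : X.Opens} {s : Γ(M, U)} (hs : Trivializes s) {V : X.Opens}
    (h : V ≤ U) {a b : Γ(X, V)} (hab : a • ToricModel.res h s = b • ToricModel.res h s) : a = b :=
  (hs V h).1 hab

lemma Trivializes.exists_smul_eq {U : X.Opens} {s : Γ(M, U)} (hs : Trivializes s) {V : X.Opens}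
    (h : V ≤ U) (m : Γ(M, V)) : ∃ a : Γ(X, V), a • ToricModel.res h s = m :=
  (hs V h).2 m

/-- Injectivity is local by the sheaf property of `𝒪`. It makes local coefficients unique, so they
agree on overlaps and glue, which gives surjectivity. -/
lemma trivializes_of_local {U : X.Opens} {s : Γ(M, U)}
    (h1 : ∀ (V : X.Opens) (hV : V ≤ U) (a b : Γ(X, V)), a • res hV s = b • res hV s → ∀ x ∈ V,
      ∃ (W : X.Opens) (hW : W ≤ V), x ∈ W ∧ resHom hW a = resHom hW b)
    (h2 : ∀ (V : X.Opens) (hV : V ≤ U) (m : Γ(M, V)), ∀ x ∈ V, ∃ (W : X.Opens) (hW : W ≤ V),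
      x ∈ W ∧ ∃ a : Γ(X, W), a • res (hW.trans hV) s = res hW m) : Trivializes s := by
  have inj : ∀ (V : X.Opens) (hV : V ≤ U) (a b : Γ(X, V)),
      a • res hV s = b • res hV s → a = b := by
    intro V hV a b hab
    choose W hW hxW heq using h1 V hV a b hab
    exact eq_of_resHom_eq (fun x : V => W x.1 x.2) (fun x => hW x.1 x.2)
      (fun x hx => Opens.mem_iSup.2 ⟨⟨x, hx⟩, hxW x hx⟩) fun x => heq x.1 x.2
  intro V hV
  refine ⟨fun a b hab => inj V hV a b hab, fun m => ?_⟩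
  choose W hW hxW a ha using h2 V hV m
  have hcov : V ≤ ⨆ x : V, W x.1 x.2 := fun x hx => Opens.mem_iSup.2 ⟨⟨x, hx⟩, hxW x hx⟩
  obtain ⟨b, hb⟩ := exists_resHom_eq (fun x : V => W x.1 x.2) (fun x => hW x.1 x.2) hcov
    (fun x => a x.1 x.2) fun x y => by
      refine inj _ (inf_le_left.trans ((hW x.1 x.2).trans hV)) _ _ ?_
      have hx := congrArg (res (inf_le_left : W x.1 x.2 ⊓ W y.1 y.2 ≤ _)) (ha x.1 x.2)
      have hy := congrArg (res (inf_le_right : W x.1 x.2 ⊓ W y.1 y.2 ≤ _)) (ha y.1 y.2)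
      rw [res_smul, res_res, res_res] at hx hy
      exact hx.trans hy.symm
  refine ⟨b, eq_of_res_eq (fun x : V => W x.1 x.2) (fun x => hW x.1 x.2) hcov fun x => ?_⟩
  refine (res_smul _ _ _).trans ?_
  rw [hb x, res_res]
  exact ha x.1 x.2

/-- A section which is a unit multiple of a generator is a generator, and conversely. -/
lemma Trivializes.smul_iff {U : X.Opens} {t : Γ(M, U)} (ht : Trivializes t) (a : Γ(X, U)) :
    Trivializes (a • t) ↔ IsUnit a := by
  constructor
  · intro h
    obtain ⟨b, hb⟩ := h.exists_smul_eq le_rfl t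
    refine IsUnit.of_mul_eq_one b ?_
    refine ht.eq_of_smul_eq le_rfl ?_
    rw [res_self] at hb ⊢
    rw [one_smul, mul_comm, mul_smul, hb]
  · intro ha V h
    simp_rw [res_smul, smul_smul]
    obtain ⟨u, hu⟩ := ha.map (resHom h)
    rw [← hu]
    exact (ht V h).comp u.mulRight_bijective

end Sections

/-! ### Tensor products and powers of generators -/

section

open MonoidalCategory

lemma bijective_smul_tmul {R M N : Type*} [CommRing R] [AddCommGroup M] [AddCommGroup N] [Module R M]
    [Module R N] {s : M} {t : N} (hs : Function.Bijective fun a : R => a • s)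
    (ht : Function.Bijective fun a : R => a • t) :
    Function.Bijective fun a : R => a • (s ⊗ₜ[R] t) := by
  let e := LinearEquiv.ofBijective (LinearMap.toSpanSingleton R M s) hs
  let f := LinearEquiv.ofBijective (LinearMap.toSpanSingleton R N t) ht
  have h := ((TensorProduct.lid R R).symm.trans (TensorProduct.congr e f)).bijective
  convert h using 2 with a
  have h1 : e 1 = s := one_smul R s
  have h2 : f a = a • t := rfl
  simp [h1, h2]

section Tensor

variable {X : Scheme.{u}} (M N : X.Modules)

/-- The presheaf tensor product. -/
abbrev tensorPresheaf : PresheafOfModules.{u} (X.presheaf ⋙ forget₂ CommRingCat RingCat) :=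
  MonoidalCategory.tensorObj
      (C := PresheafOfModules.{u} (X.presheaf ⋙ forget₂ CommRingCat RingCat)) M.val N.val

/-- The morphism from the presheaf tensor product to its sheafification. -/
def tensorUnitMap : (tensorPresheaf M N).presheaf ⟶ (tensorSheaf M N).presheaf :=
  CategoryTheory.toSheafify _ (tensorPresheaf M N).presheaf

instance : Presheaf.IsLocallyInjective (Opens.grothendieckTopology X) (tensorUnitMap M N) :=
  inferInstanceAs (Presheaf.IsLocallyInjective _ (CategoryTheory.toSheafify _ _))

instance : Presheaf.IsLocallySurjective (Opens.grothendieckTopology X) (tensorUnitMap M N) :=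
  inferInstanceAs (Presheaf.IsLocallySurjective _ (CategoryTheory.toSheafify _ _))

/-- The sheafification map of abelian presheaves underlies the unit of the sheafification of
modules, which is linear. -/
lemma tensorUnitMap_smul {U : X.Opens} (a : Γ(X, U))
    (p : (tensorPresheaf M N).obj (Opposite.op U)) :
    (tensorUnitMap M N).app (Opposite.op U) (a • p : (tensorPresheaf M N).obj (Opposite.op U)) =
      a • ((tensorUnitMap M N).app (Opposite.op U) p : Γ(tensorSheaf M N, U)) :=
  (((PresheafOfModules.sheafificationAdjunction (𝟙 X.ringCatSheaf.obj)).unit.app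
    (tensorPresheaf M N)).app (Opposite.op U)).hom.map_smul a p

variable {M N}

/-- The tensor product of sections in the presheaf tensor product. -/
def pureTensor {U : X.Opens} (s : Γ(M, U)) (t : Γ(N, U)) :
    (tensorPresheaf M N).obj (Opposite.op U) :=
  (TensorProduct.tmul Γ(X, U) s t : TensorProduct Γ(X, U) Γ(M, U) Γ(N, U))

lemma bijective_smul_pureTensor {U : X.Opens} {s : Γ(M, U)} {t : Γ(N, U)} (hs : Trivializes s)
    (ht : Trivializes t) : Function.Bijective fun a : Γ(X, U) =>
      (a • pureTensor s t : (tensorPresheaf M N).obj (Opposite.op U)) := by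
  have h1 := hs U le_rfl
  have h2 := ht U le_rfl
  rw [res_self] at h1 h2
  exact bijective_smul_tmul (R := Γ(X, U)) (M := Γ(M, U)) (N := Γ(N, U)) h1 h2

/-- The tensor product of sections. -/
def tmulSec {U : X.Opens} (s : Γ(M, U)) (t : Γ(N, U)) : Γ(tensorSheaf M N, U) :=
  (tensorUnitMap M N).app (Opposite.op U) (pureTensor s t)

lemma tensorUnitMap_res {U V : X.Opens} (h : V ≤ U)
    (p : (tensorPresheaf M N).obj (Opposite.op U)) :
    res h ((tensorUnitMap M N).app (Opposite.op U) p : Γ(tensorSheaf M N, U)) =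
      (tensorUnitMap M N).app (Opposite.op V)
        ((tensorPresheaf M N).presheaf.map (homOfLE h).op p) :=
  congr($((tensorUnitMap M N).naturality (homOfLE h).op) p).symm

lemma res_tmulSec {U V : X.Opens} (h : V ≤ U) (s : Γ(M, U)) (t : Γ(N, U)) :
    res h (tmulSec s t) = tmulSec (res h s) (res h t) :=
  tensorUnitMap_res h _

lemma smul_tmulSec_smul {U : X.Opens} (a b : Γ(X, U)) (s : Γ(M, U)) (t : Γ(N, U)) :
    tmulSec (a • s) (b • t) = (a * b) • tmulSec s t := by
  refine Eq.trans (congrArg ((tensorUnitMap M N).app (Opposite.op U)) ?_)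
    (tensorUnitMap_smul M N (a * b) (pureTensor s t))
  exact TensorProduct.smul_tmul_smul (R := Γ(X, U)) (M := Γ(M, U)) (N := Γ(N, U)) a b s t

lemma presheaf_map_smul_pureTensor {U V : X.Opens} (h : V ≤ U) (a : Γ(X, U)) (s : Γ(M, U))
    (t : Γ(N, U)) : (tensorPresheaf M N).presheaf.map (homOfLE h).op
      (a • pureTensor s t : (tensorPresheaf M N).obj (Opposite.op U)) =
        (resHom h a • pureTensor (res h s) (res h t) : (tensorPresheaf M N).obj (Opposite.op V)) :=
  (tensorPresheaf M N).map_smul (homOfLE h).op a (pureTensor s t)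

/-- The presheaf tensor product is freely generated by the pure tensor, and the map to its
sheafification is locally injective and locally surjective. -/
lemma Trivializes.tmulSec {U : X.Opens} {s : Γ(M, U)} {t : Γ(N, U)} (hs : Trivializes s)
    (ht : Trivializes t) : Trivializes (tmulSec s t) := by
  refine trivializes_of_local (fun V hV a b hab x hx => ?_) (fun V hV m x hx => ?_)
  · rw [res_tmulSec, ToricModel.tmulSec, ← tensorUnitMap_smul, ← tensorUnitMap_smul] at hab
    obtain ⟨W, f, hf, hxW⟩ := Presheaf.equalizerSieve_mem (Opens.grothendieckTopology X)
      (tensorUnitMap M N) _ _ hab x hx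
    refine ⟨W, leOfHom f, hxW, ?_⟩
    refine (bijective_smul_pureTensor (hs.res ((leOfHom f).trans hV))
      (ht.res ((leOfHom f).trans hV))).1 ?_
    have h1 := (presheaf_map_smul_pureTensor (leOfHom f) a (ToricModel.res hV s) (ToricModel.res hV t)).symm.trans
      (Eq.trans hf (presheaf_map_smul_pureTensor (leOfHom f) b (ToricModel.res hV s) (ToricModel.res hV t)))
    rw [res_res, res_res] at h1
    exact h1
  · obtain ⟨W, f, ⟨p, hp⟩, hxW⟩ := Presheaf.imageSieve_mem (Opens.grothendieckTopology X)
      (tensorUnitMap M N) m x hx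
    obtain ⟨a, ha⟩ := (bijective_smul_pureTensor (hs.res ((leOfHom f).trans hV))
      (ht.res ((leOfHom f).trans hV))).2 p
    refine ⟨W, leOfHom f, hxW, a, ?_⟩
    rw [res_tmulSec, ToricModel.tmulSec, ← tensorUnitMap_smul]
    exact (congrArg _ ha).trans hp

/-- The powers of a section. -/
def tpow {U : X.Opens} (s : Γ(M, U)) : ∀ k : ℕ, Γ(tensorPower M k, U)
  | 0 => (1 : Γ(X, U))
  | k + 1 => tmulSec (tpow s k) s

lemma res_tpow {U V : X.Opens} (h : V ≤ U) (s : Γ(M, U)) (k : ℕ) :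
    res h (tpow s k) = tpow (res h s) k := by
  induction k with
  | zero => exact map_one (resHom h)
  | succ k ih => exact (res_tmulSec _ _ _).trans (congrArg (fun y => ToricModel.tmulSec y _) ih)

lemma smul_tpow {U : X.Opens} (a : Γ(X, U)) (s : Γ(M, U)) (k : ℕ) :
    tpow (a • s) k = a ^ k • tpow s k := by
  induction k with
  | zero => exact ((congrArg (· • tpow s 0) (pow_zero a)).trans (one_smul _ (tpow s 0))).symm
  | succ k ih =>
    exact (congrArg (fun y => ToricModel.tmulSec y (a • s)) ih).trans
      ((smul_tmulSec_smul _ _ _ _).trans (congrArg (· • tpow s (k + 1)) (pow_succ a k).symm))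

lemma Trivializes.tpow {U : X.Opens} {s : Γ(M, U)} (hs : Trivializes s) (k : ℕ) :
    Trivializes (tpow s k) := by
  induction k with
  | zero =>
    intro V h
    have h1 : ToricModel.res h (ToricModel.tpow s 0) = (1 : Γ(X, V)) := map_one (resHom h)
    rw [h1]
    have h2 : (fun a : Γ(X, V) => a • (1 : Γ(X, V))) = id := funext fun a => mul_one a
    exact h2 ▸ Function.bijective_id
  | succ k ih => exact ih.tmulSec hs

end Tensor

end

/-! ### The subsheaf generated by local sections -/

section GeneratedSubsheaf

variable {Y : Scheme.{u}} {N : Y.Modules} {ι : Type*} (V : ι → Y.Opens) (t : ∀ i, Γ(N, V i))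

/-- The sections which are locally multiples of the given local sections. -/
def generatedSections (W : Y.Opens) : Submodule Γ(Y, W) Γ(N, W) where
  carrier := {s | ∀ i, ∃ a : Γ(Y, W ⊓ V i), res inf_le_left s = a • res inf_le_right (t i)}
  zero_mem' i := ⟨0, by rw [res_zero, zero_smul]⟩
  add_mem' {s s'} hs hs' i := by
    obtain ⟨a, ha⟩ := hs i
    obtain ⟨b, hb⟩ := hs' i
    exact ⟨a + b, by rw [res_add, ha, hb, add_smul]⟩
  smul_mem' c s hs i := by
    obtain ⟨a, ha⟩ := hs i
    exact ⟨resHom inf_le_left c * a, by rw [res_smul, ha, smul_smul]⟩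

variable {V t}

lemma res_mem_generatedSections {W W' : Y.Opens} (h : W' ≤ W) {s : Γ(N, W)}
    (hs : s ∈ generatedSections V t W) : res h s ∈ generatedSections V t W' := by
  intro i
  obtain ⟨a, ha⟩ := hs i
  refine ⟨resHom (inf_le_inf_right _ h) a, ?_⟩
  have := congrArg (res (inf_le_inf_right (V i) h)) ha
  rw [res_smul, res_res, res_res] at this
  rwa [res_res]

variable (V t) in
/-- The presheaf of sections which are locally multiples of the given local sections. -/
def generatedSubmodule : PresheafOfModules.Submodule N.val where
  obj W := (generatedSections V t W.unop :)
  map f _ hs := res_mem_generatedSections (leOfHom f.unop) hs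

/-- Sections glue in the ambient sheaf; their coefficients with respect to `t i` are unique by
`hinj`, so they glue too and the result stays in the submodule. -/
lemma isSheaf_generatedSubmodule
    (hinj : ∀ (i : ι) (W : Y.Opens) (h : W ≤ V i) (a b : Γ(Y, W)),
      a • res h (t i) = b • res h (t i) → a = b) :
    TopCat.Presheaf.IsSheaf (generatedSubmodule V t).toPresheafOfModules.presheaf := by
  rw [TopCat.Presheaf.isSheaf_iff_isSheafUniqueGluing]
  intro κ W s hs
  let s' : ∀ k, Γ(N, W k) := fun k => (s k).1
  have hs' : ∀ k l, res (inf_le_left : W k ⊓ W l ≤ W k) (s' k) = res inf_le_right (s' l) :=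
    fun k l => congrArg Subtype.val (hs k l)
  obtain ⟨m, hm⟩ := exists_res_eq W (fun k => le_iSup W k) le_rfl s' hs'
  have hmem : m ∈ generatedSections V t (iSup W) := by
    intro i
    have h1 : ∀ k, ∃ a : Γ(Y, W k ⊓ V i), res inf_le_left (s' k) = a • res inf_le_right (t i) :=
      fun k => (s k).2 i
    choose a ha using h1
    have hcov : iSup W ⊓ V i ≤ ⨆ k, W k ⊓ V i := by rw [iSup_inf_eq]
    have hle : ∀ k, W k ⊓ V i ≤ iSup W ⊓ V i := fun k => inf_le_inf_right _ (le_iSup W k)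
    obtain ⟨b, hb⟩ := exists_resHom_eq (fun k => W k ⊓ V i) hle hcov a fun k l => by
      refine hinj i _ (inf_le_left.trans inf_le_right) _ _ ?_
      have h2 := congrArg (res (inf_le_left : (W k ⊓ V i) ⊓ (W l ⊓ V i) ≤ _)) (ha k)
      have h3 := congrArg (res (inf_le_right : (W k ⊓ V i) ⊓ (W l ⊓ V i) ≤ _)) (ha l)
      rw [res_smul, res_res, res_res] at h2 h3
      refine h2.symm.trans (Eq.trans ?_ h3)
      have h4 := congrArg (res (inf_le_inf inf_le_left inf_le_left :
        (W k ⊓ V i) ⊓ (W l ⊓ V i) ≤ W k ⊓ W l)) (hs' k l)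
      rwa [res_res, res_res] at h4
    refine ⟨b, eq_of_res_eq (fun k => W k ⊓ V i) hle hcov fun k => ?_⟩
    rw [res_smul, hb k, res_res, res_res, ← ha k, ← hm k, res_res]
  refine ⟨(⟨m, hmem⟩ : generatedSections V t (iSup W)), fun k => Subtype.ext (hm k), ?_⟩
  intro m' hm'
  refine Subtype.ext (eq_of_res_eq W (fun k => le_iSup W k) le_rfl fun k => ?_)
  exact (congrArg Subtype.val (hm' k)).trans (hm k).symm

/-- The subsheaf generated by local sections with trivial annihilators whose transition functions
are regular functions is invertible. -/
lemma exists_generatedSubsheaf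
    (hinj : ∀ (i : ι) (W : Y.Opens) (h : W ≤ V i) (a b : Γ(Y, W)),
      a • res h (t i) = b • res h (t i) → a = b)
    (ht : ∀ i j, ∃ g : Γ(Y, V i ⊓ V j),
    res inf_le_left (t i) = g • res inf_le_right (t j)) :
    ∃ (L : Y.Modules) (f : L ⟶ N) (τ : ∀ i, Γ(L, V i)),
      (∀ i, Trivializes (τ i)) ∧ ∀ i, f.app (V i) (τ i) = t i := by
  let L : Y.Modules :=
    ⟨(generatedSubmodule V t).toPresheafOfModules, isSheaf_generatedSubmodule hinj⟩
  let f : L ⟶ N := ⟨(generatedSubmodule V t).ι⟩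
  have hf : ∀ W, Function.Injective (f.app W) := fun W => Subtype.val_injective
  let τ : ∀ i, Γ(L, V i) := fun i => (⟨t i, ht i⟩ : generatedSections V t (V i))
  have hτ : ∀ i, f.app (V i) (τ i) = t i := fun i => rfl
  refine ⟨L, f, τ, fun i W h => ⟨fun a b hab => ?_, fun m => ?_⟩, hτ⟩
  · refine hinj i W h a b ?_
    have h1 := congrArg (f.app W) hab
    change f.app W (a • res h (τ i)) = f.app W (b • res h (τ i)) at h1
    rwa [Scheme.Modules.Hom.app_smul, Scheme.Modules.Hom.app_smul, app_res, hτ] at h1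
  · have hm : f.app W m ∈ generatedSections V t W := Subtype.property (p := (· ∈ generatedSections V t W)) m
    obtain ⟨a, ha⟩ := hm i
    have hW : W ≤ W ⊓ V i := le_inf le_rfl h
    refine ⟨resHom hW a, hf W ?_⟩
    change f.app W (resHom hW a • res h (τ i)) = _
    rw [Scheme.Modules.Hom.app_smul, app_res, hτ]
    have h2 := congrArg (res hW) ha
    rw [res_smul, res_res, res_res, res_self] at h2
    exact h2.symm

end GeneratedSubsheaf

/-! ### Morphisms out of an invertible sheaf -/

section HomExt

variable {X : Scheme.{u}} {L N : X.Modules} {ι : Type*} {U : ι → X.Opens}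
  {t : ∀ i, Γ(L, U i)}

lemma hom_ext_of_trivializes (hU : ⨆ i, U i = ⊤) (ht : ∀ i, Trivializes (t i))
    {f g : L ⟶ N} (h : ∀ i, f.app (U i) (t i) = g.app (U i) (t i)) :
    f = g := by
  refine Scheme.Modules.hom_ext f g fun W => ?_
  ext s
  refine eq_of_res_eq (fun i => W ⊓ U i) (fun i => inf_le_left)
    (by rw [← inf_iSup_eq, hU, inf_top_eq]) fun i => ?_
  obtain ⟨a, ha⟩ := (ht i).exists_smul_eq inf_le_right (res (inf_le_left : W ⊓ U i ≤ W) s)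
  have h1 : ∀ k : L ⟶ N, res (inf_le_left : W ⊓ U i ≤ W) (k.app W s) =
      a • res inf_le_right (k.app (U i) (t i)) := by
    intro k
    rw [← app_res, ← ha, Scheme.Modules.Hom.app_smul, app_res]
  exact (h1 f).trans ((congrArg (fun y => a • res inf_le_right y) (h i)).trans (h1 g).symm)

/-- A morphism out of an invertible sheaf is given by the images of local generators. -/
lemma exists_hom_of_trivializes (hU : ⨆ i, U i = ⊤) (ht : ∀ i, Trivializes (t i))
    {n : ∀ i, Γ(N, U i)} (hn : ∀ i j (g : Γ(X, U i ⊓ U j)),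
    res inf_le_left (t i) = g • res inf_le_right (t j) →
      res inf_le_left (n i) = g • res inf_le_right (n j)) :
    ∃ f : L ⟶ N, ∀ i, f.app (U i) (t i) = n i := by
  have hcov : ∀ W : X.Opens, W ≤ ⨆ i, W ⊓ U i := fun W => by
    rw [← inf_iSup_eq, hU, inf_top_eq]
  -- The image of `s` is characterized by sending `a • t i` to `a • n i` wherever `s` has this form.
  -- Uniqueness of such a section then yields additivity, linearity and compatibility with
  -- restriction.
  have key : ∀ (W : X.Opens) (s : Γ(L, W)), ∃ m : Γ(N, W), ∀ i (W' : X.Opens) (h : W' ≤ W)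
      (h' : W' ≤ U i) (a : Γ(X, W')), res h s = a • res h' (t i) → res h m = a • res h' (n i) := by
    intro W s
    choose a ha using fun i => (ht i).exists_smul_eq inf_le_right (res (inf_le_left : W ⊓ U i ≤ W) s)
    have comp : ∀ i j (W' : X.Opens) (h : W' ≤ W ⊓ U i) (h' : W' ≤ U j) (b : Γ(X, W')),
        res (h.trans inf_le_left) s = b • res h' (t j) →
          resHom h (a i) • res (h.trans inf_le_right) (n i) = b • res h' (n j) := by
      intro i j W' h h' b hb
      have h1 := congrArg (res h) (ha i)
      rw [res_smul, res_res, res_res, hb] at h1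
      obtain ⟨g, hg⟩ := (ht j).exists_smul_eq inf_le_right (res (inf_le_left : U i ⊓ U j ≤ _) (t i))
      have hle : W' ≤ U i ⊓ U j := le_inf (h.trans inf_le_right) h'
      have h2 := congrArg (res hle) hg
      rw [res_smul, res_res, res_res] at h2
      have h3 := congrArg (res hle) (hn i j g hg.symm)
      rw [res_smul, res_res, res_res] at h3
      rw [← h2, smul_smul] at h1
      rw [h3, smul_smul, (ht j).eq_of_smul_eq h' h1]
    obtain ⟨m, hm⟩ := exists_res_eq (M := N) (fun i => W ⊓ U i) (fun i => inf_le_left) (hcov W)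
      (fun i => a i • res inf_le_right (n i)) fun i j => by
        rw [res_smul, res_smul, res_res, res_res]
        refine comp i j _ inf_le_left (inf_le_right.trans inf_le_right) _ ?_
        have := congrArg (res (inf_le_right : (W ⊓ U i) ⊓ (W ⊓ U j) ≤ W ⊓ U j)) (ha j)
        rw [res_smul, res_res, res_res] at this
        exact this.symm
    refine ⟨m, fun j W' h h' b hb => ?_⟩
    refine eq_of_res_eq (fun i => W' ⊓ U i) (fun i => inf_le_left) (hcov W') fun i => ?_
    have h1 := congrArg (res (inf_le_inf_right (U i) h)) (hm i)
    rw [res_smul, res_res, res_res] at h1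
    rw [res_res, res_smul, res_res]
    refine h1.trans (comp i j _ _ _ _ ?_)
    have h2 := congrArg (res (inf_le_left : W' ⊓ U i ≤ W')) hb
    rwa [res_smul, res_res, res_res] at h2
  have uniq : ∀ (W : X.Opens) (s : Γ(L, W)) (m m' : Γ(N, W)),
      (∀ i (W' : X.Opens) (h : W' ≤ W)
      (h' : W' ≤ U i) (a : Γ(X, W')), res h s = a • res h' (t i) → res h m = a • res h' (n i)) →
      (∀ i (W' : X.Opens) (h : W' ≤ W)
      (h' : W' ≤ U i) (a : Γ(X, W')), res h s = a • res h' (t i) → res h m' = a • res h' (n i)) →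
      m = m' := by
    intro W s m m' hm hm'
    refine eq_of_res_eq (fun i => W ⊓ U i) (fun i => inf_le_left) (hcov W) fun i => ?_
    obtain ⟨a, ha⟩ := (ht i).exists_smul_eq inf_le_right (res (inf_le_left : W ⊓ U i ≤ W) s)
    rw [hm i _ _ _ a ha.symm, hm' i _ _ _ a ha.symm]
  have split : ∀ (W : X.Opens) (s : Γ(L, W)) (i : ι) (W' : X.Opens) (h : W' ≤ W) (h' : W' ≤ U i),
      ∃ a : Γ(X, W'), res h s = a • res h' (t i) := fun W s i W' h h' => by
    obtain ⟨a, ha⟩ := (ht i).exists_smul_eq h' (res h s)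
    exact ⟨a, ha.symm⟩
  choose F hF using key
  have hadd : ∀ W (s s' : Γ(L, W)), F W (s + s') = F W s + F W s' := by
    intro W s s'
    refine uniq W (s + s') _ _ (hF W _) fun i W' h h' a ha => ?_
    obtain ⟨b, hb⟩ := split W s i W' h h'
    obtain ⟨b', hb'⟩ := split W s' i W' h h'
    rw [res_add, hb, hb', ← add_smul] at ha
    rw [res_add, hF W s i W' h h' b hb, hF W s' i W' h h' b' hb', ← add_smul,
      (ht i).eq_of_smul_eq h' ha]
  have hsmul : ∀ W (c : Γ(X, W)) (s : Γ(L, W)), F W (c • s) = c • F W s := by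
    intro W c s
    refine uniq W (c • s) _ _ (hF W _) fun i W' h h' a ha => ?_
    obtain ⟨b, hb⟩ := split W s i W' h h'
    rw [res_smul, hb, smul_smul] at ha
    rw [res_smul, hF W s i W' h h' b hb, smul_smul, (ht i).eq_of_smul_eq h' ha]
  have hres : ∀ W W' (hW : W' ≤ W) (s : Γ(L, W)), F W' (res hW s) = res hW (F W s) := by
    intro W W' hW s
    refine uniq W' (res hW s) _ _ (hF W' _) fun i W'' h h' a ha => ?_
    rw [res_res] at ha ⊢
    exact hF W s i W'' _ h' a ha
  let φ : L.val.presheaf ⟶ N.val.presheaf :=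
    { app := fun W => AddCommGrpCat.ofHom (AddMonoidHom.mk' (F W.unop) (hadd W.unop))
      naturality := fun W W' f => by
        ext s
        exact hres W.unop W'.unop (leOfHom f.unop) s }
  let f : L ⟶ N := ⟨PresheafOfModules.homMk φ fun W c s => hsmul W.unop c s⟩
  refine ⟨f, fun i => ?_⟩
  have h1 := hF (U i) (t i) i (U i) le_rfl le_rfl 1 (one_smul _ _).symm
  rw [res_self, res_self, one_smul] at h1
  exact h1

end HomExt

/-! ### Recognizing and constructing descended sheaves -/

section PullbackIso

variable {X Y : Scheme.{u}} {π : X ⟶ Y} {L : X.Modules}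

/-- A morphism `ℒ ⟶ π_* L` that takes local generators to local generators exhibits `L` as the
pullback of `ℒ`. -/
lemma nonempty_pullback_iso {ι : Type*} {V : ι → Y.Opens} (hV : ⨆ i, V i = ⊤)
    {t : ∀ i, Γ(L, π ⁻¹ᵁ V i)} (ht : ∀ i, Trivializes (t i)) {M : Y.Modules} {τ : ∀ i, Γ(M, V i)}
    (hτ : ∀ i, Trivializes (τ i)) (ψ : M ⟶ (Scheme.Modules.pushforward π).obj L)
    (hψ : ∀ i, ψ.app (V i) (τ i) = t i) :
    Nonempty ((Scheme.Modules.pullback π).obj M ≅ L) := by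
  let adj := Scheme.Modules.pullbackPushforwardAdjunction π
  let ψ' : (Scheme.Modules.pullback π).obj M ⟶ L := (adj.homEquiv M L).symm ψ
  have hU : ⨆ i, π ⁻¹ᵁ V i = ⊤ := by
    rw [← Scheme.Hom.preimage_iSup, hV]
    rfl
  -- Via the adjunction this says that `ψ'` induces bijections on morphisms to every `N`, so Yoneda
  -- makes it an isomorphism.
  have key : ∀ N : X.Modules, Function.Bijective fun f : L ⟶ N =>
      ψ ≫ (Scheme.Modules.pushforward π).map f := by
    intro N
    have happ : ∀ (f : L ⟶ N) i, (ψ ≫ (Scheme.Modules.pushforward π).map f).app (V i) (τ i) =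
        f.app (π ⁻¹ᵁ V i) (t i) := fun f i => congrArg (f.app (π ⁻¹ᵁ V i)) (hψ i)
    constructor
    · intro f f' h
      refine hom_ext_of_trivializes hU ht fun i => ?_
      rw [← happ, ← happ]
      exact congr($(h).app (V i) (τ i))
    · intro h
      obtain ⟨f, hf⟩ := exists_hom_of_trivializes hU ht (N := N)
        (n := fun i => (h.app (V i) (τ i) : Γ((Scheme.Modules.pushforward π).obj N, V i)))
        fun i j g hg => by
          obtain ⟨g', hg'⟩ := (hτ j).exists_smul_eq inf_le_right
            (res (inf_le_left : V i ⊓ V j ≤ _) (τ i))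
          have h1 := congrArg (ψ.app (V i ⊓ V j)) hg'
          rw [Scheme.Modules.Hom.app_smul, app_res, app_res, hψ, hψ] at h1
          -- The transition functions upstairs are the pullbacks of those of `M`, so a morphism from
          -- `M` supplies compatible images of the `t i`.
          have h2 : g = π.app (V i ⊓ V j) g' := by
            refine (ht j).eq_of_smul_eq (π.preimage_mono inf_le_right) ?_
            exact hg.symm.trans h1.symm
          have h3 := congrArg (h.app (V i ⊓ V j)) hg'
          rw [Scheme.Modules.Hom.app_smul, app_res, app_res] at h3
          rw [h2]
          exact h3.symm
      refine ⟨f, hom_ext_of_trivializes hV hτ fun i => ?_⟩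
      rw [happ]
      exact hf i
  have hiso : IsIso ψ' := by
    rw [isIso_iff_coyoneda_map_bijective]
    intro N
    have h1 : (fun f : L ⟶ N => ψ' ≫ f) =
        (adj.homEquiv M N).symm ∘ fun f => ψ ≫ (Scheme.Modules.pushforward π).map f := by
      funext f
      exact (adj.homEquiv_naturality_right_symm ψ f).symm
    rw [h1]
    exact (adj.homEquiv M N).symm.bijective.comp (key N)
  exact ⟨asIso ψ'⟩

/-- Descent of an invertible sheaf along transition functions. -/
lemma exists_descended_sheaf [QuasiCompact π] [IsSchemeTheoreticallyDominant π] {ι : Type*}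
    {V : ι → Y.Opens} (hV : ⨆ i, V i = ⊤) {t : ∀ i, Γ(L, π ⁻¹ᵁ V i)} (ht : ∀ i, Trivializes (t i))
    (hg : ∀ i j, ∃ g : Γ(Y, V i ⊓ V j), res (π.preimage_mono inf_le_left) (t i) =
      π.app (V i ⊓ V j) g • res (π.preimage_mono inf_le_right) (t j)) :
    ∃ (M : Y.Modules) (τ : ∀ i, Γ(M, V i)) (ψ : M ⟶ (Scheme.Modules.pushforward π).obj L),
      (∀ i, Trivializes (τ i)) ∧ (∀ i, ψ.app (V i) (τ i) = t i) ∧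
        Nonempty ((Scheme.Modules.pullback π).obj M ≅ L) := by
  obtain ⟨M, ψ, τ, hτ, hψ⟩ := exists_generatedSubsheaf
    (N := (Scheme.Modules.pushforward π).obj L) (V := V) (t := t)
    (fun i W h a b hab => π.app_injective W ((ht i).eq_of_smul_eq (π.preimage_mono h) hab)) hg
  exact ⟨M, τ, ψ, hτ, hψ, nonempty_pullback_iso hV ht hτ ψ hψ⟩

end PullbackIso

/-! ### Nonvanishing loci and a criterion for ampleness -/

section NonvanishingLocus

variable {X : Scheme.{u}} {M : X.Modules}

/-- A multiple `a • t` of a generator generates exactly where `a` is a unit. -/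
lemma nonvanishingLocus_inf_eq {s : Γ(M, ⊤)} {U : X.Opens} {t : Γ(M, U)} (ht : Trivializes t)
    {a : Γ(X, U)} (ha : res le_top s = a • t) : nonvanishingLocus s ⊓ U = X.basicOpen a := by
  apply le_antisymm
  · rintro x ⟨hx, hxU⟩
    obtain ⟨W, hW, hxW⟩ := Opens.mem_sSup.1 hx
    have h1 : Trivializes (res le_top s : Γ(M, W ⊓ U)) := by
      have := Trivializes.res hW (inf_le_left : W ⊓ U ≤ W)
      rwa [res_res] at this
    have h2 : (res le_top s : Γ(M, W ⊓ U)) = resHom (inf_le_right : W ⊓ U ≤ U) a •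
        res (inf_le_right : W ⊓ U ≤ U) t := by
      rw [← res_smul, ← ha, res_res]
    rw [h2, (ht.res inf_le_right).smul_iff] at h1
    have h3 := X.basicOpen_of_isUnit h1
    rw [Scheme.basicOpen_res] at h3
    exact (h3.ge ⟨hxW, hxU⟩).2
  · refine le_inf (le_sSup ?_) (X.basicOpen_le a)
    have h2 : (res le_top s : Γ(M, X.basicOpen a)) =
        resHom (X.basicOpen_le a) a • res (X.basicOpen_le a) t := by
      rw [← res_smul, ← ha, res_res]
    change Trivializes (res le_top s : Γ(M, X.basicOpen a))
    rw [h2, (ht.res _).smul_iff]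
    exact RingedSpace.isUnit_res_basicOpen X.toRingedSpace a

lemma nonvanishingLocus_eq_iSup {ι : Type*} {U : ι → X.Opens} (hU : ⨆ i, U i = ⊤) {s : Γ(M, ⊤)}
    {t : ∀ i, Γ(M, U i)} (ht : ∀ i, Trivializes (t i)) {a : ∀ i, Γ(X, U i)}
    (ha : ∀ i, res le_top s = a i • t i) : nonvanishingLocus s = ⨆ i, X.basicOpen (a i) := by
  rw [← inf_top_eq (nonvanishingLocus s), ← hU, inf_iSup_eq]
  exact iSup_congr fun i => nonvanishingLocus_inf_eq (ht i) (ha i)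

/-- The second identity in `ha` says that the sections `a i • tpow (t i) k` agree on overlaps. -/
lemma exists_section_of_transition {ι : Type*} {U : ι → X.Opens} (hU : ⨆ i, U i = ⊤)
    {t : ∀ i, Γ(M, U i)} (ht : ∀ i, Trivializes (t i)) (k : ℕ) (a : ∀ i, Γ(X, U i))
    (ha : ∀ i j, ∃ g : Γ(X, U i ⊓ U j), res inf_le_left (t i) = g • res inf_le_right (t j) ∧
      resHom inf_le_left (a i) * g ^ k = resHom inf_le_right (a j)) :
    ∃ s : Γ(tensorPower M k, ⊤), nonvanishingLocus s = ⨆ i, X.basicOpen (a i) := by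
  obtain ⟨s, hs⟩ := exists_res_eq (M := tensorPower M k) U (fun i => le_top) hU.ge
    (fun i => a i • tpow (t i) k) fun i j => by
      obtain ⟨g, hg, hga⟩ := ha i j
      rw [res_smul, res_smul, res_tpow, res_tpow, hg, smul_tpow, smul_smul, hga]
  exact ⟨s, nonvanishingLocus_eq_iSup hU (fun i => (ht i).tpow k) hs⟩

lemma isAmple_of_sections [CompactSpace X] {ι : Type*} {U : ι → X.Opens} (hU : ⨆ i, U i = ⊤)
    {t : ∀ i, Γ(M, U i)} (ht : ∀ i, Trivializes (t i)) {κ : Type*} {W : κ → X.Opens}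
    (hW : ⨆ l, W l = ⊤) (hWa : ∀ l, IsAffineOpen (W l))
    (hWs : ∀ l, ∃ k, 0 < k ∧ ∃ s : Γ(tensorPower M k, ⊤), nonvanishingLocus s = W l) :
    IsAmple M := by
  refine ⟨inferInstance, fun x => ?_, fun x => ?_⟩
  · have hx : x ∈ ⨆ i, U i := hU ▸ trivial
    obtain ⟨i, hi⟩ := Opens.mem_iSup.1 hx
    exact ⟨U i, hi, t i, ht i⟩
  · have hx : x ∈ ⨆ l, W l := hW ▸ trivial
    obtain ⟨l, hl⟩ := Opens.mem_iSup.1 hx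
    obtain ⟨k, hk, s, hs⟩ := hWs l
    exact ⟨k, hk, s, hs ▸ hl, hs ▸ hWa l⟩

end NonvanishingLocus

/-! ### Models of invertible sheaves and of their sections -/

section DescendedSheaf

variable {X Y : Scheme.{u}} {π : X ⟶ Y} [QuasiCompact π] [IsSchemeTheoreticallyDominant π]
  {L : X.Modules} {ι : Type*} {U : ι → X.Opens} {V : ι → Y.Opens}

/-- An invertible sheaf with a trivialization that pulls back to a given one. -/
structure SheafModel (π : X ⟶ Y) (L : X.Modules) (hUV : ∀ i, π ⁻¹ᵁ V i = U i)
    (t : ∀ i, Γ(L, U i)) where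
  /-- the sheaf -/
  M : Y.Modules
  /-- its local generators -/
  τ : ∀ i, Γ(M, V i)
  /-- the comparison morphism -/
  ψ : M ⟶ (Scheme.Modules.pushforward π).obj L
  trivializes : ∀ i, Trivializes (τ i)
  app_τ : ∀ i, ψ.app (V i) (τ i) = res (hUV i).le (t i)
  nonempty_iso : Nonempty ((Scheme.Modules.pullback π).obj M ≅ L)

lemma nonempty_sheafModel (hUV : ∀ i, π ⁻¹ᵁ V i = U i) (hV : ⨆ i, V i = ⊤) {t : ∀ i, Γ(L, U i)}
    (ht : ∀ i, Trivializes (t i)) {g : ∀ i j, Γ(X, U i ⊓ U j)}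
    (hg : ∀ i j, res inf_le_left (t i) = g i j • res inf_le_right (t j))
    (hgl : ∀ i j, ∃ γ : Γ(Y, V i ⊓ V j), IsLift π γ (g i j)) :
    Nonempty (SheafModel π L hUV t) := by
  obtain rfl : (fun i => π ⁻¹ᵁ V i) = U := funext hUV
  obtain ⟨M, τ, ψ, hτ, hψ, hiso⟩ := exists_descended_sheaf (π := π) hV ht fun i j => by
    obtain ⟨γ, h, hγ⟩ := hgl i j
    refine ⟨γ, ?_⟩
    rw [Scheme.Hom.app_eq_appLE]
    refine (hg i j).trans ?_
    rw [← hγ]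
    rfl
  exact ⟨⟨M, τ, ψ, hτ, fun i => (hψ i).trans (res_self _).symm, hiso⟩⟩

/-- The gluing condition for the `α i` holds after pullback, where the `a i` come from a global
section, and pullback of functions is injective. -/
lemma SheafModel.exists_section {hUV : ∀ i, π ⁻¹ᵁ V i = U i} (hV : ⨆ i, V i = ⊤)
    {t : ∀ i, Γ(L, U i)} (ht : ∀ i, Trivializes (t i)) (m : SheafModel π L hUV t) {k : ℕ}
    {s : Γ(tensorPower L k, ⊤)} {a : ∀ i, Γ(X, U i)}
    (ha : ∀ i, res le_top s = a i • tpow (t i) k) {α : ∀ i, Γ(Y, V i)}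
    (hα : ∀ i, IsLift π (α i) (a i)) :
    ∃ s' : Γ(tensorPower m.M k, ⊤), nonvanishingLocus s' = ⨆ i, Y.basicOpen (α i) := by
  obtain rfl : (fun i => π ⁻¹ᵁ V i) = U := funext hUV
  refine exists_section_of_transition hV m.trivializes k α fun i j => ?_
  obtain ⟨g, hg⟩ := (m.trivializes j).exists_smul_eq inf_le_right
    (res (inf_le_left : V i ⊓ V j ≤ _) (m.τ i))
  refine ⟨g, hg.symm, π.app_injective _ ?_⟩
  have h1 := congrArg (m.ψ.app (V i ⊓ V j)) hg
  rw [Scheme.Modules.Hom.app_smul, app_res, app_res, m.app_τ, m.app_τ, res_self, res_self] at h1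
  have h1' : res (π.preimage_mono inf_le_left) (t i) =
    π.app (V i ⊓ V j) g • res (π.preimage_mono inf_le_right) (t j) := h1.symm
  refine ((ht j).tpow k).eq_of_smul_eq (π.preimage_mono inf_le_right) ?_
  have hres : ∀ {V₁ : Y.Opens} (h : V i ⊓ V j ≤ V₁) (β : Γ(Y, V₁)),
      π.app (V i ⊓ V j) (resHom h β) = resHom (π.preimage_mono h) (π.app V₁ β) := fun h β =>
    congr($(π.naturality (homOfLE h).op) β)
  have hα' : ∀ i, π.app (V i) (α i) = a i := fun i => by
    obtain ⟨_, h⟩ := hα i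
    rw [Scheme.Hom.app_eq_appLE]
    exact h
  rw [map_mul, map_pow, hres, hres, hα', hα', mul_smul, res_tpow, ← smul_tpow, ← h1', ← res_tpow,
    ← res_smul, ← ha, ← res_tpow, ← res_smul, ← ha, res_res, res_res]

end DescendedSheaf

/-! ### Rational sections as fractions -/

section RationalSections

variable {X : Scheme.{u}} [IsIntegral X]

lemma nonempty_inf (U V : X.Opens) [hU : Nonempty U] [hV : Nonempty V] :
    Nonempty (U ⊓ V : X.Opens) := by
  obtain ⟨x, hx⟩ := nonempty_preirreducible_inter U.2 V.2 ⟨hU.some.1, hU.some.2⟩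
    ⟨hV.some.1, hV.some.2⟩
  exact ⟨⟨x, hx⟩⟩

lemma germToFunctionField_resHom {U V : X.Opens} [Nonempty U] [Nonempty V] (h : V ≤ U)
    (a : Γ(X, U)) : X.germToFunctionField V (resHom h a) = X.germToFunctionField U a :=
  TopCat.Presheaf.germ_res_apply X.presheaf (homOfLE h) _ _ a

lemma resHom_injective {U V : X.Opens} [Nonempty U] [Nonempty V] (h : V ≤ U) :
    Function.Injective (resHom h : Γ(X, U) → Γ(X, V)) := by
  intro a b hab
  refine X.germToFunctionField_injective U ?_
  rw [← germToFunctionField_resHom h, hab, germToFunctionField_resHom]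

/-- In terms of local generators this is injectivity of restriction of functions on an integral
scheme. -/
lemma res_ne_zero {M : X.Modules} (hM : IsInvertible M) {U V : X.Opens} [Nonempty V] (h : V ≤ U)
    {s : Γ(M, U)} (hs : s ≠ 0) : res h s ≠ 0 := by
  intro h0
  choose W hxW t ht using hM
  refine hs (eq_of_res_eq (fun x => U ⊓ W x) (fun x => inf_le_left)
    (fun x hx => Opens.mem_iSup.2 ⟨x, hx, hxW x⟩) fun x => ?_)
  have : Nonempty (W x) := ⟨⟨x, hxW x⟩⟩
  have : Nonempty U := ⟨⟨_, h (Classical.arbitrary V).2⟩⟩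
  have := nonempty_inf U (W x)
  have := nonempty_inf V (W x)
  obtain ⟨a, ha⟩ := (ht x).exists_smul_eq inf_le_right (res (inf_le_left : U ⊓ W x ≤ U) s)
  have h1 := congrArg (res (inf_le_inf_right (W x) h)) ha
  have h2 := congrArg (res (inf_le_left : V ⊓ W x ≤ V)) h0
  rw [res_smul, res_res, res_res] at h1
  rw [res_res, res_zero] at h2
  have h3 : resHom (inf_le_inf_right (W x) h) a = 0 := by
    refine (ht x).eq_of_smul_eq (inf_le_right : V ⊓ W x ≤ _) ?_
    rw [h1, h2, zero_smul]
  rw [map_eq_zero_iff _ (resHom_injective _)] at h3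
  rw [← ha, h3, zero_smul, res_zero]

/-- On an affine open set, a rational section is a fraction times a generator. -/
lemma exists_fraction [IsLocallyNoetherian X] {M : X.Modules} (hM : IsInvertible M) {U : X.Opens}
    [Nonempty U] {s : Γ(M, U)} (hs : s ≠ 0) {E : WeilDivisor X ℤ} (hE : IsDivisorOfSection s E)
    {V : X.Opens} [Nonempty V] (hV : IsAffineOpen V) {t : Γ(M, V)} (ht : Trivializes t) :
    ∃ a b : Γ(X, V), a ≠ 0 ∧ b ≠ 0 ∧
      resHom (inf_le_right : U ⊓ V ≤ V) b • res (inf_le_left : U ⊓ V ≤ U) s =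
        resHom (inf_le_right : U ⊓ V ≤ V) a • res (inf_le_right : U ⊓ V ≤ V) t ∧
      ∀ x ∈ V, E.coeff x = Scheme.ord (X.germToFunctionField V a) x -
        Scheme.ord (X.germToFunctionField V b) x := by
  have := nonempty_inf U V
  obtain ⟨h, hh⟩ := ht.exists_smul_eq inf_le_right (res (inf_le_left : U ⊓ V ≤ U) s)
  have h0 : h ≠ 0 := by
    rintro rfl
    rw [zero_smul] at hh
    exact res_ne_zero hM inf_le_left hs hh.symm
  have := functionField_isFractionRing_of_isAffineOpen X V hV
  obtain ⟨a, b, hb, hab⟩ := IsFractionRing.div_surjective (A := Γ(X, V))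
    (X.germToFunctionField (U ⊓ V) h)
  change X.germToFunctionField V a / X.germToFunctionField V b = _ at hab
  have hb0 : b ≠ 0 := nonZeroDivisors.ne_zero hb
  have hgb : X.germToFunctionField V b ≠ 0 := by
    rwa [ne_eq, map_eq_zero_iff _ (X.germToFunctionField_injective V)]
  have hgh : X.germToFunctionField (U ⊓ V) h ≠ 0 := by
    rwa [ne_eq, map_eq_zero_iff _ (X.germToFunctionField_injective (U ⊓ V))]
  have hab' : X.germToFunctionField V a =
      X.germToFunctionField V b * X.germToFunctionField (U ⊓ V) h := by
    rw [← hab, mul_div_cancel₀ _ hgb]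
  have ha0 : a ≠ 0 := by
    rintro rfl
    rw [map_zero] at hab'
    exact mul_ne_zero hgb hgh hab'.symm
  refine ⟨a, b, ha0, hb0, ?_, fun x hx => ?_⟩
  · rw [← hh, smul_smul]
    congr 1
    refine X.germToFunctionField_injective (U ⊓ V) ?_
    rw [map_mul, germToFunctionField_resHom, germToFunctionField_resHom, hab']
  · rw [hab', Scheme.ord_mul hgb hgh, add_sub_cancel_left]
    exact hE V t ht _ h hh.symm x hx

end RationalSections

section

variable {X Y : Scheme.{u}} {π : X ⟶ Y} [QuasiCompact π] [IsSchemeTheoreticallyDominant π]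
  {L : X.Modules} {ι : Type*} {U : ι → X.Opens} {V : ι → Y.Opens}

/-- Both sides are multiples of the generator `m.τ i`; their coefficients agree after pullback,
hence agree. This carries the presentation of a rational section as a fraction over to the model. -/
lemma SheafModel.smul_res_eq {hUV : ∀ i, π ⁻¹ᵁ V i = U i} {t : ∀ i, Γ(L, U i)}
    (ht : ∀ i, Trivializes (t i)) (m : SheafModel π L hUV t) {W : X.Opens} {W' : Y.Opens}
    (hW : π ⁻¹ᵁ W' = W) {i₀ : ι} (hWU : W ≤ U i₀) (hWV : W' ≤ V i₀) {f : Γ(X, W)} {f' : Γ(Y, W')}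
    (hf' : IsLift π f' f) {i : ι} {a b : Γ(X, U i)}
    (hab : resHom (inf_le_right : W ⊓ U i ≤ U i) b • res (inf_le_left : W ⊓ U i ≤ W) (f • res hWU (t i₀)) =
      resHom (inf_le_right : W ⊓ U i ≤ U i) a •
        res (inf_le_right : W ⊓ U i ≤ U i) (t i))
    {α β : Γ(Y, V i)} (hα : IsLift π α a) (hβ : IsLift π β b) :
    resHom (inf_le_right : W' ⊓ V i ≤ V i) β • res (inf_le_left : W' ⊓ V i ≤ W') (f' • res hWV (m.τ i₀)) =
      resHom (inf_le_right : W' ⊓ V i ≤ V i) α • res (inf_le_right : W' ⊓ V i ≤ V i) (m.τ i) := by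
  obtain rfl : (fun i => π ⁻¹ᵁ V i) = U := funext hUV
  subst hW
  have hlift : ∀ {V₁ : Y.Opens} {γ : Γ(Y, V₁)} {c : Γ(X, π ⁻¹ᵁ V₁)}, IsLift π γ c →
      π.app V₁ γ = c := by
    rintro V₁ γ c ⟨_, h⟩
    rw [Scheme.Hom.app_eq_appLE]
    exact h
  have hres : ∀ {V₁ V₂ : Y.Opens} (h : V₂ ≤ V₁) (γ : Γ(Y, V₁)),
      π.app V₂ (resHom h γ) = resHom (π.preimage_mono h) (π.app V₁ γ) := fun h γ =>
    congr($(π.naturality (homOfLE h).op) γ)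
  obtain ⟨h', hh'⟩ := (m.trivializes i).exists_smul_eq inf_le_right
    (res (inf_le_left : W' ⊓ V i ≤ W') (f' • res hWV (m.τ i₀)))
  have h1 := congrArg (m.ψ.app (W' ⊓ V i)) hh'
  rw [Scheme.Modules.Hom.app_smul, app_res, app_res, Scheme.Modules.Hom.app_smul, app_res, m.app_τ,
    m.app_τ, res_self, res_self] at h1
  have h2 : π.app (W' ⊓ V i) h' • res (π.preimage_mono inf_le_right) (t i) =
      res (π.preimage_mono inf_le_left) (f • res hWU (t i₀)) := by
    rw [← hlift hf']
    exact h1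
  rw [← hh', smul_smul]
  congr 1
  refine π.app_injective _ ?_
  rw [map_mul, hres, hres, hlift hα, hlift hβ]
  refine (ht i).eq_of_smul_eq (π.preimage_mono inf_le_right) ?_
  rw [mul_smul, h2]
  exact hab

end

/-! ### Divisors of descended rational sections -/

section DescendedSections

variable {X Y : Scheme.{u}} [IsIntegral X] [IsLocallyNoetherian X] [IsIntegral Y]
  [IsLocallyNoetherian Y] {π : X ⟶ Y} [Flat π] [QuasiCompact π] [IsSchemeTheoreticallyDominant π]
  {L : X.Modules} {ι : Type*} {U : ι → X.Opens} {V : ι → Y.Opens}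

/-- On `V i` the divisor `E'` is that of `α i / β i`, by `IsLift.ord_sub_ord_eq`. Another generator
`t₁` is a unit `c` times `m.τ i`, so its coefficient `f₁` satisfies `β i * f₁ * c = α i` and has the
same order. -/
lemma SheafModel.isDivisorOfSection {hUV : ∀ i, π ⁻¹ᵁ V i = U i} (hV : ⨆ i, V i = ⊤)
    {t : ∀ i, Γ(L, U i)} (ht : ∀ i, Trivializes (t i)) (m : SheafModel π L hUV t)
    {E : WeilDivisor X ℤ} {E' : WeilDivisor Y ℤ} (hEE' : IsPullbackDivisor π E' E)
    (hE' : ∀ y, y ∉ Set.range π → E'.coeff y = 0) {W : X.Opens} {W' : Y.Opens}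
    (hW : π ⁻¹ᵁ W' = W) [Nonempty W'] {i₀ : ι} (hWU : W ≤ U i₀) (hWV : W' ≤ V i₀) {f : Γ(X, W)}
    (hf : f ≠ 0) {f' : Γ(Y, W')} (hf' : IsLift π f' f) [∀ i, Nonempty (U i)]
    {a b : ∀ i, Γ(X, U i)} (ha : ∀ i, a i ≠ 0) (hb : ∀ i, b i ≠ 0)
    (hab : ∀ i, resHom (inf_le_right : W ⊓ U i ≤ U i) (b i) • res (inf_le_left : W ⊓ U i ≤ W)
      (f • res hWU (t i₀)) = resHom (inf_le_right : W ⊓ U i ≤ U i) (a i) •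
        res (inf_le_right : W ⊓ U i ≤ U i) (t i))
    (hE : ∀ i, ∀ x ∈ U i, E.coeff x = Scheme.ord (X.germToFunctionField (U i) (a i)) x -
      Scheme.ord (X.germToFunctionField (U i) (b i)) x)
    {α β : ∀ i, Γ(Y, V i)} (hα : ∀ i, IsLift π (α i) (a i)) (hβ : ∀ i, IsLift π (β i) (b i))
    (hgα : ∀ i, IsGood π (Y.basicOpen (α i))) (hgβ : ∀ i, IsGood π (Y.basicOpen (β i))) :
    f' • res hWV (m.τ i₀) ≠ 0 ∧ IsDivisorOfSection (f' • res hWV (m.τ i₀)) E' := by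
  constructor
  · intro h0
    refine hf'.ne_zero hf ((m.trivializes i₀).eq_of_smul_eq hWV ?_)
    rw [h0, zero_smul]
  · intro V₁ t₁ ht₁ hne f₁ hf₁ x hx
    have hxi : x ∈ ⨆ i, V i := hV ▸ trivial
    obtain ⟨i, hi⟩ := Opens.mem_iSup.1 hxi
    have : Nonempty V₁ := ⟨⟨x, hx⟩⟩
    have : Nonempty (V i) := ⟨⟨x, hi⟩⟩
    have : Nonempty (V₁ ⊓ V i : Y.Opens) := ⟨⟨x, hx, hi⟩⟩
    have := nonempty_inf W' (V i)
    have := nonempty_inf (W' ⊓ V₁) (V i)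
    rw [hα i |>.ord_sub_ord_eq (D := E.coeff) (E := E'.coeff) hEE' E'.2 hE' (hUV i) (hβ i) (ha i)
      (hb i) (hgα i) (hgβ i) (hE i) hi]
    obtain ⟨c, hc⟩ := (m.trivializes i).exists_smul_eq inf_le_right
      (res (inf_le_left : V₁ ⊓ V i ≤ _) t₁)
    have hcu : IsUnit c := by
      rw [← ((m.trivializes i).res (inf_le_right : V₁ ⊓ V i ≤ V i)).smul_iff, hc]
      exact ht₁.res _
    have hkey := m.smul_res_eq ht hW hWU hWV hf' (hab i) (hα i) (hβ i)
    generalize f' • res hWV (m.τ i₀) = s' at hkey hf₁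
    have h1 := congrArg (res (inf_le_inf_right (V i) inf_le_left :
      (W' ⊓ V₁) ⊓ V i ≤ W' ⊓ V i)) hkey
    have h2 := congrArg (res (inf_le_left : (W' ⊓ V₁) ⊓ V i ≤ W' ⊓ V₁)) hf₁
    have h3 := congrArg (res (inf_le_inf_right (V i) inf_le_right :
      (W' ⊓ V₁) ⊓ V i ≤ V₁ ⊓ V i)) hc
    rw [res_smul, res_smul, res_res, res_res, resHom_resHom, resHom_resHom] at h1
    rw [res_smul inf_le_left f₁, res_res, res_res] at h2
    rw [res_smul, res_res, res_res] at h3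
    rw [h2, ← h3, smul_smul, smul_smul] at h1
    have h4 := congrArg (Y.germToFunctionField _) ((m.trivializes i).eq_of_smul_eq _ h1)
    rw [map_mul, map_mul, germToFunctionField_resHom, germToFunctionField_resHom,
      germToFunctionField_resHom, germToFunctionField_resHom, mul_assoc] at h4
    have hα0 : Y.germToFunctionField (V i) (α i) ≠ 0 := by
      rw [ne_eq, map_eq_zero_iff _ (Y.germToFunctionField_injective _)]
      exact (hα i).ne_zero (ha i)
    have hβ0 : Y.germToFunctionField (V i) (β i) ≠ 0 := fun h => hα0 (by
      rw [← h4, h, zero_mul])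
    have hf0 : Y.germToFunctionField (W' ⊓ V₁) f₁ ≠ 0 := fun h => hα0 (by
      rw [← h4, h, zero_mul, mul_zero])
    have hc0 : Y.germToFunctionField (V₁ ⊓ V i) c ≠ 0 := fun h => hα0 (by
      rw [← h4, h, mul_zero, mul_zero])
    rw [← h4, Scheme.ord_mul hβ0 (mul_ne_zero hf0 hc0), Scheme.ord_mul hf0 hc0,
      Scheme.ord_of_isUnit hcu ⟨hx, hi⟩, add_zero, add_sub_cancel_left]

end DescendedSections

/-! ### Invertible sheaves over all large subalgebras -/

section

open Filter

lemma exists_affine_trivialization {X : Scheme.{u}} [CompactSpace X] {M : X.Modules}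
    (hM : IsInvertible M) : ∃ (ι : Type u) (_ : Finite ι) (U : ι → X.Opens) (t : ∀ i, Γ(M, U i)),
      (∀ i, IsAffineOpen (U i)) ∧ (∀ i, Nonempty (U i)) ∧ ⨆ i, U i = ⊤ ∧
        ∀ i, Trivializes (t i) := by
  have h : ∀ x : X, ∃ U : X.Opens, x ∈ U ∧ IsAffineOpen U ∧ ∃ t : Γ(M, U), Trivializes t := by
    intro x
    obtain ⟨U, hxU, t, ht⟩ := hM x
    obtain ⟨V, hV, hxV, hVU⟩ := exists_isAffineOpen_mem_and_subset hxU
    exact ⟨V, hxV, hV, res hVU t, ht.res hVU⟩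
  choose U hxU hU t ht using h
  obtain ⟨S, hS⟩ := CompactSpace.elim_nhds_subcover (fun x => (U x : Set X))
    fun x => (U x).2.mem_nhds (hxU x)
  refine ⟨S, inferInstance, fun x => U x, fun x => t x, fun x => hU x, fun x => ⟨⟨x, hxU x⟩⟩, ?_,
    fun x => ht x⟩
  refine Opens.ext ?_
  rw [Opens.coe_iSup, Opens.coe_top, ← Set.top_eq_univ, ← hS]
  exact (Set.biUnion_eq_iUnion (S : Set X) fun x _ => (U x : Set X)).symm

section SheafEventually

variable {n : ℕ} {Δ : Fan n} {K : Type u} [Field K]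
  [hfg : ∀ σ : Δ.cones, AddMonoid.FG (dualMonoid σ.1)] {L : (toricVariety Δ K).Modules}
  {ι : Type u} [Finite ι] {U : ι → (toricVariety Δ K).Opens}

lemma eventually_iSup_spread (hU : ⨆ i, U i = ⊤) : ∀ᶠ A in atTop, ⨆ i, spread (U i) A = ⊤ := by
  have h1 := SpreadsTo.iSup fun i => spreadsTo_spread (U i)
  rw [hU] at h1
  exact h1.eventually_eq spreadsTo_top

lemma eventually_sheafModel (hU : ⨆ i, U i = ⊤) {t : ∀ i, Γ(L, U i)}
    (ht : ∀ i, Trivializes (t i)) : ∀ᶠ A in atTop,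
      ∃ hUV : ∀ i, proj Δ K A ⁻¹ᵁ spread (U i) A = U i,
        Nonempty (SheafModel (proj Δ K A) L hUV t) := by
  choose g hg using fun i j => (ht j).exists_smul_eq inf_le_right
    (res (inf_le_left : U i ⊓ U j ≤ U i) (t i))
  filter_upwards [eventually_iSup_spread hU,
    eventually_all.2 fun i => (spreadsTo_spread (U i)).eventually_proj,
    eventually_all.2 fun i => eventually_all.2 fun j =>
      ((spreadsTo_spread (U i)).inf (spreadsTo_spread (U j))).eventually_exists_isLift
        (g i j)] with A h1 h2 h3
  exact ⟨h2, nonempty_sheafModel h2 h1 ht (fun i j => (hg i j).symm) h3⟩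

/-- Finitely many sections of positive powers have affine loci covering `X`. Their coefficients
lift, the lifts glue to sections on the model, and for large `A` the loci of these are the spreads
of the original loci, hence affine and covering. -/
lemma eventually_isAmple (hL : IsAmple L) (hU : ⨆ i, U i = ⊤) {t : ∀ i, Γ(L, U i)}
    (ht : ∀ i, Trivializes (t i)) : ∀ᶠ A in atTop,
      ∀ (hUV : ∀ i, proj Δ K A ⁻¹ᵁ spread (U i) A = U i)
        (m : SheafModel (proj Δ K A) L hUV t), IsAmple m.M := by
  have hcK : CompactSpace (toricVariety Δ K) := compactSpace_toricVariety Δ K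
  choose k hk s hxs hsa using hL.2.2
  obtain ⟨S, hS⟩ := CompactSpace.elim_nhds_subcover
    (fun x => (nonvanishingLocus (s x) : Set (toricVariety Δ K)))
    fun x => (nonvanishingLocus (s x)).2.mem_nhds (hxs x)
  have hcov : (⨆ x : S, nonvanishingLocus (s x)) = ⊤ := by
    refine Opens.ext ?_
    rw [Opens.coe_iSup, Opens.coe_top, ← Set.top_eq_univ, ← hS]
    exact (Set.biUnion_eq_iUnion (S : Set (toricVariety Δ K)) fun x _ =>
      (nonvanishingLocus (s x) : Set (toricVariety Δ K))).symm
  have hdata : ∀ (x : S) (i : ι), ∃ a : Γ(toricVariety Δ K, U i),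
      res le_top (s x) = a • tpow (t i) (k x) := by
    intro x i
    obtain ⟨a, ha⟩ := ((ht i).tpow (k x)).exists_smul_eq le_rfl (res le_top (s x.1))
    rw [res_self] at ha
    exact ⟨a, ha.symm⟩
  choose a ha using hdata
  have hloc : ∀ x : S, nonvanishingLocus (s x) = ⨆ i, (toricVariety Δ K).basicOpen (a x i) :=
    fun x => nonvanishingLocus_eq_iSup hU (fun i => (ht i).tpow (k x)) (ha x)
  have hspread : ∀ x : S, ∀ᶠ A in atTop,
      ⨆ i, spread ((toricVariety Δ K).basicOpen (a x i)) A = spread (nonvanishingLocus (s x)) A := by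
    intro x
    have h1 := SpreadsTo.iSup fun i => spreadsTo_spread ((toricVariety Δ K).basicOpen (a x i))
    rw [← hloc] at h1
    exact h1.eventually_eq (spreadsTo_spread _)
  filter_upwards [eventually_iSup_spread hU, eventually_iSup_spread hcov,
    eventually_all.2 fun x : S => eventually_isAffineOpen_spread (hsa x),
    eventually_all.2 hspread,
    eventually_all.2 fun x : S => eventually_all.2 fun i =>
      (spreadsTo_spread (U i)).eventually_exists_isLift (a x i),
    eventually_all.2 fun x : S => eventually_all.2 fun i =>
      (spreadsTo_spread (U i)).eventually_basicOpen (a x i)] with A h1 h2 h3 h4 h5 h6 hUV m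
  have hcA : CompactSpace (toricVariety Δ A.1) := compactSpace_toricVariety Δ A.1
  refine isAmple_of_sections h1 m.trivializes h2 h3 fun x => ?_
  choose α hα using h5 x
  obtain ⟨s', hs'⟩ := m.exists_section h1 ht (ha x) hα
  refine ⟨k x, hk x, s', ?_⟩
  rw [hs', ← h4 x]
  exact iSup_congr fun i => h6 x i (α i) (hα i)

/-- On each affine open set `U i` the rational section is a fraction times a generator. Numerators
and denominators lift to `A`, without zeros at vertical points of codimension one when `A` is large.
-/
lemma eventually_isDivisorOfSection (hL : IsInvertible L) (hUa : ∀ i, IsAffineOpen (U i))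
    [∀ i, Nonempty (U i)] (hU : ⨆ i, U i = ⊤) {t : ∀ i, Γ(L, U i)} (ht : ∀ i, Trivializes (t i))
    {U₀ : (toricVariety Δ K).Opens} [Nonempty U₀] {s : Γ(L, U₀)} (hs : s ≠ 0)
    {E : WeilDivisor (toricVariety Δ K) ℤ} (hE : IsDivisorOfSection s E) : ∀ᶠ A in atTop,
      ∀ (hUV : ∀ i, proj Δ K A ⁻¹ᵁ spread (U i) A = U i)
        (m : SheafModel (proj Δ K A) L hUV t) (E' : WeilDivisor (toricVariety Δ A.1) ℤ),
        IsPullbackDivisor (proj Δ K A) E' E →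
        (∀ y, y ∉ Set.range (proj Δ K A) → E'.coeff y = 0) →
          ∃ (W : (toricVariety Δ A.1).Opens) (s' : Γ(m.M, W)),
            (W : Set (toricVariety Δ A.1)).Nonempty ∧ s' ≠ 0 ∧ IsDivisorOfSection s' E' := by
  choose a b ha hb hab hord using fun i => exists_fraction hL hs hE (hUa i) (ht i)
  obtain ⟨x₀⟩ := (inferInstance : Nonempty U₀)
  have hx₀ : x₀.1 ∈ ⨆ i, U i := hU ▸ trivial
  -- On `U₀ ⊓ U i₀` the section is `f` times a generator, so that descending it amounts to
  -- descending the function `f`.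
  obtain ⟨i₀, hi₀⟩ := Opens.mem_iSup.1 hx₀
  have hW := nonempty_inf U₀ (U i₀)
  obtain ⟨f, hf⟩ := (ht i₀).exists_smul_eq (inf_le_right : U₀ ⊓ U i₀ ≤ _)
    (res (inf_le_left : U₀ ⊓ U i₀ ≤ U₀) s)
  have hf0 : f ≠ 0 := by
    rintro rfl
    rw [zero_smul] at hf
    exact res_ne_zero hL inf_le_left hs hf.symm
  have hab' : ∀ i, resHom (inf_le_right : (U₀ ⊓ U i₀) ⊓ U i ≤ U i) (b i) •
      res (inf_le_left : (U₀ ⊓ U i₀) ⊓ U i ≤ U₀ ⊓ U i₀) (f • res inf_le_right (t i₀)) =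
        resHom (inf_le_right : (U₀ ⊓ U i₀) ⊓ U i ≤ U i) (a i) •
          res (inf_le_right : (U₀ ⊓ U i₀) ⊓ U i ≤ U i) (t i) := by
    intro i
    have h1 := congrArg (res (inf_le_inf_right (U i) inf_le_left :
      (U₀ ⊓ U i₀) ⊓ U i ≤ U₀ ⊓ U i)) (hab i)
    rw [res_smul, res_smul, res_res, res_res, resHom_resHom, resHom_resHom] at h1
    rw [hf, res_res]
    exact h1
  filter_upwards [eventually_iSup_spread hU,
    (spreadsTo_spread (U₀ ⊓ U i₀)).eventually_proj,
    (spreadsTo_spread (U₀ ⊓ U i₀)).eventually_le (spreadsTo_spread (U i₀)) inf_le_right,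
    (spreadsTo_spread (U₀ ⊓ U i₀)).eventually_exists_isLift f,
    eventually_all.2 fun i => (spreadsTo_spread (U i)).eventually_exists_isLift (a i),
    eventually_all.2 fun i => (spreadsTo_spread (U i)).eventually_exists_isLift (b i),
    eventually_all.2 fun i => (spreadsTo_spread (U i)).eventually_basicOpen (a i),
    eventually_all.2 fun i => (spreadsTo_spread (U i)).eventually_basicOpen (b i),
    eventually_all.2 fun i => eventually_isGood_spread (nonempty_basicOpen (ha i)),
    eventually_all.2 fun i => eventually_isGood_spread (nonempty_basicOpen (hb i))]
    with A h1 h2 h3 h4 h5 h6 h7 h8 h9 h10 hUV m E' hE1 hE2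
  obtain ⟨f', hf'⟩ := h4
  choose α hα using h5
  choose β hβ using h6
  have hne : Nonempty (spread (U₀ ⊓ U i₀) A) := by
    obtain ⟨x⟩ := hW
    exact ⟨⟨proj Δ K A x.1, (h2.ge x.2 :)⟩⟩
  obtain ⟨h11, h12⟩ := m.isDivisorOfSection h1 ht hE1 hE2 h2 inf_le_right h3 hf0 hf' ha hb hab' hord
    hα hβ (fun i => h7 i _ (hα i) ▸ h9 i) (fun i => h8 i _ (hβ i) ▸ h10 i)
  exact ⟨_, _, ⟨hne.some.1, hne.some.2⟩, h11, h12⟩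

end SheafEventually

end

end ToricModel

end

/-! ### The theorem -/

open ToricModel
theorem theorem3p6 {K : Type u} [Field K] [CharZero K] {n : ℕ} (Δ : Fan n)
    (hX : IsProper (toricStr Δ K))
    (D : WeilDivisor (toricVariety Δ K) ℤ) (hD : IsEffective D)
    (L : (toricVariety Δ K).Modules) (hL : IsAmple L)
    (H : WeilDivisor (toricVariety Δ K) ℚ)
    (hH : IsAmpleQDivisor H) :
    ∃ A : Subalgebra ℤ K, A.FG ∧
      IsProper (toricStr Δ A) ∧
      IsPullback (toricMap Δ (algebraMap A K)) (toricStr Δ K)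
        (toricStr Δ A) (Spec.map (CommRingCat.ofHom (algebraMap A K))) ∧
      ∃ (𝒟 : WeilDivisor (toricVariety Δ A) ℤ)
        (ℒ : (toricVariety Δ A).Modules)
        (ℋ : WeilDivisor (toricVariety Δ A) ℚ),
        IsEffective 𝒟 ∧
        (IsEffectiveCartier D → IsEffectiveCartier 𝒟) ∧
        IsAmple ℒ ∧
        IsAmpleQDivisor ℋ ∧
        IsPullbackDivisor (toricMap Δ (algebraMap A K)) 𝒟 D ∧
        Nonempty ((Scheme.Modules.pullback (toricMap Δ (algebraMap A K))).obj ℒ ≅ L) ∧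
        IsPullbackDivisor (toricMap Δ (algebraMap A K)) ℋ H := by
  have hfg : ∀ σ : Δ.cones, AddMonoid.FG (dualMonoid σ.1) :=
    fun σ => fg_dualMonoid_of_locallyOfFiniteType Δ K σ
  have hS := Δ.separates_of_isSeparated K
  have hC := Δ.isComplete_of_universallyClosed K
  have hcK : CompactSpace (toricVariety Δ K) := compactSpace_toricVariety Δ K
  obtain ⟨_, _, m, E, M, U₀, s, hm, hEH, hM, hU₀, hs, hE⟩ := hH
  have : Nonempty U₀ := hU₀.to_subtype
  obtain ⟨ι, _, U, t, hUa, hUne, hU, ht⟩ := exists_affine_trivialization hL.2.1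
  obtain ⟨κ, _, W, r, hWa, hWne, hW, hr⟩ := exists_affine_trivialization hM.2.1
  -- The Cartier hypothesis is kept inside the eventual statement, so that a single choice of `A`
  -- serves whether or not `D` is Cartier.
  have hcartier : ∀ᶠ A in Filter.atTop, IsEffectiveCartier D →
      ∀ D' : WeilDivisor (toricVariety Δ A.1) ℤ, IsPullbackDivisor (proj Δ K A) D' D →
        (∀ y, y ∉ Set.range (proj Δ K A) → D'.coeff y = 0) → IsEffectiveCartier D' := by
    by_cases hDC : IsEffectiveCartier D
    · filter_upwards [eventually_isEffectiveCartier hDC] with A h _ using h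
    · exact Filter.Eventually.of_forall fun A h => absurd h hDC
  obtain ⟨A, hDd, hHd, hEd, ⟨hUV, ⟨mL⟩⟩, hmL, ⟨hWV, ⟨mM⟩⟩, hmM, hdiv, hcart⟩ :=
    ((eventually_isDescended_of_coeff_ne_zero D).and
    ((eventually_isDescended_of_coeff_ne_zero H).and
    ((eventually_isDescended_of_coeff_ne_zero E).and
    ((eventually_sheafModel hU ht).and
    ((eventually_isAmple hL hU ht).and
    ((eventually_sheafModel hW hr).and
    ((eventually_isAmple hM hW hr).and
    ((eventually_isDivisorOfSection hM.2.1 hWa hW hr hs hE).and hcartier)))))))).exists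
  have codim : ∀ {x : toricVariety Δ K}, Order.coheight x = 1 → IsDescended (proj Δ K A) x →
      Order.coheight (proj Δ K A x) = 1 := fun hx hd => hd.coheight_eq hx
  have hD' := fun x hx => codim (D.2 x hx) (hDd x hx)
  have hH' := fun x hx => codim (H.2 x hx) (hHd x hx)
  have hE' := fun x hx => codim (E.2 x hx) (hEd x hx)
  -- The integral multiple `E` of `H` is descended along with `H`; it is the divisor of the
  -- descended rational section and witnesses ampleness.
  obtain ⟨W', s', hW', hs', hE''⟩ := hdiv hWV mM (descend (proj Δ K A) E hE')
    (isPullbackDivisor_descend hEd hE') fun y hy => descend_eq_zero hE' hy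
  refine ⟨A.1, A.2, isProper_toricStr Δ A.1 hS hC hfg, isPullback_toricMap Δ (algebraMap A.1 K),
    descend (proj Δ K A) D hD', mL.M, descend (proj Δ K A) H hH', isEffective_descend hDd hD' hD,
    fun hDC => hcart hDC _ (isPullbackDivisor_descend hDd hD') fun y hy => descend_eq_zero hD' hy,
    hmL hUV mL, ?_, isPullbackDivisor_descend hDd hD', mL.nonempty_iso,
    isPullbackDivisor_descend hHd hH'⟩
  exact ⟨inferInstance, inferInstance, m, descend (proj Δ K A) E hE', mM.M, W', s', hm,
    descend_mul hm hEH hHd hEd hH' hE', hmM hWV mM, hW', hs', hE''⟩
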